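/- Let $\Lambda=(\mathbb R/2\pi\mathbb Z)^2$, let $\mathbf e_k(x)=\frac1{2\pi}e^{\sqrt{-1}\,k\cdot x}$ for $k\in\mathbb Z^2$, let $\mathcal D'(\Lambda)$ be the space of real distributions on $\Lambda$ with the weak-* topology and its Borel $\sigma$-algebra, and for $s\in\mathbb R$ let $H^s=\{u\in\mathcal D'(\Lambda):\|u\|_{H^s}^2=\sum_k(1+|k|^2)^s|\langle u,\mathbf e_k\rangle|^2<\infty\}$. The massive Gaussian free field is the centered Gaussian measure $\mu_0$ on $\mathcal D'(\Lambda)$ with covariance $(1-\Delta)^{-1}$, i.e. $\int\langle\phi,\mathbf e_k\rangle\overline{\langle\phi,\mathbf e_l\rangle}\,\mu_0(d\phi)=(1+|k|^2)^{-1}\mathbf 1_{k=l}$; such a measure exists. Let $\psi:\mathbb R^2\to[0,1]$ be a Borel function with $\psi(-x)=\psi(x)$, $\psi(0)=1$, $\sup_{x\ne0}|x|^{-\theta}|\psi(x)-1|<\infty$ for some $\theta\in(0,1)$ and $\sup_x|x|^m|\psi(x)|<\infty$ for some $m\ge4$. For $N\in\mathbb N$ put $$P_N\phi(x)=\sum_{k\in\mathbb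 Z^2}\psi(2^{-N}k)\langle\phi,\mathbf e_k\rangle\mathbf e_k(x),\qquad C_N=\frac1{4\pi^2}\sum_{k\in\mathbb Z^2}\frac{\psi(2^{-N}k)^2}{1+|k|^2},\qquad \exp_N^\diamond(\alpha\phi)(x)=\exp\Big(\alpha P_N\phi(x)-\frac{\alpha^2}2C_N\Big),$$ $$\mu_N^{(\alpha)}(d\phi)=\frac1{Z_N^{(\alpha)}}\exp\Big(-\int_\Lambda\exp_N^\diamond(\alpha\phi)(x)\,dx\Big)\mu_0(d\phi),\qquad \mu^{(\alpha)}(d\phi)=\frac1{Z^{(\alpha)}}\exp\Big(-\int_\Lambda\exp^\diamond(\alpha\phi)(x)\,dx\Big)\mu_0(d\phi),$$ where $\exp^\diamond(\alpha\phi)$ is the limit of $\exp_N^\diamond(\alpha\phi)$ as a distribution, $\int_\Lambda\exp^\diamond(\alpha\phi)(x)\,dx$ is its pairing with the constant function $1$, and $Z_N^{(\alpha)}$, $Z^{(\alpha)}$ are the normalizing constants. **Corollary.** Let $|\alpha|<\sqrt{4\pi}$. Then the $\exp(\Phi)_2$-measure $\mu^{(\alpha)}$ is well defined: for every $\beta\in(\frac{\alpha^2}{4\pi},1)$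 and $\mu_0$-almost every $\phi$, the sequence $\exp_N^\diamond(\alpha\phi)$ converges to $\exp^\diamond(\alpha\phi)$ in $H^{-\beta}$; up to $\mu_0$-null sets $\exp^\diamond(\alpha\,\cdot)$ does not depend on the choice of $\psi$, and neither does $\mu^{(\alpha)}$; and $\mu_N^{(\alpha)}$ ($N\in\mathbb N$) and $\mu^{(\alpha)}$ are probability measures. Moreover: 1. $\mu_N^{(\alpha)}\to\mu^{(\alpha)}$ weakly as $N\to\infty$, both on $\mathcal D'(\Lambda)$ and, for every $\varepsilon>0$, on $H^{-\varepsilon}$ with its norm topology. 2. $\mu^{(\alpha)}$ is absolutely continuous with respect to $\mu_0$. In particular, for every $\varepsilon>0$, $\mu^{(\alpha)}$ is supported in $H^{-\varepsilon}$, i.e. $\mu^{(\alpha)}(\mathcal D'(\Lambda)\setminus H^{-\varepsilon})=0$, and likewise for every $\mu_N^{(\alpha)}$. 3. Every $\mu_N^{(\alpha)}$ is absolutely continuous with respect to $\mu_0$, and the densities $d\mu_N^{(\alpha)}/d\mu_0$ are bounded $\mu_0$-almost everywhere by a constant that does not depend on $N$. -/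

import Mathlib

open MeasureTheory Filter Set Topology
open scoped ENNReal NNReal ContDiff

noncomputable section

namespace ExpPhi

/-! ### The torus `Λ = (ℝ / 2πℤ)²`, smooth functions and distributions on it

Functions on `Λ` are functions on `ℝ × ℝ` that are `2π`-periodic in each variable. -/

/-- The space `C^∞(Λ; ℝ)`. -/
def TestFn : Submodule ℝ (ℝ × ℝ → ℝ) where
  carrier := {f | ContDiff ℝ ∞ f ∧ (∀ x, f (x + (2 * Real.pi, 0)) = f x) ∧
    ∀ x, f (x + (0, 2 * Real.pi)) = f x}
  add_mem' := by
    rintro f g ⟨hf, hf1, hf2⟩ ⟨hg, hg1, hg2⟩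
    exact ⟨hf.add hg, fun x => by simp only [Pi.add_apply, hf1, hg1],
      fun x => by simp only [Pi.add_apply, hf2, hg2]⟩
  zero_mem' := ⟨contDiff_const, fun _ => rfl, fun _ => rfl⟩
  smul_mem' := by
    rintro c f ⟨hf, hf1, hf2⟩
    exact ⟨contDiff_const.smul hf, fun x => by simp only [Pi.smul_apply, hf1],
      fun x => by simp only [Pi.smul_apply, hf2]⟩

theorem bddAbove_of_periodic {g : ℝ × ℝ → ℝ} (hg : Continuous g)
    (h1 : ∀ x, g (x + (2 * Real.pi, 0)) = g x) (h2 : ∀ x, g (x + (0, 2 * Real.pi)) = g x) :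
    BddAbove (range g) := by
  have hK : IsCompact (Icc (0 : ℝ) (2 * Real.pi) ×ˢ Icc (0 : ℝ) (2 * Real.pi)) :=
    isCompact_Icc.prod isCompact_Icc
  obtain ⟨C, hC⟩ := (hK.image hg).bddAbove
  refine ⟨C, ?_⟩
  rintro _ ⟨⟨a, b⟩, rfl⟩
  have p1 : ∀ b, Function.Periodic (fun a => g (a, b)) (2 * Real.pi) := fun b a => by
    simpa using h1 (a, b)
  have p2 : ∀ a, Function.Periodic (fun b => g (a, b)) (2 * Real.pi) := fun a b => by
    simpa using h2 (a, b)
  obtain ⟨a', ha', e1⟩ := (p1 b).exists_mem_Ico₀ Real.two_pi_pos a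
  obtain ⟨b', hb', e2⟩ := (p2 a').exists_mem_Ico₀ Real.two_pi_pos b
  have e : g (a, b) = g (a', b') := e1.trans e2
  rw [e]
  exact hC ⟨(a', b'), ⟨Ico_subset_Icc_self ha', Ico_subset_Icc_self hb'⟩, rfl⟩

theorem testFn_contDiff (f : TestFn) : ContDiff ℝ ∞ (f : ℝ × ℝ → ℝ) := f.2.1

theorem testFn_bddAbove (f : TestFn) (m : ℕ) :
    BddAbove (range fun x => ‖iteratedFDeriv ℝ m (f : ℝ × ℝ → ℝ) x‖) := by
  have key : ∀ a : ℝ × ℝ, (∀ x, (f : ℝ × ℝ → ℝ) (x + a) = (f : ℝ × ℝ → ℝ) x) →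
      ∀ x, iteratedFDeriv ℝ m (f : ℝ × ℝ → ℝ) (x + a)
        = iteratedFDeriv ℝ m (f : ℝ × ℝ → ℝ) x := by
    intro a ha x
    have := iteratedFDeriv_comp_add_right (𝕜 := ℝ) (f := (f : ℝ × ℝ → ℝ)) m a x
    rw [← this]
    congr 1
    exact funext ha
  refine bddAbove_of_periodic ?_ (fun x => by rw [key _ f.2.2.1]) (fun x => by rw [key _ f.2.2.2])
  exact ((testFn_contDiff f).continuous_iteratedFDeriv (by exact_mod_cast le_top)).norm

/-- The seminorm `f ↦ sup_x ‖D^m f(x)‖` on `C^∞(Λ)`. -/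
def testSeminorm (m : ℕ) : Seminorm ℝ TestFn :=
  Seminorm.of (fun f => ⨆ x, ‖iteratedFDeriv ℝ m (f : ℝ × ℝ → ℝ) x‖)
    (by
      intro f g
      refine ciSup_le fun x => ?_
      have hf : ContDiffAt ℝ m (f : ℝ × ℝ → ℝ) x :=
        ((testFn_contDiff f).of_le (by exact_mod_cast le_top)).contDiffAt
      have hg : ContDiffAt ℝ m (g : ℝ × ℝ → ℝ) x :=
        ((testFn_contDiff g).of_le (by exact_mod_cast le_top)).contDiffAt
      have e : iteratedFDeriv ℝ m ((f + g : TestFn) : ℝ × ℝ → ℝ) x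
          = iteratedFDeriv ℝ m (f : ℝ × ℝ → ℝ) x + iteratedFDeriv ℝ m (g : ℝ × ℝ → ℝ) x :=
        iteratedFDeriv_add_apply hf hg
      rw [e]
      exact (norm_add_le _ _).trans
        (add_le_add (le_ciSup (testFn_bddAbove f m) x) (le_ciSup (testFn_bddAbove g m) x)))
    (by
      intro c f
      rw [Real.mul_iSup_of_nonneg (norm_nonneg c)]
      congr 1
      funext x
      have hf : ContDiffAt ℝ m (f : ℝ × ℝ → ℝ) x :=
        ((testFn_contDiff f).of_le (by exact_mod_cast le_top)).contDiffAt
      have e : iteratedFDeriv ℝ m ((c • f : TestFn) : ℝ × ℝ → ℝ) x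
          = c • iteratedFDeriv ℝ m (f : ℝ × ℝ → ℝ) x := iteratedFDeriv_const_smul_apply hf
      rw [e, norm_smul])

def testSeminormFamily : SeminormFamily ℝ TestFn ℕ := testSeminorm

/-- The usual Fréchet topology of `C^∞(Λ)`: uniform convergence of all derivatives. -/
instance : TopologicalSpace TestFn := testSeminormFamily.moduleFilterBasis.topology

theorem withSeminorms_testFn : WithSeminorms testSeminormFamily := ⟨rfl⟩

/-- The space `𝒟'(Λ)` of real distributions, with the weak-* topology. -/
abbrev Dist : Type := WeakDual ℝ TestFn

instance : MeasurableSpace Dist := borel Dist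

instance : BorelSpace Dist := ⟨rfl⟩

/-- A fundamental domain of `Λ`. -/
def box : Set (ℝ × ℝ) := Ico 0 (2 * Real.pi) ×ˢ Ico 0 (2 * Real.pi)

theorem testFn_abs_le (f : TestFn) (x : ℝ × ℝ) :
    |(f : ℝ × ℝ → ℝ) x| ≤ testSeminormFamily 0 f := by
  have := le_ciSup (testFn_bddAbove f 0) x
  rw [norm_iteratedFDeriv_zero] at this
  exact this

theorem testFn_integrableOn_mul (f : TestFn) {g : ℝ × ℝ → ℝ} (hg : IntegrableOn g box) :
    IntegrableOn (fun x => g x * (f : ℝ × ℝ → ℝ) x) box :=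
  hg.mul_bdd (c := testSeminormFamily 0 f) (testFn_contDiff f).continuous.aestronglyMeasurable
    (Eventually.of_forall fun x => testFn_abs_le f x)

/-- The distribution `f ↦ ∫_Λ g(x) f(x) dx` of an integrable function `g`. -/
def distOfIntegrable (g : ℝ × ℝ → ℝ) (hg : IntegrableOn g box) : Dist :=
  StrongDual.toWeakDual
  { toFun := fun f => ∫ x in box, g x * (f : ℝ × ℝ → ℝ) x
    map_add' := fun f₁ f₂ => by
      rw [← integral_add (testFn_integrableOn_mul f₁ hg) (testFn_integrableOn_mul f₂ hg)]
      simp only [Submodule.coe_add, Pi.add_apply, mul_add]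
    map_smul' := fun c f => by
      rw [RingHom.id_apply, smul_eq_mul, ← integral_const_mul]
      simp only [Submodule.coe_smul, Pi.smul_apply, smul_eq_mul, mul_left_comm]
    cont := by
      let L : TestFn →ₗ[ℝ] ℝ :=
        { toFun := fun f => ∫ x in box, g x * (f : ℝ × ℝ → ℝ) x
          map_add' := fun f₁ f₂ => by
            rw [← integral_add (testFn_integrableOn_mul f₁ hg) (testFn_integrableOn_mul f₂ hg)]
            simp only [Submodule.coe_add, Pi.add_apply, mul_add]
          map_smul' := fun c f => by
            rw [RingHom.id_apply, smul_eq_mul, ← integral_const_mul]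
            simp only [Submodule.coe_smul, Pi.smul_apply, smul_eq_mul, mul_left_comm] }
      have hpos : 0 ≤ ∫ x in box, |g x| := integral_nonneg fun x => abs_nonneg _
      refine WithSeminorms.continuous_real_rng withSeminorms_testFn L
        ⟨{0}, ⟨∫ x in box, |g x|, hpos⟩, fun f => ?_⟩
      have h1 : L f ≤ ∫ x in box, |g x| * testSeminormFamily 0 f := by
        refine integral_mono (testFn_integrableOn_mul f hg) (hg.abs.mul_const _) fun x => ?_
        refine (le_abs_self _).trans ?_
        rw [abs_mul]
        exact mul_le_mul_of_nonneg_left (testFn_abs_le f x) (abs_nonneg _)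
      rw [integral_mul_const] at h1
      rw [Finset.sup_singleton]
      exact h1 }

open Classical in
/-- A function on `Λ`, integrable over `Λ`, as a distribution (with value `0` if the function is not
integrable). -/
def toDist (g : ℝ × ℝ → ℝ) : Dist :=
  if hg : IntegrableOn g box then distOfIntegrable g hg else 0

/-! ### Fourier coefficients and Sobolev spaces -/

/-- `k · x` -/
def kdot (k : ℤ × ℤ) (x : ℝ × ℝ) : ℝ := k.1 * x.1 + k.2 * x.2

/-- `1 + |k|²` -/
def bracketSq (k : ℤ × ℤ) : ℝ := 1 + (k.1 : ℝ) ^ 2 + (k.2 : ℝ) ^ 2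

/-- The function `𝐞_k(x) = (2π)⁻¹ e^{i k·x}`. -/
def expFn (k : ℤ × ℤ) (x : ℝ × ℝ) : ℂ :=
  (1 / (2 * Real.pi) : ℝ) * Complex.exp (Complex.I * (kdot k x : ℝ))

def cosTest (k : ℤ × ℤ) : TestFn :=
  ⟨fun x => Real.cos (kdot k x), by
    refine ⟨?_, fun x => ?_, fun x => ?_⟩
    · unfold kdot
      exact Real.contDiff_cos.comp (by fun_prop)
    · have : kdot k (x + (2 * Real.pi, 0)) = kdot k x + k.1 * (2 * Real.pi) := by
        simp only [kdot, Prod.fst_add, Prod.snd_add]; ring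
      simp only [this, Real.cos_add_int_mul_two_pi]
    · have : kdot k (x + (0, 2 * Real.pi)) = kdot k x + k.2 * (2 * Real.pi) := by
        simp only [kdot, Prod.fst_add, Prod.snd_add]; ring
      simp only [this, Real.cos_add_int_mul_two_pi]⟩

def sinTest (k : ℤ × ℤ) : TestFn :=
  ⟨fun x => Real.sin (kdot k x), by
    refine ⟨?_, fun x => ?_, fun x => ?_⟩
    · unfold kdot
      exact Real.contDiff_sin.comp (by fun_prop)
    · have : kdot k (x + (2 * Real.pi, 0)) = kdot k x + k.1 * (2 * Real.pi) := by
        simp only [kdot, Prod.fst_add, Prod.snd_add]; ring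
      simp only [this, Real.sin_add_int_mul_two_pi]
    · have : kdot k (x + (0, 2 * Real.pi)) = kdot k x + k.2 * (2 * Real.pi) := by
        simp only [kdot, Prod.fst_add, Prod.snd_add]; ring
      simp only [this, Real.sin_add_int_mul_two_pi]⟩

/-- The constant function `1`. -/
def oneTest : TestFn := ⟨fun _ => 1, contDiff_const, fun _ => rfl, fun _ => rfl⟩

/-- The Fourier coefficient `⟨u, 𝐞_k⟩`, that is, `u` applied (complex linearly) to the complex
conjugate of `𝐞_k`. -/
def fourierCoef (u : Dist) (k : ℤ × ℤ) : ℂ :=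
  (1 / (2 * Real.pi) : ℝ) * ((u (cosTest k) : ℝ) - Complex.I * (u (sinTest k) : ℝ))

/-- The norm `‖u‖_{H^s} = (∑_k (1 + |k|²)^s |⟨u, 𝐞_k⟩|²)^{1/2}`, with values in `[0, ∞]`. -/
def sobolevNorm (s : ℝ) (u : Dist) : ℝ≥0∞ :=
  (∑' k : ℤ × ℤ, ENNReal.ofReal (bracketSq k ^ s * ‖fourierCoef u k‖ ^ 2)) ^ (1 / 2 : ℝ)

/-- The Sobolev space `H^s(Λ)`, as a subset of `𝒟'(Λ)`. -/
def sobolevSpace (s : ℝ) : Set Dist := {u | sobolevNorm s u < ⊤}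

/-- The restriction of `F` to `H^s` is continuous for the norm topology of `H^s`. -/
def SobolevContinuous (s : ℝ) (F : Dist → ℝ) : Prop :=
  ∀ u ∈ sobolevSpace s, ∀ v : ℕ → Dist, (∀ n, v n ∈ sobolevSpace s) →
    Tendsto (fun n => sobolevNorm s (v n - u)) atTop (𝓝 0) →
    Tendsto (fun n => F (v n)) atTop (𝓝 (F u))

/-! ### The massive Gaussian free field -/

/-- `μ₀` is the centered Gaussian measure on `𝒟'(Λ)` with covariance operator `(1 - Δ)⁻¹`. -/
structure IsGFF (μ₀ : Measure Dist) : Prop where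
  isGaussian : ProbabilityTheory.IsGaussian μ₀
  centered : ∀ f : TestFn, ∫ φ, φ f ∂μ₀ = 0
  covariance : ∀ k l : ℤ × ℤ,
    ∫ φ, fourierCoef φ k * (starRingEnd ℂ) (fourierCoef φ l) ∂μ₀ =
      if k = l then (((bracketSq k)⁻¹ : ℝ) : ℂ) else 0

/-! ### Regularization and Wick exponentials -/

/-- The Euclidean norm on `ℝ²` (the norm of `ℝ × ℝ` in Mathlib is the sup norm). -/
def euclNorm (x : ℝ × ℝ) : ℝ := Real.sqrt (x.1 ^ 2 + x.2 ^ 2)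

/-- The admissible Fourier cut-off functions `ψ`. -/
structure IsCutoff (ψ : ℝ × ℝ → ℝ) : Prop where
  measurable : Measurable ψ
  mem_Icc : ∀ x, ψ x ∈ Icc (0 : ℝ) 1
  even : ∀ x, ψ (-x) = ψ x
  at_zero : ψ 0 = 1
  near_zero : ∃ θ ∈ Ioo (0 : ℝ) 1, ∃ C : ℝ, ∀ x, x ≠ 0 → euclNorm x ^ (-θ) * |ψ x - 1| ≤ C
  decay : ∃ m : ℝ, 4 ≤ m ∧ ∃ C : ℝ, ∀ x, euclNorm x ^ m * |ψ x| ≤ C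

/-- `ψ(2^{-N} k)` -/
def cutoffAt (ψ : ℝ × ℝ → ℝ) (N : ℕ) (k : ℤ × ℤ) : ℝ :=
  ψ ((k.1 : ℝ) / 2 ^ N, (k.2 : ℝ) / 2 ^ N)

/-- `P_N φ(x) = ∑_k ψ(2^{-N} k) ⟨φ, 𝐞_k⟩ 𝐞_k(x)`. The sum is real since `ψ` is even and `φ` is
real. -/
def regularize (ψ : ℝ × ℝ → ℝ) (N : ℕ) (φ : Dist) (x : ℝ × ℝ) : ℝ :=
  (∑' k : ℤ × ℤ, (cutoffAt ψ N k : ℂ) * fourierCoef φ k * expFn k x).re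

/-- `C_N = (4π²)⁻¹ ∑_k ψ(2^{-N} k)² / (1 + |k|²)` -/
def wickConst (ψ : ℝ × ℝ → ℝ) (N : ℕ) : ℝ :=
  1 / (4 * Real.pi ^ 2) * ∑' k : ℤ × ℤ, cutoffAt ψ N k ^ 2 / bracketSq k

/-- The approximating Wick exponential `exp_N^⋄(αφ)(x) = exp(α P_N φ(x) - α² C_N / 2)`. -/
def wickExpN (ψ : ℝ × ℝ → ℝ) (α : ℝ) (N : ℕ) (φ : Dist) (x : ℝ × ℝ) : ℝ :=
  Real.exp (α * regularize ψ N φ x - α ^ 2 / 2 * wickConst ψ N)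

/-- The Wick exponential `exp^⋄(αφ)`: the limit of the distributions `exp_N^⋄(αφ)`. -/
def wickExp (ψ : ℝ × ℝ → ℝ) (α : ℝ) (φ : Dist) : Dist :=
  limUnder atTop fun N : ℕ => toDist (wickExpN ψ α N φ)

/-! ### The measures -/

/-- The measure `Z⁻¹ exp(-V) μ₀`, where `Z = ∫ exp(-V) dμ₀`. -/
def gibbs (μ₀ : Measure Dist) (V : Dist → ℝ) : Measure Dist :=
  (∫⁻ φ, ENNReal.ofReal (Real.exp (-V φ)) ∂μ₀)⁻¹ •
    μ₀.withDensity fun φ => ENNReal.ofReal (Real.exp (-V φ))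

/-- The regularized measure `μ_N^{(α)}`. -/
def expMeasureN (μ₀ : Measure Dist) (ψ : ℝ × ℝ → ℝ) (α : ℝ) (N : ℕ) : Measure Dist :=
  gibbs μ₀ fun φ => ∫ x in box, wickExpN ψ α N φ x

/-- The `exp(Φ)₂`-measure `μ^{(α)}`; here `∫_Λ exp^⋄(αφ)(x) dx` is the pairing of the distribution
`exp^⋄(αφ)` with the constant function `1`. -/
def expMeasure (μ₀ : Measure Dist) (ψ : ℝ × ℝ → ℝ) (α : ℝ) : Measure Dist :=
  gibbs μ₀ fun φ => wickExp ψ α φ oneTest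

end ExpPhi

end

/-!
The Wick exponentials are controlled by second moments, throughout the range `α² < 4π`.

*Chaos expansion.* For regularizations by Fourier multipliers `p` and `q` with finitely many modes,
the correlation of two Wick exponentials at `x` and `y` is the exponential of `α²` times the
regularized covariance function at `x - y`. Expanding this exponential, the mean square distance of
the `k`-th Fourier coefficients is a sum over `n` and over the `n`-tuples of frequencies with
`κ₁ + ⋯ + κₙ = k`, with terms proportional to `α^{2n} / n! ∏ (1 + |κ_i|²)⁻¹ (∏ p(κ_i) - ∏ q(κ_i))²`;
see `IsGFF.hasSum_integral_wickTrigCoef_sub`. Since `p` and `q` take values in `[0, 1]`, the last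
factor is at most `∑ |p(κ_i) - q(κ_i)|`.

*The exponential of the covariance.* Summed over `k` with the Sobolev weight `(1 + |k|²)^{-β}`, this
is an exponential series in the operator of convolution with the covariance on the Fourier side. By
the lattice estimate `exists_tsum_bracketSq_conv_le`, that operator acts on the weights, up to a
bounded term and with constants arbitrarily close to the sharp one, as multiplication by
`(4π)⁻¹ log(1 + |k|²)`. Writing the exponential as the limit of `(1 + (l / n) covOp)^n` and absorbing
the logarithm at each step into the exponent by `1 + x ≤ eˣ`, one loses in total an exponent slightly
above `l / (4π)` (`tsum_covOp_pow_weight_le`); hence the sum is finite if `α² / (4π) < β`, with enough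
room for a small power of `|κ_i|` (`exists_tsum_covOp_pow_convOp_le`).

*Convergence.* Fatou's lemma removes the restriction to finitely many modes
(`IsGFF.exists_lintegral_sobolevNorm_sub_sq_le`). The regularity of the cut-off at the origin makes
the mean square distance of `exp_N^⋄` and `exp_{N+1}^⋄` in `H^{-β}`, and likewise that of the Wick
exponentials for two cut-offs, decay geometrically in `N`. So the distances are almost surely
summable, which gives the almost sure limit (`IsGFF.ae_tendsto_wickExpN`) and its independence of the
cut-off (`IsGFF.wickExp_ae_eq`).

*The measures.* The interaction is the pairing with the constant function `1`. It is nonnegative for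
every `N` and converges almost surely, so that the densities `exp(-V_N)` are bounded by `1` and
converge, and the normalizing constants tend to a positive limit by dominated convergence. This gives
the convergence of the integrals of all bounded measurable functions, in particular of the functions
that are continuous in the weak-* topology or in the norm of `H^{-ε}` (`tendsto_integral_gibbs`), and
the uniform bound on the densities (`exists_rnDeriv_gibbs_le`). The support in `H^{-ε}` is inherited
from the free field.

*The free field* is constructed as the random series
`∑ ξ_k (1 + |k|²)^{-1/2} (2π)⁻¹ (cos(k·x) + sin(k·x))` with independent standard Gaussian `ξ_k`
(`exists_isGFF`). The map from sequences to distributions is continuous on each of the closed sets of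
sequences bounded by a multiple of `(1 + |k|²)²`, hence Borel measurable for the weak-* topology.
-/

noncomputable section

namespace ExpPhi

/-! ### Lattice sums -/

theorem one_le_bracketSq (k : ℤ × ℤ) : 1 ≤ bracketSq k := by
  unfold bracketSq; nlinarith [sq_nonneg (k.1 : ℝ), sq_nonneg (k.2 : ℝ)]

theorem bracketSq_pos (k : ℤ × ℤ) : 0 < bracketSq k := one_pos.trans_le (one_le_bracketSq k)

@[simp] theorem bracketSq_zero : bracketSq 0 = 1 := by simp [bracketSq]

@[simp] theorem bracketSq_neg (k : ℤ × ℤ) : bracketSq (-k) = bracketSq k := by simp [bracketSq]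

/-- A disc of radius `√r` contains `O(r)` lattice points. The cardinality is written as a sum with
values in `[0, ∞]`, the form in which it enters the dyadic decompositions. -/
theorem card_bracketSq_lt_le {r : ℝ} (hr : 1 ≤ r) :
    ∑' l : ℤ × ℤ, (if bracketSq l < r then 1 else 0 : ℝ≥0∞) ≤ ENNReal.ofReal (9 * r) := by
  set s : ℕ := ⌊√r⌋₊ with hs
  have hs1 : (s : ℝ) ≤ √r := Nat.floor_le (Real.sqrt_nonneg _)
  have h1 : 1 ≤ √r := Real.one_le_sqrt.2 hr
  have key : ∀ m : ℤ, (m : ℝ) ^ 2 ≤ r → m ∈ Finset.Icc (-(s : ℤ)) s := by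
    intro m hm
    have h2 : ((m.natAbs : ℕ) : ℝ) ≤ √r := by
      rw [Nat.cast_natAbs, Int.cast_abs]
      exact Real.abs_le_sqrt hm
    have h3 : m.natAbs ≤ s := Nat.le_floor h2
    rw [Finset.mem_Icc]; omega
  have hsub : ∀ l : ℤ × ℤ, bracketSq l < r →
      l ∈ Finset.Icc (-(s : ℤ)) s ×ˢ Finset.Icc (-(s : ℤ)) s := by
    intro l hl
    unfold bracketSq at hl
    exact Finset.mem_product.2 ⟨key _ (by nlinarith [sq_nonneg (l.2 : ℝ)]),
      key _ (by nlinarith [sq_nonneg (l.1 : ℝ)])⟩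
  rw [tsum_eq_sum (s := Finset.Icc (-(s : ℤ)) s ×ˢ Finset.Icc (-(s : ℤ)) s)]
  · calc _ ≤ ∑ _l ∈ Finset.Icc (-(s : ℤ)) s ×ˢ Finset.Icc (-(s : ℤ)) s, (1 : ℝ≥0∞) :=
          Finset.sum_le_sum fun l _ => by split_ifs <;> simp
      _ = ENNReal.ofReal (((2 * s + 1) * (2 * s + 1) : ℕ) : ℝ) := by
          rw [Finset.sum_const, Finset.card_product, Int.card_Icc, ENNReal.ofReal_natCast]
          have : ((s : ℤ) + 1 - -(s : ℤ)).toNat = 2 * s + 1 := by omega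
          rw [this]; simp
      _ ≤ _ := by
          refine ENNReal.ofReal_le_ofReal ?_
          push_cast
          have h3 : (2 * s + 1 : ℝ) ≤ 3 * √r := by linarith
          have h4 : √r * √r = r := Real.mul_self_sqrt (by linarith)
          nlinarith [mul_self_le_mul_self (by positivity : (0 : ℝ) ≤ 2 * s + 1) h3]
  · intro l hl
    exact if_neg fun h => hl (hsub l h)

/-- Sums over the lattice, truncated dyadically: the exponents `-β` and `-1-β` lie strictly on
either side of the borderline `-1`, so that the dyadic sum is carried by the scale `K`. -/
theorem exists_tsum_rpow_div_max_le {σ : ℝ} (hσ : 0 < σ) :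
    ∃ C : ℝ, 0 ≤ C ∧ ∀ β ∈ Icc σ (1 - σ), ∀ K : ℝ, 1 ≤ K →
      ∑' l : ℤ × ℤ, ENNReal.ofReal (bracketSq l ^ (-β) / max K (bracketSq l)) ≤
        ENNReal.ofReal (C * K ^ (-β)) := by
  set q : ℝ := 2 ^ (-σ) with hq
  have hq0 : 0 < q := by positivity
  have hq1 : q < 1 := Real.rpow_lt_one_of_one_lt_of_neg one_lt_two (by linarith)
  have hsum : Summable fun d : ℤ => q ^ d.natAbs := by
    refine Summable.of_nat_of_neg ?_ ?_ <;>
    simpa using summable_geometric_of_lt_one hq0.le hq1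
  set Q : ℝ := ∑' d : ℤ, q ^ d.natAbs with hQ
  have hQ0 : 0 ≤ Q := tsum_nonneg fun d => by positivity
  refine ⟨36 * Q, by positivity, fun β hβ K hK => ?_⟩
  have hβ0 : 0 < β := hσ.trans_le hβ.1
  have hβ1 : β < 1 := by linarith [hβ.2]
  -- `2 ^ p` is the dyadic scale of `K`; the contribution of the scale `2 ^ i` decays
  -- like `q ^ |i - p|`.
  obtain ⟨p, hp1, hp2⟩ := exists_nat_pow_near hK (one_lt_two (α := ℝ))
  have e : ∀ (i : ℕ) (s : ℝ), ((2 : ℝ) ^ i) ^ s = 2 ^ (i * s) := fun i s => by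
    rw [Real.rpow_mul (by norm_num), Real.rpow_natCast]
  set H : ℕ → ℝ := fun i => ((2 : ℝ) ^ i) ^ (-β) / max K (2 ^ i) with hH
  have hH0 : ∀ i, 0 ≤ H i := fun i => by positivity
  have step : ∀ i : ℕ, H i * (9 * 2 ^ (i + 1)) ≤ 36 * K ^ (-β) * q ^ ((i : ℤ) - p).natAbs := by
    intro i
    have h1 : H i * 2 ^ i ≤ ((2 : ℝ) ^ p) ^ (-β) * q ^ ((i : ℤ) - p).natAbs := by
      have e1 : q ^ ((i : ℤ) - p).natAbs = (2 : ℝ) ^ (-σ * |(i : ℝ) - p|) := by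
        rw [hq, ← Real.rpow_natCast, ← Real.rpow_mul (by norm_num), Nat.cast_natAbs]
        push_cast; rfl
      rw [e1, e, ← Real.rpow_add (by norm_num)]
      rcases le_total i p with hip | hip
      · calc H i * 2 ^ i ≤ ((2 : ℝ) ^ i) ^ (-β) / 2 ^ p * 2 ^ i := by
              refine mul_le_mul_of_nonneg_right ?_ (by positivity)
              exact div_le_div_of_nonneg_left (by positivity) (by positivity)
                (hp1.trans (le_max_left _ _))
          _ = (2 : ℝ) ^ (i * (-β) + i - p) := by
              rw [Real.rpow_sub (by norm_num), Real.rpow_add (by norm_num), e, Real.rpow_natCast,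
                Real.rpow_natCast]; ring
          _ ≤ _ := by
              refine Real.rpow_le_rpow_of_exponent_le one_le_two ?_
              have : (i : ℝ) ≤ p := by exact_mod_cast hip
              rw [abs_of_nonpos (by linarith)]
              nlinarith [hβ.2]
      · calc H i * 2 ^ i ≤ ((2 : ℝ) ^ i) ^ (-β) / 2 ^ i * 2 ^ i := by
              refine mul_le_mul_of_nonneg_right ?_ (by positivity)
              exact div_le_div_of_nonneg_left (by positivity) (by positivity) (le_max_right _ _)
          _ = (2 : ℝ) ^ (i * (-β)) := by
              rw [div_mul_cancel₀ _ (by positivity), e]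
          _ ≤ _ := by
              refine Real.rpow_le_rpow_of_exponent_le one_le_two ?_
              have : (p : ℝ) ≤ i := by exact_mod_cast hip
              rw [abs_of_nonneg (by linarith)]
              nlinarith [hβ.1]
    have h2 : ((2 : ℝ) ^ p) ^ (-β) ≤ 2 * K ^ (-β) := by
      have : ((2 : ℝ) ^ (p + 1)) ^ (-β) ≤ K ^ (-β) :=
        Real.rpow_le_rpow_of_nonpos (by linarith) hp2.le (by linarith)
      rw [pow_succ, Real.mul_rpow (by positivity) (by norm_num)] at this
      have h3 : (1 / 2 : ℝ) ≤ 2 ^ (-β) := by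
        calc (1 / 2 : ℝ) = 2 ^ (-1 : ℝ) := by norm_num [Real.rpow_neg_one]
          _ ≤ _ := Real.rpow_le_rpow_of_exponent_le one_le_two (by linarith)
      have h4 : 0 < ((2 : ℝ) ^ p) ^ (-β) := by positivity
      nlinarith
    have h5 : 0 < q ^ ((i : ℤ) - p).natAbs := by positivity
    calc H i * (9 * 2 ^ (i + 1)) = 18 * (H i * 2 ^ i) := by rw [pow_succ]; ring
      _ ≤ 18 * (((2 : ℝ) ^ p) ^ (-β) * q ^ ((i : ℤ) - p).natAbs) := by gcongr
      _ ≤ 18 * ((2 * K ^ (-β)) * q ^ ((i : ℤ) - p).natAbs) := by gcongr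
      _ = _ := by ring
  calc ∑' l : ℤ × ℤ, ENNReal.ofReal (bracketSq l ^ (-β) / max K (bracketSq l))
      ≤ ∑' l : ℤ × ℤ, ∑' i : ℕ, ENNReal.ofReal (H i) *
          (if bracketSq l < 2 ^ (i + 1) then 1 else 0) := by
        refine ENNReal.tsum_le_tsum fun l => ?_
        obtain ⟨i, hi1, hi2⟩ := exists_nat_pow_near (one_le_bracketSq l) (one_lt_two (α := ℝ))
        refine le_trans ?_ (ENNReal.le_tsum i)
        rw [if_pos hi2, mul_one]
        refine ENNReal.ofReal_le_ofReal ?_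
        refine div_le_div₀ (by positivity) ?_ (by positivity) (max_le_max_left _ hi1)
        exact Real.rpow_le_rpow_of_nonpos (by positivity) hi1 (by linarith)
    _ = ∑' i : ℕ, ENNReal.ofReal (H i) *
          ∑' l : ℤ × ℤ, (if bracketSq l < 2 ^ (i + 1) then 1 else 0) := by
        rw [ENNReal.tsum_comm]; simp_rw [ENNReal.tsum_mul_left]
    _ ≤ ∑' i : ℕ, ENNReal.ofReal (36 * K ^ (-β)) * ENNReal.ofReal (q ^ ((i : ℤ) - p).natAbs) := by
        refine ENNReal.tsum_le_tsum fun i => ?_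
        calc _ ≤ ENNReal.ofReal (H i) * ENNReal.ofReal (9 * 2 ^ (i + 1)) := by
              gcongr; exact card_bracketSq_lt_le (one_le_pow₀ one_le_two)
          _ ≤ _ := by
              rw [← ENNReal.ofReal_mul (hH0 i), ← ENNReal.ofReal_mul (by positivity)]
              exact ENNReal.ofReal_le_ofReal (step i)
    _ ≤ ENNReal.ofReal (36 * K ^ (-β)) * ∑' d : ℤ, ENNReal.ofReal (q ^ d.natAbs) := by
        rw [ENNReal.tsum_mul_left]
        gcongr
        refine ENNReal.tsum_comp_le_tsum_of_injective (f := fun i : ℕ => (i : ℤ) - p)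
          (fun a b h => by simpa using h) (fun d : ℤ => ENNReal.ofReal (q ^ d.natAbs))
    _ = _ := by
        rw [← ENNReal.ofReal_tsum_of_nonneg (fun d => by positivity) hsum,
          ← ENNReal.ofReal_mul (by positivity)]
        congr 1; ring

theorem tsum_bracketSq_rpow_ne_top {s : ℝ} (hs : 1 < s) :
    ∑' l : ℤ × ℤ, ENNReal.ofReal (bracketSq l ^ (-s)) ≠ ⊤ := by
  set t : ℝ := min (s - 1) (1 / 2) with ht
  have ht0 : 0 < t := lt_min (by linarith) (by norm_num)
  obtain ⟨C, -, hC⟩ := exists_tsum_rpow_div_max_le ht0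
  have := hC t ⟨le_rfl, by linarith [min_le_right (s - 1) (1 / 2 : ℝ)]⟩ 1 le_rfl
  refine ne_top_of_le_ne_top ENNReal.ofReal_ne_top (le_trans ?_ this)
  refine ENNReal.tsum_le_tsum fun l => ENNReal.ofReal_le_ofReal ?_
  have hl := one_le_bracketSq l
  rw [max_eq_right hl]
  calc bracketSq l ^ (-s) ≤ bracketSq l ^ (-t - 1) :=
        Real.rpow_le_rpow_of_exponent_le hl (by linarith [min_le_left (s - 1) (1 / 2 : ℝ)])
    _ = _ := by rw [Real.rpow_sub_one (bracketSq_pos l).ne']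

theorem summable_bracketSq_rpow {s : ℝ} (hs : 1 < s) :
    Summable fun l : ℤ × ℤ => bracketSq l ^ (-s) := by
  have := ENNReal.summable_toReal (tsum_bracketSq_rpow_ne_top hs)
  refine this.congr fun l => ?_
  rw [ENNReal.toReal_ofReal (Real.rpow_nonneg (bracketSq_pos l).le _)]

theorem tsum_int_eq_add (f : ℤ → ℝ≥0∞) (hf : ∀ m, f (-m) = f m) :
    ∑' m, f m = f 0 + 2 * ∑' n : ℕ, f (n + 1) := by
  have h := (ENNReal.summable (f := fun n : ℕ => f n)).hasSum.of_nat_of_neg_add_one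
    (ENNReal.summable (f := fun n : ℕ => f (-(n + 1)))).hasSum
  rw [h.tsum_eq, tsum_eq_zero_add' ENNReal.summable]
  simp only [hf]
  push_cast
  rw [add_assoc, two_mul]

/-- Comparison of `∑_m 1 / (c² + m²)` with the integral `π / c`. -/
theorem tsum_int_inv_sq_add_sq_le {c : ℝ} (hc : 0 < c) :
    ∑' m : ℤ, ENNReal.ofReal (1 / (c ^ 2 + (m : ℝ) ^ 2)) ≤
      ENNReal.ofReal (Real.pi / c + 1 / c ^ 2) := by
  have step : ∀ n : ℕ, 1 / (c ^ 2 + ((n : ℝ) + 1) ^ 2) ≤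
      1 / c * (Real.arctan ((n + 1 : ℕ) / c) - Real.arctan (n / c)) := by
    intro n
    have hlt : (n : ℝ) / c < (n + 1 : ℕ) / c := by
      push_cast; gcongr; linarith
    obtain ⟨x, hx, hd⟩ := exists_deriv_eq_slope Real.arctan hlt
      Real.continuous_arctan.continuousOn Real.differentiable_arctan.differentiableOn
    rw [Real.deriv_arctan] at hd
    have e : ((n + 1 : ℕ) : ℝ) / c - n / c = 1 / c := by push_cast; field_simp; ring
    rw [e, eq_div_iff (by positivity)] at hd
    rw [← hd]
    have hx0 : 0 ≤ x := le_trans (by positivity) hx.1.le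
    have hx1 : x * c ≤ n + 1 := by
      have := hx.2.le; rw [le_div_iff₀ hc] at this; exact_mod_cast this
    have : (x * c) ^ 2 ≤ ((n : ℝ) + 1) ^ 2 := pow_le_pow_left₀ (by positivity) hx1 2
    calc 1 / (c ^ 2 + ((n : ℝ) + 1) ^ 2) ≤ 1 / (c ^ 2 + (x * c) ^ 2) := by gcongr
      _ = _ := by field_simp
  have hpart : ∑' n : ℕ, ENNReal.ofReal (1 / (c ^ 2 + ((n : ℝ) + 1) ^ 2)) ≤
      ENNReal.ofReal (Real.pi / 2 / c) := by
    refine ENNReal.tsum_le_of_sum_range_le fun M => ?_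
    rw [← ENNReal.ofReal_sum_of_nonneg fun n _ => by positivity]
    refine ENNReal.ofReal_le_ofReal ?_
    calc _ ≤ ∑ n ∈ Finset.range M,
          1 / c * (Real.arctan ((n + 1 : ℕ) / c) - Real.arctan (n / c)) :=
          Finset.sum_le_sum fun n _ => step n
      _ = 1 / c * Real.arctan (M / c) := by
          rw [← Finset.mul_sum, Finset.sum_range_sub (fun n : ℕ => Real.arctan (n / c))]; simp
      _ ≤ 1 / c * (Real.pi / 2) := by gcongr; exact (Real.arctan_lt_pi_div_two _).le
      _ = _ := by ring
  rw [tsum_int_eq_add _ fun m => by simp]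
  push_cast
  calc _ ≤ ENNReal.ofReal (1 / c ^ 2) + 2 * ENNReal.ofReal (Real.pi / 2 / c) := by
        gcongr; simp
    _ = _ := by
        rw [← ENNReal.ofReal_ofNat, ← ENNReal.ofReal_mul (by norm_num),
          ← ENNReal.ofReal_add (by positivity) (by positivity)]
        congr 1; ring

/-- The sharp logarithmic growth of `∑ 1 / (1 + |j|²)`; summing over a strip instead of a disc
changes only the additive constant. -/
theorem tsum_strip_le {K : ℝ} (hK : 1 ≤ K) :
    ∑' j : ℤ × ℤ, (if (j.1 : ℝ) ^ 2 ≤ K then ENNReal.ofReal (1 / bracketSq j) else 0) ≤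
      ENNReal.ofReal (Real.pi * Real.log K + (4 * Real.pi + 1)) := by
  have hpi := Real.pi_pos
  rw [ENNReal.tsum_prod']
  have row : ∀ m : ℤ, ∑' n : ℤ, (if (m : ℝ) ^ 2 ≤ K then ENNReal.ofReal (1 / bracketSq (m, n))
      else 0) ≤ (if (m : ℝ) ^ 2 ≤ K then ENNReal.ofReal (Real.pi / √(1 + (m : ℝ) ^ 2)) else 0) +
        ENNReal.ofReal (1 / (1 ^ 2 + (m : ℝ) ^ 2)) := by
    intro m
    split_ifs
    · have h := tsum_int_inv_sq_add_sq_le (c := √(1 + (m : ℝ) ^ 2)) (by positivity)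
      rw [Real.sq_sqrt (by positivity), ENNReal.ofReal_add (by positivity) (by positivity)] at h
      simpa [bracketSq] using h
    · simp
  refine (ENNReal.tsum_le_tsum row).trans ?_
  rw [ENNReal.tsum_add]
  have h1 := tsum_int_inv_sq_add_sq_le (c := 1) one_pos
  have h2 : ∑' m : ℤ, (if (m : ℝ) ^ 2 ≤ K then ENNReal.ofReal (Real.pi / √(1 + (m : ℝ) ^ 2))
      else 0) ≤ ENNReal.ofReal (Real.pi * Real.log K + 3 * Real.pi) := by
    rw [tsum_int_eq_add _ fun m => by simp]
    set M : ℕ := ⌊√K⌋₊ with hM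
    have hM1 : 1 ≤ M := by
      rw [hM, Nat.one_le_floor_iff]; exact Real.one_le_sqrt.2 hK
    have h3 : ∑' n : ℕ, (if (((n : ℤ) + 1 : ℤ) : ℝ) ^ 2 ≤ K then
        ENNReal.ofReal (Real.pi / √(1 + (((n : ℤ) + 1 : ℤ) : ℝ) ^ 2)) else 0) ≤
        ENNReal.ofReal (Real.pi * (1 + Real.log K / 2)) := by
      rw [tsum_eq_sum (s := Finset.range M)]
      · calc _ ≤ ∑ n ∈ Finset.range M, ENNReal.ofReal (Real.pi * ((n + 1 : ℕ) : ℝ)⁻¹) := by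
              refine Finset.sum_le_sum fun n _ => ?_
              split_ifs
              · refine ENNReal.ofReal_le_ofReal ?_
                rw [div_eq_mul_inv]
                push_cast
                gcongr
                exact Real.le_sqrt_of_sq_le (by linarith)
              · simp
          _ = ENNReal.ofReal (Real.pi * (harmonic M : ℝ)) := by
              rw [← ENNReal.ofReal_sum_of_nonneg fun n _ => by positivity, ← Finset.mul_sum]
              congr 2
              simp [harmonic]
          _ ≤ _ := by
              refine ENNReal.ofReal_le_ofReal ?_
              gcongr
              refine (harmonic_le_one_add_log M).trans ?_
              gcongr
              rw [← Real.log_sqrt (by linarith)]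
              exact Real.log_le_log (by exact_mod_cast hM1) (Nat.floor_le (Real.sqrt_nonneg _))
      · intro n hn
        refine if_neg fun h => hn ?_
        rw [Finset.mem_range]
        have : ((n + 1 : ℕ) : ℝ) ≤ √K := Real.le_sqrt_of_sq_le (by exact_mod_cast h)
        exact Nat.lt_of_succ_le (Nat.le_floor this)
    calc _ ≤ ENNReal.ofReal Real.pi + 2 * ENNReal.ofReal (Real.pi * (1 + Real.log K / 2)) := by
          gcongr
          split_ifs <;> simp
      _ = _ := by
          have := Real.log_nonneg hK
          rw [← ENNReal.ofReal_ofNat, ← ENNReal.ofReal_mul (by norm_num),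
            ← ENNReal.ofReal_add (by positivity) (by positivity)]
          congr 1; ring
  have := Real.log_nonneg hK
  calc _ ≤ _ := add_le_add h2 h1
    _ = _ := by
      rw [← ENNReal.ofReal_add (by positivity) (by positivity)]
      congr 1; ring

/-- The convolution of `(1 + |k|²)⁻¹` and `(1 + |k|²)^{-β}`, with the sharp constant in front of
the logarithm. The logarithm comes from the indices `j` that are small compared with `k`. -/
theorem exists_tsum_bracketSq_conv_le {σ δ : ℝ} (hσ : 0 < σ) (hδ : 0 < δ) :
    ∃ C : ℝ, 0 ≤ C ∧ ∀ β ∈ Icc σ (1 - σ), ∀ k : ℤ × ℤ,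
      ∑' j : ℤ × ℤ, ENNReal.ofReal ((bracketSq j)⁻¹ * bracketSq (k + j) ^ (-β)) ≤
        ENNReal.ofReal (bracketSq k ^ (-β) *
          (Real.pi * (1 + δ) * Real.log (bracketSq k) + C)) := by
  have hpi := Real.pi_pos
  obtain ⟨C₁, hC₁, hS⟩ := exists_tsum_rpow_div_max_le hσ
  -- If `|j_i|² ≤ η² (1 + |k|²)`, then `1 + |k + j|²` is at least `(1 - 4η) (1 + |k|²)`, and
  -- `1 - 4η = (1 + δ)⁻¹`.
  set η : ℝ := δ / (4 * (1 + δ)) with hη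
  have hη0 : 0 < η := by positivity
  have hη1 : 1 - 4 * η = (1 + δ)⁻¹ := by rw [hη]; field_simp; ring
  have hη2 : η < 1 := by
    have : 0 < (1 + δ)⁻¹ := by positivity
    linarith
  set D : ℝ := 2 * (1 + 1 / η ^ 2) with hD
  refine ⟨(1 + δ) * (4 * Real.pi + 1) + D * C₁, by positivity, fun β hβ k => ?_⟩
  have hβ0 : 0 < β := hσ.trans_le hβ.1
  have hβ1 : β < 1 := by linarith [hβ.2]
  set K := bracketSq k with hKdef
  have hK : 1 ≤ K := one_le_bracketSq k
  have hKp : 0 < K := bracketSq_pos k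
  have hlog := Real.log_nonneg hK
  have term : ∀ j : ℤ × ℤ, ENNReal.ofReal ((bracketSq j)⁻¹ * bracketSq (k + j) ^ (-β)) ≤
      ENNReal.ofReal ((1 + δ) * K ^ (-β)) *
        (if (j.1 : ℝ) ^ 2 ≤ K then ENNReal.ofReal (1 / bracketSq j) else 0) +
      ENNReal.ofReal D *
        ENNReal.ofReal (bracketSq (k + j) ^ (-β) / max K (bracketSq (k + j))) := by
    intro j
    have hj := bracketSq_pos j
    have hkj := bracketSq_pos (k + j)
    by_cases hnear : (j.1 : ℝ) ^ 2 ≤ η ^ 2 * K ∧ (j.2 : ℝ) ^ 2 ≤ η ^ 2 * K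
    · refine le_trans ?_ le_self_add
      have hj1 : (j.1 : ℝ) ^ 2 ≤ K := hnear.1.trans
        (mul_le_of_le_one_left hKp.le (pow_le_one₀ hη0.le hη2.le))
      rw [if_pos hj1, ← ENNReal.ofReal_mul (by positivity)]
      refine ENNReal.ofReal_le_ofReal ?_
      have hlow : (1 + δ)⁻¹ * K ≤ bracketSq (k + j) := by
        rw [← hη1]
        have ab : ∀ x y : ℝ, y ^ 2 ≤ η ^ 2 * K → x ^ 2 ≤ K → -(η * K) ≤ x * y := by
          intro x y hy hx
          have : (x * y) ^ 2 ≤ (η * K) ^ 2 := by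
            rw [mul_pow, mul_pow]; nlinarith [sq_nonneg x, sq_nonneg y]
          exact (abs_le.1 (abs_le_of_sq_le_sq this (by positivity))).1
        have hk1 : (k.1 : ℝ) ^ 2 ≤ K := by
          rw [hKdef, bracketSq]; nlinarith [sq_nonneg (k.2 : ℝ)]
        have hk2 : (k.2 : ℝ) ^ 2 ≤ K := by
          rw [hKdef, bracketSq]; nlinarith [sq_nonneg (k.1 : ℝ)]
        have a1 := ab k.1 j.1 hnear.1 hk1
        have a2 := ab k.2 j.2 hnear.2 hk2
        have : bracketSq (k + j) = K + 2 * (k.1 * j.1) + 2 * (k.2 * j.2)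
            + (j.1 : ℝ) ^ 2 + (j.2 : ℝ) ^ 2 := by
          simp only [hKdef, bracketSq, Prod.fst_add, Prod.snd_add]; push_cast; ring
        rw [this]
        nlinarith [sq_nonneg (j.1 : ℝ), sq_nonneg (j.2 : ℝ)]
      have hpow : bracketSq (k + j) ^ (-β) ≤ (1 + δ) * K ^ (-β) := by
        calc bracketSq (k + j) ^ (-β) ≤ ((1 + δ)⁻¹ * K) ^ (-β) :=
              Real.rpow_le_rpow_of_nonpos (by positivity) hlow (by linarith)
          _ = (1 + δ) ^ β * K ^ (-β) := by
              rw [Real.mul_rpow (by positivity) hKp.le, Real.inv_rpow (by positivity),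
                Real.rpow_neg (by positivity), inv_inv]
          _ ≤ _ := by
              gcongr
              calc (1 + δ) ^ β ≤ (1 + δ) ^ (1 : ℝ) :=
                    Real.rpow_le_rpow_of_exponent_le (by linarith) hβ1.le
                _ = _ := Real.rpow_one _
      calc (bracketSq j)⁻¹ * bracketSq (k + j) ^ (-β)
          ≤ (bracketSq j)⁻¹ * ((1 + δ) * K ^ (-β)) := by gcongr
        _ = _ := by ring
    · refine le_trans ?_ le_add_self
      rw [← ENNReal.ofReal_mul (by positivity)]
      refine ENNReal.ofReal_le_ofReal ?_
      -- Away from the origin the decay in `j` is at least that of `max (1 + |k|², 1 + |k + j|²)⁻¹`,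
      -- up to the constant `D`, and no logarithm arises.
      have hfar : η ^ 2 * K ≤ bracketSq j := by
        rw [not_and_or, not_le, not_le] at hnear
        rw [bracketSq]
        rcases hnear with h | h <;> nlinarith [sq_nonneg (j.1 : ℝ), sq_nonneg (j.2 : ℝ)]
      have hfar' : K ≤ 1 / η ^ 2 * bracketSq j := by
        rw [one_div, inv_mul_eq_div, le_div_iff₀ (by positivity)]; linarith
      have hadd : bracketSq (k + j) ≤ 2 * (K + bracketSq j) := by
        simp only [hKdef, bracketSq, Prod.fst_add, Prod.snd_add]; push_cast
        nlinarith [sq_nonneg ((k.1 : ℝ) - j.1), sq_nonneg ((k.2 : ℝ) - j.2)]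
      have hmax : max K (bracketSq (k + j)) ≤ D * bracketSq j := by
        have : 0 < 1 / η ^ 2 * bracketSq j := by positivity
        rw [hD]
        refine max_le ?_ ?_ <;> nlinarith
      calc (bracketSq j)⁻¹ * bracketSq (k + j) ^ (-β)
          = bracketSq (k + j) ^ (-β) * (D / (D * bracketSq j)) := by
            have : D ≠ 0 := by positivity
            field_simp
        _ ≤ bracketSq (k + j) ^ (-β) * (D / max K (bracketSq (k + j))) := by gcongr
        _ = _ := by ring
  refine (ENNReal.tsum_le_tsum term).trans ?_
  rw [ENNReal.tsum_add, ENNReal.tsum_mul_left, ENNReal.tsum_mul_left]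
  have hshift : ∑' j : ℤ × ℤ, ENNReal.ofReal (bracketSq (k + j) ^ (-β) /
      max K (bracketSq (k + j))) = ∑' l : ℤ × ℤ, ENNReal.ofReal (bracketSq l ^ (-β) /
      max K (bracketSq l)) :=
    (Equiv.addLeft k).tsum_eq fun l => ENNReal.ofReal (bracketSq l ^ (-β) / max K (bracketSq l))
  rw [hshift]
  calc _ ≤ ENNReal.ofReal ((1 + δ) * K ^ (-β)) *
        ENNReal.ofReal (Real.pi * Real.log K + (4 * Real.pi + 1)) +
        ENNReal.ofReal D * ENNReal.ofReal (C₁ * K ^ (-β)) := by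
        gcongr
        · exact tsum_strip_le hK
        · exact hS β hβ K hK
    _ = _ := by
        have h0 : 0 ≤ K ^ (-β) := by positivity
        rw [← ENNReal.ofReal_mul (by positivity), ← ENNReal.ofReal_mul (by positivity),
          ← ENNReal.ofReal_add (by positivity) (by positivity)]
        congr 1; ring

/-! ### Convolution powers of the covariance on the Fourier side -/

/-- The operator `v ↦ (m ↦ ∑_j w_j v_{m+j})`, that is, convolution with the reflection of `w`.
Values in `[0, ∞]` make all sums meaningful. -/
def convOp (w : ℤ × ℤ → ℝ≥0∞) : Module.End ℝ≥0∞ (ℤ × ℤ → ℝ≥0∞) where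
  toFun v m := ∑' j, w j * v (m + j)
  map_add' v v' := by
    ext m
    simp only [Pi.add_apply, mul_add, ENNReal.tsum_add]
  map_smul' c v := by
    ext m
    simp only [Pi.smul_apply, smul_eq_mul, RingHom.id_apply, ← ENNReal.tsum_mul_left]
    exact tsum_congr fun j => by ring

theorem convOp_apply (w v : ℤ × ℤ → ℝ≥0∞) (m : ℤ × ℤ) :
    convOp w v m = ∑' j, w j * v (m + j) := rfl

theorem convOp_mono (w : ℤ × ℤ → ℝ≥0∞) {v v' : ℤ × ℤ → ℝ≥0∞} (h : v ≤ v') :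
    convOp w v ≤ convOp w v' := fun m =>
  ENNReal.tsum_le_tsum fun j => by gcongr; exact h _

theorem convOp_pow_mono (w : ℤ × ℤ → ℝ≥0∞) (n : ℕ) {v v' : ℤ × ℤ → ℝ≥0∞} (h : v ≤ v') :
    (convOp w ^ n) v ≤ (convOp w ^ n) v' := by
  induction n with
  | zero => simpa using h
  | succ n ih => simpa only [pow_succ', Module.End.mul_apply] using convOp_mono w ih

theorem convOp_commute (w w' : ℤ × ℤ → ℝ≥0∞) : Commute (convOp w) (convOp w') := by
  refine LinearMap.ext fun v => funext fun m => ?_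
  simp only [Module.End.mul_apply, convOp_apply, ← ENNReal.tsum_mul_left]
  rw [ENNReal.tsum_comm]
  refine tsum_congr fun j => tsum_congr fun i => ?_
  rw [add_right_comm]; ring

theorem tsum_fin_succ {X : Type*} (n : ℕ) (F : (Fin (n + 1) → X) → ℝ≥0∞) :
    ∑' κ, F κ = ∑' j : X, ∑' κ : Fin n → X, F (Fin.cons j κ) := by
  rw [← (Fin.consEquiv fun _ : Fin (n + 1) => X).tsum_eq F, ENNReal.tsum_prod']
  rfl

/-- Sums over `n`-tuples of frequencies, weighted by a function of the total frequency, are powers of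
the convolution operator. -/
theorem tsum_prod_mul_eq_pow (w v : ℤ × ℤ → ℝ≥0∞) (n : ℕ) (m : ℤ × ℤ) :
    ∑' κ : Fin n → ℤ × ℤ, (∏ i, w (κ i)) * v (m + ∑ i, κ i) = (convOp w ^ n) v m := by
  induction n generalizing m with
  | zero => simp
  | succ n ih =>
    rw [tsum_fin_succ, pow_succ', Module.End.mul_apply, convOp_apply]
    refine tsum_congr fun j => ?_
    rw [← ih, ← ENNReal.tsum_mul_left]
    refine tsum_congr fun κ => ?_
    simp only [Fin.prod_univ_succ, Fin.sum_univ_succ, Fin.cons_zero, Fin.cons_succ]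
    rw [mul_assoc, add_assoc]

/-- In a sum over `(n + 1)`-tuples with the additional factor `∑ d(κ_i)`, the `n + 1` terms of this
factor contribute equally: one of the convolutions carries `w d` in place of `w`, and the
convolutions commute. -/
theorem tsum_prod_mul_sum_eq (w d v : ℤ × ℤ → ℝ≥0∞) (n : ℕ) (m : ℤ × ℤ) :
    ∑' κ : Fin (n + 1) → ℤ × ℤ, (∏ i, w (κ i)) * (∑ i, d (κ i)) * v (m + ∑ i, κ i) =
      (n + 1) * (convOp w ^ n) (convOp (fun j => w j * d j) v) m := by
  induction n generalizing m with
  | zero =>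
    rw [tsum_fin_succ]
    simp [convOp_apply]
  | succ n ih =>
    rw [tsum_fin_succ]
    have h1 : ∀ j : ℤ × ℤ, ∑' κ : Fin (n + 1) → ℤ × ℤ,
        (∏ i, w (Fin.cons (α := fun _ => ℤ × ℤ) j κ i)) *
          (∑ i, d (Fin.cons (α := fun _ => ℤ × ℤ) j κ i)) *
          v (m + ∑ i, Fin.cons (α := fun _ => ℤ × ℤ) j κ i) =
        w j * d j * (convOp w ^ (n + 1)) v (m + j) +
        w j * ((n + 1) * (convOp w ^ n) (convOp (fun j => w j * d j) v) (m + j)) := by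
      intro j
      rw [← ih, ← tsum_prod_mul_eq_pow, ← ENNReal.tsum_mul_left, ← ENNReal.tsum_mul_left,
        ← ENNReal.tsum_add]
      refine tsum_congr fun κ => ?_
      have s1 : ∑ i, d (Fin.cons (α := fun _ => ℤ × ℤ) j κ i) = d j + ∑ i, d (κ i) := by
        rw [Fin.sum_univ_succ]; rfl
      have s2 : ∑ i, Fin.cons (α := fun _ => ℤ × ℤ) j κ i = j + ∑ i, κ i := by
        rw [Fin.sum_univ_succ]; rfl
      have s3 : ∏ i, w (Fin.cons (α := fun _ => ℤ × ℤ) j κ i) = w j * ∏ i, w (κ i) := by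
        rw [Fin.prod_univ_succ]; rfl
      rw [s1, s2, s3, ← add_assoc m j]
      ring
    simp_rw [h1]
    rw [ENNReal.tsum_add]
    have h2 : ∑' j, w j * d j * (convOp w ^ (n + 1)) v (m + j) =
        (convOp w ^ (n + 1)) (convOp (fun j => w j * d j) v) m := by
      have := ((convOp_commute (fun j => w j * d j) w).pow_right (n + 1)).eq
      rw [← Module.End.mul_apply, ← this, Module.End.mul_apply, convOp_apply]
    have h3 : ∑' j, w j * ((n + 1) * (convOp w ^ n) (convOp (fun j => w j * d j) v) (m + j)) =
        (n + 1) * (convOp w ^ (n + 1)) (convOp (fun j => w j * d j) v) m := by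
      rw [pow_succ', Module.End.mul_apply, convOp_apply, ← ENNReal.tsum_mul_left]
      exact tsum_congr fun j => by ring
    rw [h2, h3]
    push_cast
    ring

/-- The Fourier coefficients `(4π²)⁻¹ (1 + |j|²)⁻¹` of the covariance function. -/
def covCoef (j : ℤ × ℤ) : ℝ := 1 / (4 * Real.pi ^ 2) * (bracketSq j)⁻¹

theorem covCoef_pos (j : ℤ × ℤ) : 0 < covCoef j := by
  have := bracketSq_pos j
  unfold covCoef; positivity

/-- The operator `convOp` of the covariance. -/
def covOp : Module.End ℝ≥0∞ (ℤ × ℤ → ℝ≥0∞) := convOp fun j => ENNReal.ofReal (covCoef j)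

/-- The weight `(1 + |k|²)^{-β}`. -/
def weight (β : ℝ) (k : ℤ × ℤ) : ℝ≥0∞ := ENNReal.ofReal (bracketSq k ^ (-β))

/-- The covariance acts on Sobolev weights as multiplication by a logarithm, with any constant
larger than the sharp one, `(4π)⁻¹`. The bound is uniform in the exponent. -/
theorem exists_covOp_weight_le {σ c : ℝ} (hσ : 0 < σ) (hc : 1 / (4 * Real.pi) < c) :
    ∃ C : ℝ, 0 ≤ C ∧ ∀ β ∈ Icc σ (1 - σ), ∀ k : ℤ × ℤ,
      covOp (weight β) k ≤ ENNReal.ofReal (bracketSq k ^ (-β) *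
        (c * Real.log (bracketSq k) + C)) := by
  have hpi := Real.pi_pos
  obtain ⟨C, hC, h⟩ := exists_tsum_bracketSq_conv_le (σ := σ) (δ := 4 * Real.pi * c - 1) hσ (by
    rw [div_lt_iff₀ (by positivity)] at hc; linarith)
  refine ⟨1 / (4 * Real.pi ^ 2) * C, by positivity, fun β hβ k => ?_⟩
  have e : covOp (weight β) k = ENNReal.ofReal (1 / (4 * Real.pi ^ 2)) *
      ∑' j : ℤ × ℤ, ENNReal.ofReal ((bracketSq j)⁻¹ * bracketSq (k + j) ^ (-β)) := by
    rw [covOp, convOp_apply, ← ENNReal.tsum_mul_left]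
    refine tsum_congr fun j => ?_
    have := bracketSq_pos j
    rw [weight, covCoef, ← ENNReal.ofReal_mul (by positivity),
      ← ENNReal.ofReal_mul (by positivity), mul_assoc]
  rw [e]
  refine (mul_le_mul_right (h β hβ k) _).trans ?_
  rw [← ENNReal.ofReal_mul (by positivity)]
  refine ENNReal.ofReal_le_ofReal (le_of_eq ?_)
  field_simp
  ring

/-- One step of the exponential iteration: a logarithm times `h` is absorbed into a change of the
exponent, by `1 + x ≤ eˣ`. -/
theorem one_add_covOp_weight_le {σ c C : ℝ} (hc : 0 ≤ c) (hC : 0 ≤ C)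
    (H : ∀ β ∈ Icc σ (1 - σ), ∀ k : ℤ × ℤ,
      covOp (weight β) k ≤ ENNReal.ofReal (bracketSq k ^ (-β) *
        (c * Real.log (bracketSq k) + C)))
    {β h : ℝ} (hβ : β ∈ Icc σ (1 - σ)) (hh : 0 ≤ h) :
    (1 + ENNReal.ofReal h • covOp) (weight β) ≤
      ENNReal.ofReal (Real.exp (h * C)) • weight (β - h * c) := by
  intro k
  have hk := one_le_bracketSq k
  have hk0 := bracketSq_pos k
  have hlog := Real.log_nonneg hk
  have h0 : 0 ≤ bracketSq k ^ (-β) := by positivity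
  simp only [LinearMap.add_apply, Module.End.one_apply, LinearMap.smul_apply, Pi.add_apply,
    Pi.smul_apply, smul_eq_mul]
  refine (add_le_add_right (mul_le_mul_right (H β hβ k) _) _).trans ?_
  rw [weight, weight, ← ENNReal.ofReal_mul hh, ← ENNReal.ofReal_add h0 (by positivity),
    ← ENNReal.ofReal_mul (by positivity)]
  refine ENNReal.ofReal_le_ofReal ?_
  have e : bracketSq k ^ (-(β - h * c)) = bracketSq k ^ (-β) *
      Real.exp (h * c * Real.log (bracketSq k)) := by
    rw [neg_sub, sub_eq_neg_add, Real.rpow_add hk0, Real.rpow_def_of_pos hk0 (h * c)]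
    ring_nf
  rw [e]
  calc bracketSq k ^ (-β) + h * (bracketSq k ^ (-β) * (c * Real.log (bracketSq k) + C))
      = bracketSq k ^ (-β) * (h * C + h * c * Real.log (bracketSq k) + 1) := by ring
    _ ≤ bracketSq k ^ (-β) * Real.exp (h * C + h * c * Real.log (bracketSq k)) := by
        gcongr; exact Real.add_one_le_exp _
    _ = _ := by rw [Real.exp_add]; ring

/-- Iteration of `one_add_covOp_weight_le`: each factor `1 + h covOp` lowers the exponent by `h c`. -/
theorem one_add_covOp_pow_weight_le {σ c C : ℝ} (hc : 0 ≤ c) (hC : 0 ≤ C)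
    (H : ∀ β ∈ Icc σ (1 - σ), ∀ k : ℤ × ℤ,
      covOp (weight β) k ≤ ENNReal.ofReal (bracketSq k ^ (-β) *
        (c * Real.log (bracketSq k) + C)))
    {β h : ℝ} (hh : 0 ≤ h) (n : ℕ) (hβ1 : β ≤ 1 - σ) (hβ2 : σ ≤ β - n * h * c) :
    ((1 + ENNReal.ofReal h • covOp) ^ n) (weight β) ≤
      ENNReal.ofReal (Real.exp (n * h * C)) • weight (β - n * h * c) := by
  induction n with
  | zero => simp
  | succ n ih =>
    have hhc : 0 ≤ h * c := by positivity
    have hn : 0 ≤ n * h * c := by positivity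
    push_cast at hβ2
    have ih' := ih (by nlinarith)
    have mono : ∀ {v v' : ℤ × ℤ → ℝ≥0∞}, v ≤ v' → (1 + ENNReal.ofReal h • covOp) v ≤
        (1 + ENNReal.ofReal h • covOp) v' := by
      intro v v' hv
      simp only [LinearMap.add_apply, Module.End.one_apply, LinearMap.smul_apply]
      exact add_le_add hv fun m => mul_le_mul_right (convOp_mono _ hv m) _
    rw [pow_succ', Module.End.mul_apply]
    refine (mono ih').trans ?_
    rw [map_smul]
    have step := one_add_covOp_weight_le hc hC H (β := β - n * h * c) (h := h)
      ⟨by nlinarith, by linarith⟩ hh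
    intro k
    have := mul_le_mul_right (step k) (ENNReal.ofReal (Real.exp (n * h * C)))
    refine this.trans (le_of_eq ?_)
    have e : β - n * h * c - h * c = β - (n + 1 : ℕ) * h * c := by push_cast; ring
    have e' : n * h * C + h * C = (n + 1 : ℕ) * h * C := by push_cast; ring
    simp only [Pi.smul_apply, smul_eq_mul]
    rw [← mul_assoc, ← ENNReal.ofReal_mul (by positivity), ← Real.exp_add, e, e']

/-- The exponential series of `covOp` loses only the factor `(1 + |k|²)^{cl}` of Sobolev weight.
This is the Fourier side of the bound `exp(l G(z)) ≲ |z|^{-2cl}` for the covariance `G`. -/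
theorem tsum_covOp_pow_weight_le {σ c C : ℝ} (hc : 0 ≤ c) (hC : 0 ≤ C)
    (H : ∀ β ∈ Icc σ (1 - σ), ∀ k : ℤ × ℤ,
      covOp (weight β) k ≤ ENNReal.ofReal (bracketSq k ^ (-β) *
        (c * Real.log (bracketSq k) + C)))
    {β l : ℝ} (hl : 0 < l) (hβ1 : β ≤ 1 - σ) (hβ2 : σ ≤ β - l * c) (k : ℤ × ℤ) :
    ∑' m : ℕ, ENNReal.ofReal (l ^ m / m.factorial) * (covOp ^ m) (weight β) k ≤
      ENNReal.ofReal (Real.exp (l * C)) * weight (β - l * c) k := by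
  -- By the binomial theorem `(1 + (l / n) covOp) ^ n` converges termwise to the exponential series.
  refine ENNReal.tsum_le_of_sum_range_le fun M => ?_
  have lim : Tendsto (fun n : ℕ => ∑ m ∈ Finset.range M,
      ENNReal.ofReal (n.choose m * (l / n) ^ m) * (covOp ^ m) (weight β) k) atTop
      (𝓝 (∑ m ∈ Finset.range M,
        ENNReal.ofReal (l ^ m / m.factorial) * (covOp ^ m) (weight β) k)) := by
    refine tendsto_finsetSum _ fun m _ => ?_
    refine ENNReal.Tendsto.mul_const ?_ (Or.inl ?_)
    · refine ENNReal.tendsto_ofReal ?_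
      have h1 : Tendsto (fun n : ℕ => (n.choose m : ℝ) / (n ^ m / m.factorial)) atTop (𝓝 1) := by
        refine (Asymptotics.isEquivalent_iff_tendsto_one ?_).1 (isEquivalent_choose m)
        filter_upwards [eventually_gt_atTop 0] with n hn
        have : (0 : ℝ) < n := by exact_mod_cast hn
        positivity
      have h2 := h1.mul_const (l ^ m / m.factorial)
      rw [one_mul] at h2
      refine h2.congr' ?_
      filter_upwards [eventually_gt_atTop 0] with n hn
      have : (0 : ℝ) < n := by exact_mod_cast hn
      have : (0 : ℝ) < m.factorial := by exact_mod_cast m.factorial_pos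
      rw [div_pow]
      field_simp
    · have : (0 : ℝ) < m.factorial := by exact_mod_cast m.factorial_pos
      rw [ne_eq, ENNReal.ofReal_eq_zero, not_le]; positivity
  refine le_of_tendsto lim ?_
  filter_upwards [eventually_ge_atTop M, eventually_gt_atTop 0] with n hn hn0
  have hn' : (0 : ℝ) < n := by exact_mod_cast hn0
  have e : (n : ℝ) * (l / n) = l := by field_simp
  have main := one_add_covOp_pow_weight_le hc hC H (β := β) (h := l / n) (by positivity) n hβ1
    (by rwa [e]) k
  rw [e, add_comm, (Commute.one_right _).add_pow] at main
  refine le_trans ?_ main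
  rw [LinearMap.sum_apply, Finset.sum_apply]
  refine le_trans (le_of_eq ?_) (Finset.sum_le_sum_of_subset
    (Finset.range_mono (hn.trans n.le_succ)))
  refine Finset.sum_congr rfl fun m _ => ?_
  rw [ENNReal.ofReal_mul (by positivity), ENNReal.ofReal_natCast,
    ENNReal.ofReal_pow (by positivity), smul_pow, one_pow, mul_one,
    ← (Nat.cast_commute (n.choose m) _).eq, Module.End.mul_apply, Module.End.natCast_apply,
    Pi.smul_apply, LinearMap.smul_apply, Pi.smul_apply, nsmul_eq_mul, smul_eq_mul, mul_assoc]

/-- Peetre's inequality. -/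
theorem bracketSq_le_mul (k j : ℤ × ℤ) : bracketSq j ≤ 2 * bracketSq k * bracketSq (k + j) := by
  have h : bracketSq j ≤ 2 * (bracketSq k + bracketSq (k + j)) - 2 := by
    simp only [bracketSq, Prod.fst_add, Prod.snd_add]; push_cast
    nlinarith [sq_nonneg (2 * (k.1 : ℝ) + j.1), sq_nonneg (2 * (k.2 : ℝ) + j.2)]
  nlinarith [one_le_bracketSq k, one_le_bracketSq (k + j)]

/-- The additional factor `(1 + |j|²)^κ` is absorbed by Peetre's inequality into the weight, at the
cost of an exponent `2κ`; a third `κ` pays for the logarithm. -/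
theorem exists_convOp_weight_le {σ c C κ : ℝ} (hc : 0 ≤ c) (hC : 0 ≤ C) (hκ : 0 < κ)
    (H : ∀ β ∈ Icc σ (1 - σ), ∀ k : ℤ × ℤ,
      covOp (weight β) k ≤ ENNReal.ofReal (bracketSq k ^ (-β) *
        (c * Real.log (bracketSq k) + C)))
    {β : ℝ} (hβ : β - κ ∈ Icc σ (1 - σ)) :
    ∃ C' : ℝ≥0, convOp (fun j => ENNReal.ofReal (covCoef j) * ENNReal.ofReal (bracketSq j ^ κ))
      (weight β) ≤ (C' : ℝ≥0∞) • weight (β - 3 * κ) := by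
  refine ⟨Real.toNNReal (2 ^ κ * (c / κ + C)), fun k => ?_⟩
  have hk := one_le_bracketSq k
  have hk0 := bracketSq_pos k
  have h1 : convOp (fun j => ENNReal.ofReal (covCoef j) * ENNReal.ofReal (bracketSq j ^ κ))
      (weight β) k ≤ ENNReal.ofReal (2 ^ κ * bracketSq k ^ κ) * covOp (weight (β - κ)) k := by
    rw [covOp, convOp_apply, convOp_apply, ← ENNReal.tsum_mul_left]
    refine ENNReal.tsum_le_tsum fun j => ?_
    have hj := bracketSq_pos j
    have hkj := bracketSq_pos (k + j)
    have hcov := covCoef_pos j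
    simp only [weight]
    rw [← ENNReal.ofReal_mul hcov.le, ← ENNReal.ofReal_mul (by positivity),
      ← ENNReal.ofReal_mul hcov.le, ← ENNReal.ofReal_mul (by positivity)]
    refine ENNReal.ofReal_le_ofReal ?_
    have hP : bracketSq j ^ κ ≤ 2 ^ κ * bracketSq k ^ κ * bracketSq (k + j) ^ κ := by
      rw [← Real.mul_rpow (by norm_num) hk0.le, ← Real.mul_rpow (by positivity) hkj.le]
      exact Real.rpow_le_rpow hj.le (bracketSq_le_mul k j) hκ.le
    have e : bracketSq (k + j) ^ (-(β - κ)) = bracketSq (k + j) ^ κ * bracketSq (k + j) ^ (-β) := by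
      rw [← Real.rpow_add hkj]; ring_nf
    rw [e]
    calc covCoef j * bracketSq j ^ κ * bracketSq (k + j) ^ (-β)
        ≤ covCoef j * (2 ^ κ * bracketSq k ^ κ * bracketSq (k + j) ^ κ) *
          bracketSq (k + j) ^ (-β) := by gcongr
      _ = _ := by ring
  refine h1.trans ((mul_le_mul_right (H _ hβ k) _).trans ?_)
  rw [Pi.smul_apply, smul_eq_mul, weight, ENNReal.ofNNReal_toNNReal,
    ← ENNReal.ofReal_mul (by positivity), ← ENNReal.ofReal_mul (by positivity)]
  refine ENNReal.ofReal_le_ofReal ?_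
  have hl : c * Real.log (bracketSq k) + C ≤ (c / κ + C) * bracketSq k ^ κ := by
    have a := Real.log_le_rpow_div hk0.le hκ
    have b : 1 ≤ bracketSq k ^ κ := Real.one_le_rpow hk hκ.le
    calc c * Real.log (bracketSq k) + C ≤ c * (bracketSq k ^ κ / κ) + C * bracketSq k ^ κ := by
          gcongr; nlinarith
      _ = _ := by ring
  have e : bracketSq k ^ (-(β - 3 * κ)) =
      bracketSq k ^ κ * bracketSq k ^ (-(β - κ)) * bracketSq k ^ κ := by
    rw [← Real.rpow_add hk0, ← Real.rpow_add hk0]; ring_nf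
  rw [e]
  calc _ ≤ 2 ^ κ * bracketSq k ^ κ * (bracketSq k ^ (-(β - κ)) *
        ((c / κ + C) * bracketSq k ^ κ)) := by gcongr
    _ = _ := by ring

/-- The sums that bound the second moments of differences of Wick exponentials. The condition
`l / (4π) < β` is sharp. -/
theorem exists_tsum_covOp_pow_convOp_le {l β : ℝ} (hl : 0 < l) (hβ : l / (4 * Real.pi) < β)
    (hβ1 : β < 1) :
    ∃ κ₀ : ℝ, 0 < κ₀ ∧ ∀ κ : ℝ, 0 < κ → κ ≤ κ₀ → ∃ C : ℝ≥0,
      ∑' m : ℕ, ENNReal.ofReal (l ^ m / m.factorial) * (covOp ^ m)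
        (convOp (fun j => ENNReal.ofReal (covCoef j) * ENNReal.ofReal (bracketSq j ^ κ))
          (weight β)) 0 ≤ C := by
  have hpi := Real.pi_pos
  set gap := β - l / (4 * Real.pi) with hgap
  have hgap0 : 0 < gap := by linarith
  -- The exponent `gap` to spare is split between the constant of the logarithm, where `l * c` exceeds
  -- `l / (4π)` by `gap / 4`, and the loss `3κ ≤ gap / 4`. This leaves an exponent of at least `gap / 2`.
  set c := 1 / (4 * Real.pi) + gap / (4 * l) with hc
  have hc0 : 0 ≤ c := by positivity
  have hlc : l * c = l / (4 * Real.pi) + gap / 4 := by rw [hc]; field_simp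
  have hl4 : 0 < l / (4 * Real.pi) := by positivity
  set σ := min (gap / 2) (1 - β) with hσ
  have hσ1 : σ ≤ gap / 2 := min_le_left _ _
  have hσ2 : σ ≤ 1 - β := min_le_right _ _
  obtain ⟨C, hC, H⟩ := exists_covOp_weight_le (σ := σ) (c := c)
    (lt_min (by linarith) (by linarith)) (by rw [hc]; linarith [show 0 < gap / (4 * l) by positivity])
  refine ⟨gap / 12, by positivity, fun κ hκ hκ' => ?_⟩
  obtain ⟨C', hC'⟩ := exists_convOp_weight_le hc0 hC hκ H (β := β) ⟨by linarith, by linarith⟩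
  refine ⟨C' * Real.toNNReal (Real.exp (l * C)), ?_⟩
  calc _ ≤ ∑' m : ℕ, (C' : ℝ≥0∞) * (ENNReal.ofReal (l ^ m / m.factorial) *
        (covOp ^ m) (weight (β - 3 * κ)) 0) := by
        refine ENNReal.tsum_le_tsum fun m => ?_
        have := convOp_pow_mono (fun j => ENNReal.ofReal (covCoef j)) m hC' 0
        rw [map_smul, Pi.smul_apply, smul_eq_mul] at this
        refine (mul_le_mul_right this _).trans (le_of_eq ?_)
        rw [covOp]; ring
    _ ≤ C' * (ENNReal.ofReal (Real.exp (l * C)) * weight (β - 3 * κ - l * c) 0) := by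
        rw [ENNReal.tsum_mul_left]
        gcongr
        exact tsum_covOp_pow_weight_le hc0 hC H hl (by linarith) (by linarith) 0
    _ = _ := by
        simp [weight, ENNReal.ofReal]

/-! ### Integration over the torus -/

theorem box_subset : box ⊆ Icc (0 : ℝ) (2 * Real.pi) ×ˢ Icc (0 : ℝ) (2 * Real.pi) :=
  prod_mono Ico_subset_Icc_self Ico_subset_Icc_self

theorem integrableOn_box {E : Type*} [NormedAddCommGroup E] {G : ℝ × ℝ → E} (hG : Continuous G) :
    IntegrableOn G box :=
  (hG.continuousOn.integrableOn_compact (isCompact_Icc.prod isCompact_Icc)).mono_set box_subset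

theorem volume_box : volume box = ENNReal.ofReal (4 * Real.pi ^ 2) := by
  rw [box, Measure.volume_eq_prod, Measure.prod_prod, Real.volume_Ico,
    ← ENNReal.ofReal_mul (by linarith [Real.two_pi_pos])]
  congr 1; ring

theorem volume_real_box : volume.real box = 4 * Real.pi ^ 2 := by
  rw [Measure.real, volume_box, ENNReal.toReal_ofReal (by positivity)]

instance : IsFiniteMeasure (volume.restrict box) :=
  ⟨by rw [Measure.restrict_apply_univ, volume_box]; exact ENNReal.ofReal_lt_top⟩

theorem integral_box_eq {E : Type*} [NormedAddCommGroup E] [NormedSpace ℝ E] {G : ℝ × ℝ → E}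
    (hG : Continuous G) :
    ∫ x in box, G x = ∫ a in (0 : ℝ)..2 * Real.pi, ∫ b in (0 : ℝ)..2 * Real.pi, G (a, b) := by
  have h := integrableOn_box hG
  rw [box, Measure.volume_eq_prod] at h ⊢
  rw [setIntegral_prod _ h, integral_Ico_eq_integral_Ioc,
    intervalIntegral.integral_of_le Real.two_pi_pos.le]
  simp_rw [intervalIntegral.integral_of_le Real.two_pi_pos.le, integral_Ico_eq_integral_Ioc]

theorem integral_box_swap {E : Type*} [NormedAddCommGroup E] [NormedSpace ℝ E] (G : ℝ × ℝ → E) :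
    ∫ x in box, G x.swap = ∫ x in box, G x := by
  simp only [box, Measure.volume_eq_prod]
  exact setIntegral_prod_swap _ _ _

/-- The integral over the torus of a derivative in the second variable vanishes. -/
theorem integral_box_deriv_snd {G G' : ℝ × ℝ → ℂ} (hG' : Continuous G')
    (hd : ∀ a b, HasDerivAt (fun b => G (a, b)) (G' (a, b)) b)
    (hper : ∀ x, G (x + (0, 2 * Real.pi)) = G x) : ∫ x in box, G' x = 0 := by
  rw [integral_box_eq hG']
  have : ∀ a, ∫ b in (0 : ℝ)..2 * Real.pi, G' (a, b) = 0 := by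
    intro a
    rw [intervalIntegral.integral_eq_sub_of_hasDerivAt (fun b _ => hd a b)
      ((hG'.comp (by fun_prop)).intervalIntegrable _ _), sub_eq_zero]
    simpa using hper (a, 0)
  simp [this]

theorem integral_box_deriv_fst {G G' : ℝ × ℝ → ℂ} (hG' : Continuous G')
    (hd : ∀ a b, HasDerivAt (fun a => G (a, b)) (G' (a, b)) a)
    (hper : ∀ x, G (x + (2 * Real.pi, 0)) = G x) : ∫ x in box, G' x = 0 := by
  rw [← integral_box_swap]
  refine integral_box_deriv_snd (G := fun x => G x.swap) (by fun_prop) (fun a b => hd b a) ?_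
  intro x
  simpa using hper x.swap

/-! ### Fourier series of test functions -/

theorem expFn_def (k : ℤ × ℤ) (x : ℝ × ℝ) :
    expFn k x = (1 / (2 * Real.pi) : ℝ) * Complex.exp ((kdot k x : ℝ) * Complex.I) := by
  rw [expFn, mul_comm Complex.I]

@[fun_prop]
theorem continuous_kdot (k : ℤ × ℤ) : Continuous (kdot k) := by unfold kdot; fun_prop

@[fun_prop]
theorem continuous_expFn (k : ℤ × ℤ) : Continuous (expFn k) := by
  unfold expFn; fun_prop

theorem norm_expFn (k : ℤ × ℤ) (x : ℝ × ℝ) : ‖expFn k x‖ = 1 / (2 * Real.pi) := by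
  have := Real.two_pi_pos
  rw [expFn_def, norm_mul, Complex.norm_exp_ofReal_mul_I, mul_one, Complex.norm_real,
    Real.norm_of_nonneg (by positivity)]

theorem expFn_add_fst (k : ℤ × ℤ) (x : ℝ × ℝ) : expFn k (x + (2 * Real.pi, 0)) = expFn k x := by
  have : ((kdot k (x + (2 * Real.pi, 0)) : ℝ) : ℂ) * Complex.I =
      (kdot k x : ℝ) * Complex.I + k.1 * (2 * Real.pi * Complex.I) := by
    simp only [kdot, Prod.fst_add, Prod.snd_add]; push_cast; ring
  rw [expFn_def, expFn_def, this, Complex.exp_periodic.int_mul k.1]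

theorem expFn_add_snd (k : ℤ × ℤ) (x : ℝ × ℝ) : expFn k (x + (0, 2 * Real.pi)) = expFn k x := by
  have : ((kdot k (x + (0, 2 * Real.pi)) : ℝ) : ℂ) * Complex.I =
      (kdot k x : ℝ) * Complex.I + k.2 * (2 * Real.pi * Complex.I) := by
    simp only [kdot, Prod.fst_add, Prod.snd_add]; push_cast; ring
  rw [expFn_def, expFn_def, this, Complex.exp_periodic.int_mul k.2]

theorem hasDerivAt_expFn_fst (k : ℤ × ℤ) (a b : ℝ) :
    HasDerivAt (fun a => expFn k (a, b)) (Complex.I * k.1 * expFn k (a, b)) a := by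
  have h1 : HasDerivAt (fun a : ℝ => Complex.I * ((kdot k (a, b) : ℝ) : ℂ))
      (Complex.I * k.1) a := by
    refine HasDerivAt.const_mul _ ?_
    have : HasDerivAt (fun a : ℝ => kdot k (a, b)) (k.1 : ℝ) a := by
      simpa [kdot] using ((hasDerivAt_id a).const_mul (k.1 : ℝ)).add_const (k.2 * b)
    simpa using this.ofReal_comp
  have h2 := (h1.cexp).const_mul (((1 / (2 * Real.pi) : ℝ)) : ℂ)
  exact h2.congr_deriv (by simp only [expFn]; ring)

theorem hasDerivAt_expFn_snd (k : ℤ × ℤ) (a b : ℝ) :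
    HasDerivAt (fun b => expFn k (a, b)) (Complex.I * k.2 * expFn k (a, b)) b := by
  have h1 : HasDerivAt (fun b : ℝ => Complex.I * ((kdot k (a, b) : ℝ) : ℂ))
      (Complex.I * k.2) b := by
    refine HasDerivAt.const_mul _ ?_
    have : HasDerivAt (fun b : ℝ => kdot k (a, b)) (k.2 : ℝ) b := by
      simpa [kdot] using ((hasDerivAt_id b).const_mul (k.2 : ℝ)).const_add (k.1 * a)
    simpa using this.ofReal_comp
  have h2 := (h1.cexp).const_mul (((1 / (2 * Real.pi) : ℝ)) : ℂ)
  exact h2.congr_deriv (by simp only [expFn]; ring)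

theorem kdot_neg (k : ℤ × ℤ) (x : ℝ × ℝ) : kdot (-k) x = -kdot k x := by
  simp only [kdot, Prod.fst_neg, Prod.snd_neg]; push_cast; ring

theorem expFn_neg (k : ℤ × ℤ) (x : ℝ × ℝ) : expFn (-k) x = (starRingEnd ℂ) (expFn k x) := by
  rw [expFn_def, expFn_def, map_mul, ← Complex.exp_conj, map_mul, Complex.conj_I,
    Complex.conj_ofReal, Complex.conj_ofReal, kdot_neg]
  push_cast; ring_nf

/-- The characters integrate to zero because they are derivatives of periodic functions. -/
theorem integral_box_expFn (k : ℤ × ℤ) :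
    ∫ x in box, expFn k x = if k = 0 then (2 * Real.pi : ℂ) else 0 := by
  have hpi := Real.pi_pos
  split_ifs with h
  · have : ∀ x, expFn k x = (1 / (2 * Real.pi) : ℝ) := fun x => by
      rw [h, expFn_def]; simp [kdot]
    simp only [this]
    rw [integral_const, measureReal_restrict_apply_univ, volume_real_box, Complex.real_smul,
      ← Complex.ofReal_mul]
    norm_cast
    field_simp
    ring
  · have h' : k.1 ≠ 0 ∨ k.2 ≠ 0 := by
      by_contra! hh
      exact h (Prod.ext hh.1 hh.2)
    rcases h' with h1 | h1
    · have := integral_box_deriv_fst (G := expFn k) (G' := fun x => Complex.I * k.1 * expFn k x)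
        (by fun_prop) (hasDerivAt_expFn_fst k) (expFn_add_fst k)
      rw [integral_const_mul] at this
      simpa [h1] using this
    · have := integral_box_deriv_snd (G := expFn k) (G' := fun x => Complex.I * k.2 * expFn k x)
        (by fun_prop) (hasDerivAt_expFn_snd k) (expFn_add_snd k)
      rw [integral_const_mul] at this
      simpa [h1] using this

/-- The Fourier coefficient `∫_Λ f(x) conj(𝐞_k(x)) dx` of a test function. -/
def testCoef (f : TestFn) (k : ℤ × ℤ) : ℂ :=
  ∫ x in box, ((f : ℝ × ℝ → ℝ) x : ℂ) * expFn (-k) x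

theorem testFn_continuous (f : TestFn) : Continuous (f : ℝ × ℝ → ℝ) :=
  (testFn_contDiff f).continuous

/-- The directional derivative of a test function. -/
def dirDeriv (v : ℝ × ℝ) (f : TestFn) : TestFn :=
  ⟨fun x => fderiv ℝ (f : ℝ × ℝ → ℝ) x v, by
    refine ⟨?_, fun x => ?_, fun x => ?_⟩
    · exact ((testFn_contDiff f).fderiv_right (m := ∞) (by simp)).clm_apply contDiff_const
    · have h := fderiv_comp_add_right (𝕜 := ℝ) (f := (f : ℝ × ℝ → ℝ)) (x := x) (2 * Real.pi, 0)
      beta_reduce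
      rw [← h]
      congr 2
      exact funext f.2.2.1
    · have h := fderiv_comp_add_right (𝕜 := ℝ) (f := (f : ℝ × ℝ → ℝ)) (x := x) (0, 2 * Real.pi)
      beta_reduce
      rw [← h]
      congr 2
      exact funext f.2.2.2⟩

theorem testSeminorm_dirDeriv_le (v : ℝ × ℝ) (hv : ‖v‖ ≤ 1) (f : TestFn) (m : ℕ) :
    testSeminorm m (dirDeriv v f) ≤ testSeminorm (m + 1) f := by
  refine ciSup_le fun x => ?_
  have hc : ContDiffAt ℝ ∞ (fderiv ℝ (f : ℝ × ℝ → ℝ)) x :=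
    ((testFn_contDiff f).fderiv_right (m := ∞) (by simp)).contDiffAt
  refine (norm_iteratedFDeriv_clm_apply_const hc (n := m) (c := v)
    (by exact_mod_cast le_top)).trans ?_
  rw [norm_iteratedFDeriv_fderiv]
  refine (mul_le_of_le_one_left (norm_nonneg _) hv).trans ?_
  exact le_ciSup (testFn_bddAbove f (m + 1)) x

theorem hasDerivAt_testFn_fst (f : TestFn) (a b : ℝ) :
    HasDerivAt (fun a => (f : ℝ × ℝ → ℝ) (a, b)) ((dirDeriv (1, 0) f : ℝ × ℝ → ℝ) (a, b)) a := by
  have h := ((testFn_contDiff f).differentiable (by simp) (a, b)).hasFDerivAt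
  exact h.comp_hasDerivAt a ((hasDerivAt_id a).prodMk (hasDerivAt_const a b))

theorem hasDerivAt_testFn_snd (f : TestFn) (a b : ℝ) :
    HasDerivAt (fun b => (f : ℝ × ℝ → ℝ) (a, b)) ((dirDeriv (0, 1) f : ℝ × ℝ → ℝ) (a, b)) b := by
  have h := ((testFn_contDiff f).differentiable (by simp) (a, b)).hasFDerivAt
  exact h.comp_hasDerivAt b ((hasDerivAt_const b a).prodMk (hasDerivAt_id b))

theorem testCoef_dirDeriv_fst (f : TestFn) (k : ℤ × ℤ) :
    testCoef (dirDeriv (1, 0) f) k = Complex.I * k.1 * testCoef f k := by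
  have hf := testFn_continuous f
  have hf' := testFn_continuous (dirDeriv (1, 0) f)
  have := integral_box_deriv_fst
    (G := fun x => ((f : ℝ × ℝ → ℝ) x : ℂ) * expFn (-k) x)
    (G' := fun x => ((dirDeriv (1, 0) f : ℝ × ℝ → ℝ) x : ℂ) * expFn (-k) x +
      ((f : ℝ × ℝ → ℝ) x : ℂ) * (Complex.I * (-k).1 * expFn (-k) x))
    (by fun_prop)
    (fun a b => (hasDerivAt_testFn_fst f a b).ofReal_comp.mul (hasDerivAt_expFn_fst (-k) a b))
    (fun x => by rw [f.2.2.1, expFn_add_fst])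
  rw [integral_add (integrableOn_box (by fun_prop)) (integrableOn_box (by fun_prop))] at this
  have e : ∀ x : ℝ × ℝ, ((f : ℝ × ℝ → ℝ) x : ℂ) * (Complex.I * (-k).1 * expFn (-k) x) =
      -(Complex.I * k.1) * (((f : ℝ × ℝ → ℝ) x : ℂ) * expFn (-k) x) := fun x => by
    rw [Prod.fst_neg]; push_cast; ring
  simp_rw [e] at this
  rw [integral_const_mul] at this
  unfold testCoef
  linear_combination this

theorem testCoef_dirDeriv_snd (f : TestFn) (k : ℤ × ℤ) :
    testCoef (dirDeriv (0, 1) f) k = Complex.I * k.2 * testCoef f k := by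
  have hf := testFn_continuous f
  have hf' := testFn_continuous (dirDeriv (0, 1) f)
  have := integral_box_deriv_snd
    (G := fun x => ((f : ℝ × ℝ → ℝ) x : ℂ) * expFn (-k) x)
    (G' := fun x => ((dirDeriv (0, 1) f : ℝ × ℝ → ℝ) x : ℂ) * expFn (-k) x +
      ((f : ℝ × ℝ → ℝ) x : ℂ) * (Complex.I * (-k).2 * expFn (-k) x))
    (by fun_prop)
    (fun a b => (hasDerivAt_testFn_snd f a b).ofReal_comp.mul (hasDerivAt_expFn_snd (-k) a b))
    (fun x => by rw [f.2.2.2, expFn_add_snd])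
  rw [integral_add (integrableOn_box (by fun_prop)) (integrableOn_box (by fun_prop))] at this
  have e : ∀ x : ℝ × ℝ, ((f : ℝ × ℝ → ℝ) x : ℂ) * (Complex.I * (-k).2 * expFn (-k) x) =
      -(Complex.I * k.2) * (((f : ℝ × ℝ → ℝ) x : ℂ) * expFn (-k) x) := fun x => by
    rw [Prod.snd_neg]; push_cast; ring
  simp_rw [e] at this
  rw [integral_const_mul] at this
  unfold testCoef
  linear_combination this

theorem integrableOn_testFn_mul_expFn (f : TestFn) (k : ℤ × ℤ) :
    IntegrableOn (fun x => ((f : ℝ × ℝ → ℝ) x : ℂ) * expFn k x) box := by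
  have hf := testFn_continuous f
  exact integrableOn_box (by fun_prop)

theorem testCoef_add (f g : TestFn) (k : ℤ × ℤ) :
    testCoef (f + g) k = testCoef f k + testCoef g k := by
  unfold testCoef
  rw [← integral_add (integrableOn_testFn_mul_expFn f _) (integrableOn_testFn_mul_expFn g _)]
  simp [add_mul]

theorem testCoef_smul (c : ℝ) (f : TestFn) (k : ℤ × ℤ) :
    testCoef (c • f) k = c * testCoef f k := by
  unfold testCoef
  rw [← integral_const_mul]
  simp [mul_assoc]

/-- The operator `1 - Δ` on test functions. -/
def oneSubLaplacian (f : TestFn) : TestFn :=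
  f + ((-1 : ℝ) • dirDeriv (1, 0) (dirDeriv (1, 0) f) +
    (-1 : ℝ) • dirDeriv (0, 1) (dirDeriv (0, 1) f))

theorem testCoef_oneSubLaplacian (f : TestFn) (k : ℤ × ℤ) :
    testCoef (oneSubLaplacian f) k = bracketSq k * testCoef f k := by
  rw [oneSubLaplacian, testCoef_add, testCoef_add, testCoef_smul, testCoef_smul,
    testCoef_dirDeriv_fst, testCoef_dirDeriv_fst, testCoef_dirDeriv_snd, testCoef_dirDeriv_snd,
    bracketSq]
  push_cast
  linear_combination (-(k.1 : ℂ) ^ 2 * testCoef f k - (k.2 : ℂ) ^ 2 * testCoef f k) *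
    Complex.I_mul_I

theorem testSeminorm_oneSubLaplacian_le (f : TestFn) (m : ℕ) :
    testSeminorm m (oneSubLaplacian f) ≤ testSeminorm m f + 2 * testSeminorm (m + 2) f := by
  have h1 : testSeminorm m (dirDeriv (1, 0) (dirDeriv (1, 0) f)) ≤ testSeminorm (m + 2) f :=
    (testSeminorm_dirDeriv_le _ (by simp [Prod.norm_def]) _ _).trans
      (testSeminorm_dirDeriv_le _ (by simp [Prod.norm_def]) _ _)
  have h2 : testSeminorm m (dirDeriv (0, 1) (dirDeriv (0, 1) f)) ≤ testSeminorm (m + 2) f :=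
    (testSeminorm_dirDeriv_le _ (by simp [Prod.norm_def]) _ _).trans
      (testSeminorm_dirDeriv_le _ (by simp [Prod.norm_def]) _ _)
  unfold oneSubLaplacian
  refine (map_add_le_add _ _ _).trans ?_
  have h3 := map_add_le_add (testSeminorm m) ((-1 : ℝ) • dirDeriv (1, 0) (dirDeriv (1, 0) f))
    ((-1 : ℝ) • dirDeriv (0, 1) (dirDeriv (0, 1) f))
  rw [map_smul_eq_mul, map_smul_eq_mul] at h3
  norm_num at h3
  linarith

/-- The seminorm that adds up the suprema of the derivatives of order less than `m`. -/
def sumSeminorm (m : ℕ) (f : TestFn) : ℝ := ∑ j ∈ Finset.range m, testSeminorm j f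

theorem sumSeminorm_nonneg (m : ℕ) (f : TestFn) : 0 ≤ sumSeminorm m f :=
  Finset.sum_nonneg fun _ _ => apply_nonneg _ _

theorem sumSeminorm_oneSubLaplacian_le (m : ℕ) (f : TestFn) :
    sumSeminorm m (oneSubLaplacian f) ≤ 3 * sumSeminorm (m + 2) f := by
  have h1 : sumSeminorm m f ≤ sumSeminorm (m + 2) f :=
    Finset.sum_le_sum_of_subset_of_nonneg (Finset.range_mono (by omega))
      fun _ _ _ => apply_nonneg _ _
  have h2 : ∑ j ∈ Finset.range m, testSeminorm (j + 2) f ≤ sumSeminorm (m + 2) f := by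
    rw [sumSeminorm, Finset.sum_range_succ', Finset.sum_range_succ']
    have a := apply_nonneg (testSeminorm 0) f
    have b := apply_nonneg (testSeminorm 1) f
    simp only [zero_add, add_assoc, Nat.reduceAdd]
    linarith
  calc sumSeminorm m (oneSubLaplacian f)
      ≤ ∑ j ∈ Finset.range m, (testSeminorm j f + 2 * testSeminorm (j + 2) f) :=
        Finset.sum_le_sum fun j _ => testSeminorm_oneSubLaplacian_le f j
    _ = sumSeminorm m f + 2 * ∑ j ∈ Finset.range m, testSeminorm (j + 2) f := by
        rw [Finset.sum_add_distrib, Finset.mul_sum, sumSeminorm]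
    _ ≤ _ := by linarith

/-- Rapid decay of the Fourier coefficients of a test function, by integrating `(1 - Δ)^m` by parts. -/
theorem norm_testCoef_le (f : TestFn) (k : ℤ × ℤ) (m : ℕ) :
    ‖testCoef f k‖ ≤ 2 * Real.pi * 3 ^ m * sumSeminorm (2 * m + 1) f * bracketSq k ^ (-(m : ℝ)) := by
  have hpi := Real.pi_pos
  induction m generalizing f with
  | zero =>
    have : ‖testCoef f k‖ ≤ (testSeminorm 0 f * (1 / (2 * Real.pi))) * volume.real box := by
      refine norm_setIntegral_le_of_norm_le_const (by rw [volume_box]; exact ENNReal.ofReal_lt_top)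
        fun x _ => ?_
      rw [norm_mul, norm_expFn, Complex.norm_real, Real.norm_eq_abs]
      gcongr
      exact testFn_abs_le f x
    refine this.trans (le_of_eq ?_)
    rw [volume_real_box]
    simp [sumSeminorm]
    field_simp
    ring
  | succ m ih =>
    have hk := bracketSq_pos k
    have h1 := ih (oneSubLaplacian f)
    rw [testCoef_oneSubLaplacian, norm_mul, Complex.norm_real, Real.norm_of_nonneg hk.le] at h1
    have h2 := sumSeminorm_oneSubLaplacian_le (2 * m + 1) f
    have e : bracketSq k ^ (-((m + 1 : ℕ) : ℝ)) = (bracketSq k)⁻¹ * bracketSq k ^ (-(m : ℝ)) := by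
      rw [← Real.rpow_neg_one, ← Real.rpow_add hk]; push_cast; ring_nf
    rw [e]
    calc ‖testCoef f k‖ = (bracketSq k)⁻¹ * (bracketSq k * ‖testCoef f k‖) := by field_simp
      _ ≤ (bracketSq k)⁻¹ * (2 * Real.pi * 3 ^ m * (3 * sumSeminorm (2 * m + 1 + 2) f) *
          bracketSq k ^ (-(m : ℝ))) := by
          refine mul_le_mul_of_nonneg_left (h1.trans ?_) (by positivity)
          gcongr
      _ = _ := by
          rw [show 2 * (m + 1) + 1 = 2 * m + 1 + 2 by ring]; ring

/-- Linear functionals bounded by `sumSeminorm` are distributions. -/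
def distOfBound (L : TestFn →ₗ[ℝ] ℝ) (h : ∃ (m : ℕ) (C : ℝ), ∀ f, |L f| ≤ C * sumSeminorm m f) :
    Dist :=
  StrongDual.toWeakDual
  { toLinearMap := L
    cont := by
      obtain ⟨m, C, hC⟩ := h
      refine WithSeminorms.continuous_real_rng withSeminorms_testFn L
        ⟨Finset.range m, ⟨|C| * m, by positivity⟩, fun f => ?_⟩
      have h1 : sumSeminorm m f ≤ m * ((Finset.range m).sup testSeminormFamily) f := by
        have : sumSeminorm m f ≤
            ∑ j ∈ Finset.range m, ((Finset.range m).sup testSeminormFamily) f :=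
          Finset.sum_le_sum fun j hj =>
            Seminorm.le_finset_sup_apply (p := testSeminormFamily) hj
        simpa using this
      calc L f ≤ C * sumSeminorm m f := (le_abs_self _).trans (hC f)
        _ ≤ |C| * (m * ((Finset.range m).sup testSeminormFamily) f) := by
            refine mul_le_mul (le_abs_self _) h1 (sumSeminorm_nonneg _ _) (abs_nonneg _)
        _ = (|C| * m) * ((Finset.range m).sup testSeminormFamily) f := by ring
        _ = _ := rfl }

theorem summable_testCoef (f : TestFn) : Summable (testCoef f) := by
  refine Summable.of_norm_bounded ?_ (fun k => norm_testCoef_le f k 2)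
  exact (summable_bracketSq_rpow (by norm_num)).mul_left _

/-- A `2π`-periodic function, as a function on the unit torus. -/
def torusLift (G : ℝ × ℝ → ℂ) (z : UnitAddTorus (Fin 2)) : ℂ :=
  G (2 * Real.pi * (AddCircle.equivIco 1 0 (z 0) : ℝ), 2 * Real.pi * (AddCircle.equivIco 1 0 (z 1) : ℝ))

theorem torusLift_coe {G : ℝ × ℝ → ℂ} (h1 : ∀ x, G (x + (2 * Real.pi, 0)) = G x)
    (h2 : ∀ x, G (x + (0, 2 * Real.pi)) = G x) (y : Fin 2 → ℝ) :
    torusLift G (fun i => (y i : UnitAddCircle)) = G (2 * Real.pi * y 0, 2 * Real.pi * y 1) := by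
  have p1 : ∀ b, Function.Periodic (fun a => G (a, b)) (2 * Real.pi) := fun b a => by
    simpa using h1 (a, b)
  have p2 : ∀ a, Function.Periodic (fun b => G (a, b)) (2 * Real.pi) := fun a b => by
    simpa using h2 (a, b)
  have e : ∀ t : ℝ, 2 * Real.pi * Int.fract t = 2 * Real.pi * t - ⌊t⌋ * (2 * Real.pi) := by
    intro t; rw [Int.fract]; ring
  simp only [torusLift, AddCircle.coe_equivIco_mk_apply, div_one, mul_one]
  rw [e, e]
  exact ((p1 _).sub_int_mul_eq _).trans ((p2 _).sub_int_mul_eq _)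

theorem continuous_torusLift {G : ℝ × ℝ → ℂ} (hG : Continuous G)
    (h1 : ∀ x, G (x + (2 * Real.pi, 0)) = G x) (h2 : ∀ x, G (x + (0, 2 * Real.pi)) = G x) :
    Continuous (torusLift G) := by
  have hq : IsOpenQuotientMap (Pi.map fun (_ : Fin 2) (t : ℝ) => (t : UnitAddCircle)) :=
    IsOpenQuotientMap.piMap fun _ => QuotientAddGroup.isOpenQuotientMap_mk
  rw [hq.isQuotientMap.continuous_iff]
  have : torusLift G ∘ (Pi.map fun (_ : Fin 2) (t : ℝ) => (t : UnitAddCircle)) =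
      fun y => G (2 * Real.pi * y 0, 2 * Real.pi * y 1) := funext fun y => torusLift_coe h1 h2 y
  rw [this]
  fun_prop

theorem mFourier_coe (n : Fin 2 → ℤ) (y : Fin 2 → ℝ) :
    UnitAddTorus.mFourier n (fun i => (y i : UnitAddCircle)) =
      2 * Real.pi * expFn (n 0, n 1) (2 * Real.pi * y 0, 2 * Real.pi * y 1) := by
  have hpi : (Real.pi : ℂ) ≠ 0 := by exact_mod_cast Real.pi_ne_zero
  simp only [UnitAddTorus.mFourier, ContinuousMap.coe_mk, Fin.prod_univ_two, fourier_coe_apply,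
    ← Complex.exp_add]
  rw [expFn, kdot]
  push_cast
  rw [← mul_assoc, mul_one_div_cancel (by simp [hpi]), one_mul]
  ring_nf

theorem mFourierCoeff_torusLift {G : ℝ × ℝ → ℂ} (hG : Continuous G)
    (h1 : ∀ x, G (x + (2 * Real.pi, 0)) = G x) (h2 : ∀ x, G (x + (0, 2 * Real.pi)) = G x)
    (n : Fin 2 → ℤ) :
    UnitAddTorus.mFourierCoeff (torusLift G) n =
      (2 * (Real.pi : ℂ))⁻¹ * ∫ x in box, G x * expFn (-(n 0, n 1)) x := by
  have hpi := Real.pi_pos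
  rw [UnitAddTorus.mFourierCoeff_eq_integral _ _ 0]
  set H : ℝ × ℝ → ℂ := fun x => 2 * Real.pi * expFn (-(n 0, n 1)) x * G x with hH
  have hHc : Continuous H := by fun_prop
  have e : ∀ y : Fin 2 → ℝ, UnitAddTorus.mFourier (-n) (fun i => (y i : UnitAddCircle)) •
      torusLift G (fun i => (y i : UnitAddCircle)) =
      (fun z : ℝ × ℝ => H (2 * Real.pi * z.1, 2 * Real.pi * z.2))
        (MeasurableEquiv.finTwoArrow y) := by
    intro y
    rw [mFourier_coe, torusLift_coe h1 h2]
    rfl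
  simp_rw [e]
  have hs : {x : Fin 2 → ℝ | ∀ i, x i ∈ Ioc ((0 : Fin 2 → ℝ) i) ((0 : Fin 2 → ℝ) i + 1)} =
      MeasurableEquiv.finTwoArrow ⁻¹' (Ioc (0 : ℝ) 1 ×ˢ Ioc (0 : ℝ) 1) := by
    ext x
    simp [Fin.forall_fin_two, MeasurableEquiv.finTwoArrow]
  rw [hs]
  refine ((volume_preserving_finTwoArrow ℝ).setIntegral_preimage_emb
    (MeasurableEquiv.measurableEmbedding _)
    (fun z : ℝ × ℝ => H (2 * Real.pi * z.1, 2 * Real.pi * z.2)) _).trans ?_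
  have hc : Continuous fun z : ℝ × ℝ => H (2 * Real.pi * z.1, 2 * Real.pi * z.2) := by fun_prop
  have hint : IntegrableOn (fun z : ℝ × ℝ => H (2 * Real.pi * z.1, 2 * Real.pi * z.2))
      (Ioc (0 : ℝ) 1 ×ˢ Ioc (0 : ℝ) 1) :=
    (hc.continuousOn.integrableOn_compact (isCompact_Icc.prod isCompact_Icc)).mono_set
      (prod_mono Ioc_subset_Icc_self Ioc_subset_Icc_self)
  rw [Measure.volume_eq_prod] at hint ⊢
  rw [setIntegral_prod _ hint]
  simp only
  simp_rw [← intervalIntegral.integral_of_le (zero_le_one (α := ℝ))]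
  have hin : ∀ a, ∫ b in (0 : ℝ)..1, H (2 * Real.pi * a, 2 * Real.pi * b) =
      (2 * Real.pi)⁻¹ • ∫ b in (0 : ℝ)..2 * Real.pi, H (2 * Real.pi * a, b) := by
    intro a
    rw [intervalIntegral.integral_comp_mul_left (fun b => H (2 * Real.pi * a, b))
      Real.two_pi_pos.ne', mul_zero, mul_one]
  simp_rw [hin]
  rw [intervalIntegral.integral_smul, intervalIntegral.integral_comp_mul_left
    (fun a => ∫ b in (0 : ℝ)..2 * Real.pi, H (a, b)) Real.two_pi_pos.ne', mul_zero, mul_one,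
    ← integral_box_eq hHc]
  simp only [hH, mul_assoc]
  rw [integral_const_mul, integral_const_mul, Complex.real_smul, Complex.real_smul]
  have hpi' : (Real.pi : ℂ) ≠ 0 := by exact_mod_cast Real.pi_ne_zero
  push_cast
  field_simp
  simp_rw [mul_comm (G _)]
  rfl

/-- A test function is the sum of its Fourier series. -/
theorem hasSum_testCoef_mul_expFn (f : TestFn) (x : ℝ × ℝ) :
    HasSum (fun k => testCoef f k * expFn k x) ((f : ℝ × ℝ → ℝ) x : ℂ) := by
  set G : ℝ × ℝ → ℂ := fun x => ((f : ℝ × ℝ → ℝ) x : ℂ) with hG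
  have hGc : Continuous G := Complex.continuous_ofReal.comp (testFn_continuous f)
  have h1 : ∀ x, G (x + (2 * Real.pi, 0)) = G x := fun x => by simp only [hG, f.2.2.1]
  have h2 : ∀ x, G (x + (0, 2 * Real.pi)) = G x := fun x => by simp only [hG, f.2.2.2]
  let F : C(UnitAddTorus (Fin 2), ℂ) := ⟨torusLift G, continuous_torusLift hGc h1 h2⟩
  have hcoef : ∀ n : Fin 2 → ℤ, UnitAddTorus.mFourierCoeff F n =
      (2 * (Real.pi : ℂ))⁻¹ * testCoef f (n 0, n 1) := fun n => mFourierCoeff_torusLift hGc h1 h2 n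
  have hsum : Summable (UnitAddTorus.mFourierCoeff F) := by
    have : Summable fun n : Fin 2 → ℤ => testCoef f (finTwoArrowEquiv ℤ n) :=
      (finTwoArrowEquiv ℤ).summable_iff.2 (summable_testCoef f)
    refine (this.mul_left ((2 * Real.pi : ℂ)⁻¹)).congr fun n => ?_
    rw [hcoef]; rfl
  have hpi : (Real.pi : ℂ) ≠ 0 := by exact_mod_cast Real.pi_ne_zero
  have hpi' := Real.pi_ne_zero
  have main := UnitAddTorus.hasSum_mFourier_series_apply_of_summable hsum
    (fun i => ((![x.1 / (2 * Real.pi), x.2 / (2 * Real.pi)] i : ℝ) : UnitAddCircle))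
  have e1 : F (fun i => ((![x.1 / (2 * Real.pi), x.2 / (2 * Real.pi)] i : ℝ) : UnitAddCircle)) =
      G x := by
    refine (torusLift_coe h1 h2 _).trans ?_
    congr 1
    ext <;> simp <;> field_simp
  rw [e1] at main
  rw [← (finTwoArrowEquiv ℤ).hasSum_iff]
  convert main using 1
  funext n
  change testCoef f (n 0, n 1) * expFn (n 0, n 1) x = _
  rw [hcoef, mFourier_coe, smul_eq_mul]
  have e2 : ((2 * Real.pi * ![x.1 / (2 * Real.pi), x.2 / (2 * Real.pi)] 0,
      2 * Real.pi * ![x.1 / (2 * Real.pi), x.2 / (2 * Real.pi)] 1) : ℝ × ℝ) = x := by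
    ext <;> simp <;> field_simp
  rw [e2]
  field_simp

/-! ### Distributions and Sobolev norms -/

theorem fourierCoef_sub (u v : Dist) (k : ℤ × ℤ) :
    fourierCoef (u - v) k = fourierCoef u k - fourierCoef v k := by
  have h : ∀ f : TestFn, (u - v) f = u f - v f := fun f => rfl
  simp only [fourierCoef, h]
  push_cast
  ring

/-- The pairing of a distribution with a test function is given by Parseval's formula. Every
distribution has this property; it is established here for functions, where it is elementary. -/
def HasParseval (u : Dist) : Prop :=
  ∀ f : TestFn, HasSum (fun k => testCoef f k * (starRingEnd ℂ) (fourierCoef u k)) (u f : ℂ)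

theorem HasParseval.sub {u v : Dist} (hu : HasParseval u) (hv : HasParseval v) :
    HasParseval (u - v) := by
  intro f
  have e : (((u - v) f : ℝ) : ℂ) = (u f : ℂ) - (v f : ℂ) := by
    rw [← Complex.ofReal_sub]; rfl
  rw [e]
  simp only [fourierCoef_sub, map_sub, mul_sub]
  exact (hu f).sub (hv f)

theorem toDist_apply {g : ℝ × ℝ → ℝ} (hg : IntegrableOn g box) (f : TestFn) :
    toDist g f = ∫ x in box, g x * (f : ℝ × ℝ → ℝ) x := by
  rw [toDist, dif_pos hg]; rfl

theorem fourierCoef_toDist {g : ℝ × ℝ → ℝ} (hg : IntegrableOn g box) (k : ℤ × ℤ) :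
    fourierCoef (toDist g) k = ∫ x in box, (g x : ℂ) * expFn (-k) x := by
  rw [fourierCoef, toDist_apply hg, toDist_apply hg, ← integral_complex_ofReal,
    ← integral_complex_ofReal, ← integral_const_mul, ← integral_sub, ← integral_const_mul]
  · refine integral_congr_ae (ae_of_all _ fun x => ?_)
    simp only [expFn_def, kdot_neg, cosTest, sinTest]
    rw [Complex.exp_mul_I]
    push_cast
    rw [Complex.cos_neg, Complex.sin_neg]
    ring
  · exact (testFn_integrableOn_mul _ hg).ofReal
  · exact (testFn_integrableOn_mul _ hg).ofReal.const_mul _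

/-- The Fourier series of the test function converges absolutely and uniformly, so that it may be
integrated against `g` term by term. If `g` is not integrable, then `toDist g = 0`. -/
theorem hasParseval_toDist (g : ℝ × ℝ → ℝ) : HasParseval (toDist g) := by
  intro f
  by_cases hg : IntegrableOn g box
  · have hgc : IntegrableOn (fun x => (g x : ℂ)) box := hg.ofReal
    have hterm : ∀ k, ∫ x in box, (g x : ℂ) * (testCoef f k * expFn k x) =
        testCoef f k * (starRingEnd ℂ) (fourierCoef (toDist g) k) := by
      intro k
      rw [fourierCoef_toDist hg, ← integral_conj, ← integral_const_mul]
      refine integral_congr_ae (ae_of_all _ fun x => ?_)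
      simp only [map_mul, Complex.conj_ofReal, expFn_neg, Complex.conj_conj]
      ring
    have hint : ∀ k, IntegrableOn (fun x => (g x : ℂ) * (testCoef f k * expFn k x)) box := by
      intro k
      refine hgc.mul_bdd (c := ‖testCoef f k‖ * (1 / (2 * Real.pi)))
        (Continuous.aestronglyMeasurable (by fun_prop)) (ae_of_all _ fun x => ?_)
      rw [norm_mul, norm_expFn]
    have hnorm : ∀ k, ∫ x in box, ‖(g x : ℂ) * (testCoef f k * expFn k x)‖ =
        (∫ x in box, |g x|) * (1 / (2 * Real.pi)) * ‖testCoef f k‖ := by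
      intro k
      rw [mul_assoc, ← integral_mul_const]
      refine integral_congr_ae (ae_of_all _ fun x => ?_)
      simp only [norm_mul, norm_expFn, Complex.norm_real, Real.norm_eq_abs]
      ring
    have main := hasSum_integral_of_summable_integral_norm hint (by
      simp_rw [hnorm]
      exact (summable_testCoef f).norm.mul_left _)
    simp_rw [hterm] at main
    have hval : ∫ x in box, ∑' k, (g x : ℂ) * (testCoef f k * expFn k x) = (toDist g f : ℝ) := by
      rw [toDist_apply hg, ← integral_complex_ofReal]
      refine integral_congr_ae (ae_of_all _ fun x => ?_)
      simp only
      rw [tsum_mul_left, (hasSum_testCoef_mul_expFn f x).tsum_eq, Complex.ofReal_mul]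
    rw [← hval]
    exact main
  · have h0 : toDist g = 0 := dif_neg hg
    have h1 : ∀ f : TestFn, (0 : Dist) f = 0 := fun f => rfl
    rw [h0]
    simp [fourierCoef, h1, hasSum_zero]

/-- The weighted Fourier coefficients, whose `ℓ²` norm is the Sobolev norm. -/
def sobolevSeq (s : ℝ) (u : Dist) (k : ℤ × ℤ) : ℂ := (bracketSq k ^ (s / 2) : ℝ) * fourierCoef u k

theorem sobolevNorm_sq (s : ℝ) (u : Dist) : sobolevNorm s u ^ 2 =
    ∑' k : ℤ × ℤ, ENNReal.ofReal (bracketSq k ^ s * ‖fourierCoef u k‖ ^ 2) := by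
  rw [sobolevNorm, ← ENNReal.rpow_natCast, ← ENNReal.rpow_mul]
  norm_num

theorem enorm_sobolevSeq_sq (s : ℝ) (u : Dist) (k : ℤ × ℤ) :
    ‖sobolevSeq s u k‖ₑ ^ 2 = ENNReal.ofReal (bracketSq k ^ s * ‖fourierCoef u k‖ ^ 2) := by
  have hk := bracketSq_pos k
  have e : (bracketSq k ^ (s / 2)) ^ 2 = bracketSq k ^ s := by
    rw [← Real.rpow_natCast, ← Real.rpow_mul hk.le]; norm_num
  rw [← ofReal_norm, ← ENNReal.ofReal_pow (norm_nonneg _), sobolevSeq, norm_mul, mul_pow,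
    Complex.norm_real, Real.norm_of_nonneg (by positivity), e]

theorem sobolevNorm_eq_eLpNorm (s : ℝ) (u : Dist) :
    sobolevNorm s u = eLpNorm (sobolevSeq s u) 2 Measure.count := by
  rw [eLpNorm_eq_lintegral_rpow_enorm_toReal (by norm_num) (by norm_num), lintegral_count,
    sobolevNorm]
  congr 1
  refine tsum_congr fun k => ?_
  rw [← enorm_sobolevSeq_sq, ENNReal.toReal_ofNat, ENNReal.rpow_ofNat]

theorem sobolevSeq_sub (s : ℝ) (u v : Dist) :
    sobolevSeq s (u - v) = sobolevSeq s u - sobolevSeq s v := by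
  funext k
  simp only [sobolevSeq, fourierCoef_sub, Pi.sub_apply, mul_sub]

theorem sobolevNorm_sub_le (s : ℝ) (u v w : Dist) :
    sobolevNorm s (u - w) ≤ sobolevNorm s (u - v) + sobolevNorm s (v - w) := by
  simp only [sobolevNorm_eq_eLpNorm, sobolevSeq_sub]
  have : sobolevSeq s u - sobolevSeq s w =
      (sobolevSeq s u - sobolevSeq s v) + (sobolevSeq s v - sobolevSeq s w) := by abel
  rw [this]
  exact eLpNorm_add_le (.of_discrete) (.of_discrete) (by norm_num)

theorem enorm_sobolevSeq_le (s : ℝ) (u : Dist) (k : ℤ × ℤ) :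
    ‖sobolevSeq s u k‖ₑ ≤ sobolevNorm s u := by
  rw [← ENNReal.pow_le_pow_left_iff two_ne_zero, sobolevNorm_sq, enorm_sobolevSeq_sq]
  exact ENNReal.le_tsum k

/-- A Sobolev bound on the Fourier coefficients controls all pairings. Parseval's formula is needed
as a hypothesis because `sobolevNorm` sees a distribution only through its Fourier coefficients. -/
theorem HasParseval.abs_apply_le {u : Dist} (hu : HasParseval u) {β : ℝ} (hβ : β < 1)
    (f : TestFn) (h : sobolevNorm (-β) u ≠ ⊤) :
    |u f| ≤ 18 * Real.pi * (∑' k, bracketSq k ^ (-(3 / 2) : ℝ)) * sumSeminorm 5 f *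
      (sobolevNorm (-β) u).toReal := by
  have hpi := Real.pi_pos
  have hsum := summable_bracketSq_rpow (s := 3 / 2) (by norm_num)
  have hterm : ∀ k, ‖testCoef f k * (starRingEnd ℂ) (fourierCoef u k)‖ ≤
      (18 * Real.pi * sumSeminorm 5 f * (sobolevNorm (-β) u).toReal) *
        bracketSq k ^ (-(3 / 2) : ℝ) := by
    intro k
    have hk := bracketSq_pos k
    have h1 := norm_testCoef_le f k 2
    have h2 : ‖sobolevSeq (-β) u k‖ ≤ (sobolevNorm (-β) u).toReal := by
      rw [← toReal_enorm]
      exact ENNReal.toReal_mono h (enorm_sobolevSeq_le _ _ _)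
    rw [sobolevSeq, norm_mul, Complex.norm_real, Real.norm_of_nonneg (by positivity)] at h2
    have h3 : ‖fourierCoef u k‖ ≤ bracketSq k ^ (1 / 2 : ℝ) * (sobolevNorm (-β) u).toReal := by
      calc ‖fourierCoef u k‖ = bracketSq k ^ (1 / 2 : ℝ) * (bracketSq k ^ (-(1 / 2) : ℝ) *
            ‖fourierCoef u k‖) := by
            rw [← mul_assoc, ← Real.rpow_add hk]; norm_num
        _ ≤ bracketSq k ^ (1 / 2 : ℝ) * (bracketSq k ^ (-β / 2) * ‖fourierCoef u k‖) := by
            gcongr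
            · exact one_le_bracketSq k
            · linarith
        _ ≤ _ := by gcongr
    have e : bracketSq k ^ (-(3 / 2) : ℝ) = bracketSq k ^ (-((2 : ℕ) : ℝ)) *
        bracketSq k ^ (1 / 2 : ℝ) := by
      rw [← Real.rpow_add hk]; norm_num
    rw [norm_mul, RCLike.norm_conj, e]
    calc _ ≤ (2 * Real.pi * 3 ^ 2 * sumSeminorm (2 * 2 + 1) f * bracketSq k ^ (-((2 : ℕ) : ℝ))) *
          (bracketSq k ^ (1 / 2 : ℝ) * (sobolevNorm (-β) u).toReal) := by
          gcongr
          exact (norm_nonneg _).trans h1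
      _ = _ := by norm_num; ring
  have := (hsum.mul_left (18 * Real.pi * sumSeminorm 5 f *
    (sobolevNorm (-β) u).toReal)).hasSum
  have h4 := (hu f).norm_le_of_bounded this hterm
  rw [Complex.norm_real, Real.norm_eq_abs, tsum_mul_left] at h4
  refine h4.trans (le_of_eq (by ring))

theorem continuous_fourierCoef (k : ℤ × ℤ) : Continuous fun u : Dist => fourierCoef u k := by
  have h1 := WeakDual.eval_continuous (𝕜 := ℝ) (cosTest k)
  have h2 := WeakDual.eval_continuous (𝕜 := ℝ) (sinTest k)
  exact continuous_const.mul ((Complex.continuous_ofReal.comp h1).sub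
    (continuous_const.mul (Complex.continuous_ofReal.comp h2)))

/-- Lower semicontinuity of the Sobolev norm under weak convergence. -/
theorem sobolevNorm_le_of_tendsto {s : ℝ} {w : ℕ → Dist} {u : Dist} {c : ℝ≥0∞}
    (h : Tendsto w atTop (𝓝 u)) (hc : ∀ᶠ n in atTop, sobolevNorm s (w n) ≤ c) :
    sobolevNorm s u ≤ c := by
  simp only [sobolevNorm_eq_eLpNorm] at hc ⊢
  refine (Lp.eLpNorm_lim_le_liminf_eLpNorm (f := fun n => sobolevSeq s (w n))
    (fun n => .of_discrete) _ (ae_of_all _ fun k => ?_)).trans ?_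
  · exact (((continuous_fourierCoef k).tendsto u).comp h).const_mul _
  · exact liminf_le_of_frequently_le' hc.frequently

/-- A sequence of distributions with Parseval's formula and summable distances in `H^{-β}` converges,
both in `H^{-β}` and weakly. The limit is defined by its pairings with test functions. -/
theorem exists_tendsto_of_tsum_sobolevNorm {β : ℝ} (hβ : β < 1) {v : ℕ → Dist}
    (hv : ∀ n, HasParseval (v n)) (h0 : sobolevNorm (-β) (v 0) ≠ ⊤)
    (hs : ∑' n, sobolevNorm (-β) (v (n + 1) - v n) ≠ ⊤) :
    ∃ u : Dist, Tendsto v atTop (𝓝 u) ∧ u ∈ sobolevSpace (-β) ∧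
      Tendsto (fun n => sobolevNorm (-β) (v n - u)) atTop (𝓝 0) := by
  set a : ℕ → ℝ≥0∞ := fun n => sobolevNorm (-β) (v (n + 1) - v n) with ha
  set tail : ℕ → ℝ≥0∞ := fun n => ∑' j, a (j + n) with htail
  have htail0 : Tendsto tail atTop (𝓝 0) := ENNReal.tendsto_sum_nat_add a hs
  have htop : ∀ n, tail n ≠ ⊤ := fun n =>
    ne_top_of_le_ne_top hs (ENNReal.tsum_comp_le_tsum_of_injective (add_left_injective n) a)
  have hself : ∀ u : Dist, sobolevNorm (-β) (u - u) = 0 := fun u => by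
    rw [sobolevNorm_eq_eLpNorm, sobolevSeq_sub, sub_self, eLpNorm_zero]
  have hsum : ∀ n m, sobolevNorm (-β) (v (n + m) - v n) ≤ ∑ j ∈ Finset.range m, a (j + n) := by
    intro n m
    induction m with
    | zero => rw [add_zero, hself]; exact zero_le
    | succ m ih =>
      rw [Finset.sum_range_succ, add_comm _ (a _)]
      refine (sobolevNorm_sub_le _ _ (v (n + m)) _).trans (add_le_add (le_of_eq ?_) ih)
      simp only [ha]
      rw [show n + (m + 1) = m + n + 1 by ring, add_comm n m]
  have hcau : ∀ n m, n ≤ m → sobolevNorm (-β) (v m - v n) ≤ tail n := by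
    intro n m hnm
    obtain ⟨d, rfl⟩ := Nat.exists_eq_add_of_le hnm
    exact (hsum n d).trans (ENNReal.sum_le_tsum _)
  set C := 18 * Real.pi * (∑' k, bracketSq k ^ (-(3 / 2) : ℝ)) with hC
  have hC0 : 0 ≤ C := mul_nonneg (by positivity)
    (tsum_nonneg fun k => Real.rpow_nonneg (bracketSq_pos k).le _)
  have hpair : ∀ n m, n ≤ m → ∀ f, |v m f - v n f| ≤ C * sumSeminorm 5 f * (tail n).toReal := by
    intro n m hnm f
    have h1 := hcau n m hnm
    refine (((hv m).sub (hv n)).abs_apply_le hβ f (ne_top_of_le_ne_top (htop n) h1)).trans ?_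
    have := sumSeminorm_nonneg 5 f
    gcongr
    exact htop n
  have hlim : ∀ f, ∃ y, Tendsto (fun n => v n f) atTop (𝓝 y) := by
    intro f
    refine cauchySeq_tendsto_of_complete ?_
    refine cauchySeq_of_le_tendsto_0' (fun n => C * sumSeminorm 5 f * (tail n).toReal)
      (fun n m hnm => ?_) ?_
    · rw [dist_comm, Real.dist_eq]; exact hpair n m hnm f
    · have := ((ENNReal.tendsto_toReal ENNReal.zero_ne_top).comp htail0).const_mul
        (C * sumSeminorm 5 f)
      simpa using this
  choose L hL using hlim
  have hbound : ∀ f, |L f| ≤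
      (C * ((sobolevNorm (-β) (v 0)).toReal + (tail 0).toReal)) * sumSeminorm 5 f := by
    intro f
    refine le_of_tendsto (hL f).abs (Eventually.of_forall fun n => ?_)
    have h1 := hpair 0 n (Nat.zero_le n) f
    have h2 := (hv 0).abs_apply_le hβ f h0
    have h3 : |v n f| ≤ |v 0 f| + |v n f - v 0 f| := by
      have := abs_add_le (v 0 f) (v n f - v 0 f); simpa using this
    calc |v n f| ≤ _ := h3
      _ ≤ C * sumSeminorm 5 f * (sobolevNorm (-β) (v 0)).toReal +
          C * sumSeminorm 5 f * (tail 0).toReal := add_le_add h2 h1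
      _ = _ := by ring
  let Lm : TestFn →ₗ[ℝ] ℝ :=
    { toFun := L
      map_add' := fun f g => tendsto_nhds_unique (hL (f + g)) <| by
        simpa only [map_add] using (hL f).add (hL g)
      map_smul' := fun c f => tendsto_nhds_unique (hL (c • f)) <| by
        simpa only [map_smul, smul_eq_mul, RingHom.id_apply] using (hL f).const_mul c }
  let u : Dist := distOfBound Lm ⟨5, _, hbound⟩
  have hu : Tendsto v atTop (𝓝 u) := by
    rw [tendsto_iff_forall_eval_tendsto_topDualPairing]
    exact fun f => hL f
  refine ⟨u, hu, ?_, ?_⟩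
  · refine (sobolevNorm_le_of_tendsto (c := tail 0 + sobolevNorm (-β) (v 0)) hu
      (Eventually.of_forall fun n => ?_)).trans_lt (ENNReal.add_ne_top.2 ⟨htop 0, h0⟩).lt_top
    have := sobolevNorm_sub_le (-β) (v n) (v 0) 0
    rw [sub_zero, sub_zero] at this
    exact this.trans (by gcongr; exact hcau 0 n (Nat.zero_le n))
  · refine tendsto_of_tendsto_of_tendsto_of_le_of_le tendsto_const_nhds htail0
      (fun _ => zero_le) fun n => ?_
    have hsymm : sobolevNorm (-β) (v n - u) = sobolevNorm (-β) (u - v n) := by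
      simp only [sobolevNorm_eq_eLpNorm, sobolevSeq_sub]
      exact eLpNorm_sub_comm _ _ _ _
    simp only [hsymm]
    exact sobolevNorm_le_of_tendsto (hu.sub_const (v n))
      ((eventually_ge_atTop n).mono fun m hm => hcau n m hm)

/-- Distributions that are close in `H^{-β}` are weakly close. -/
theorem tendsto_apply_of_sobolevNorm {β : ℝ} (hβ : β < 1) {v : ℕ → Dist}
    (hv : ∀ n, HasParseval (v n)) (h : Tendsto (fun n => sobolevNorm (-β) (v n)) atTop (𝓝 0)) :
    Tendsto v atTop (𝓝 0) := by
  rw [tendsto_iff_forall_eval_tendsto_topDualPairing]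
  intro f
  have h1 : Tendsto (fun n => 18 * Real.pi * (∑' k, bracketSq k ^ (-(3 / 2) : ℝ)) *
      sumSeminorm 5 f * (sobolevNorm (-β) (v n)).toReal) atTop (𝓝 0) := by
    simpa using ((ENNReal.tendsto_toReal ENNReal.zero_ne_top).comp h).const_mul
      (18 * Real.pi * (∑' k, bracketSq k ^ (-(3 / 2) : ℝ)) * sumSeminorm 5 f)
  refine squeeze_zero_norm' ?_ h1
  filter_upwards [h.eventually_ne (ENNReal.zero_ne_top)] with n hn
  exact (hv n).abs_apply_le hβ f hn

section

/-! ### Gaussian moments of the free field -/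

theorem continuous_apply_testFn (f : TestFn) : Continuous fun φ : Dist => φ f :=
  WeakDual.eval_continuous f

theorem measurable_apply_testFn (f : TestFn) : Measurable fun φ : Dist => φ f :=
  (continuous_apply_testFn f).measurable

theorem measurable_fourierCoef (k : ℤ × ℤ) : Measurable fun φ : Dist => fourierCoef φ k :=
  (continuous_fourierCoef k).measurable

/-- Evaluation at a test function, as a continuous linear functional on distributions. -/
def evalCLM (f : TestFn) : StrongDual ℝ Dist where
  toFun φ := φ f
  map_add' _ _ := rfl
  map_smul' _ _ := rfl
  cont := continuous_apply_testFn f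

variable {μ₀ : Measure Dist}

theorem IsGFF.isProbabilityMeasure (h : IsGFF μ₀) : IsProbabilityMeasure μ₀ := by
  have := h.isGaussian
  infer_instance

theorem IsGFF.map_apply (h : IsGFF μ₀) (f : TestFn) :
    μ₀.map (fun φ : Dist => φ f) =
      ProbabilityTheory.gaussianReal 0 (∫ φ, φ f ^ 2 ∂μ₀).toNNReal := by
  have := h.isProbabilityMeasure
  have h1 := h.isGaussian.map_eq_gaussianReal (evalCLM f)
  have e : (evalCLM f : Dist → ℝ) = fun φ : Dist => φ f := rfl
  have h2 : ProbabilityTheory.variance (fun φ : Dist => φ f) μ₀ = ∫ φ, φ f ^ 2 ∂μ₀ :=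
    ProbabilityTheory.variance_of_integral_eq_zero (measurable_apply_testFn f).aemeasurable (h.centered f)
  rw [e, h.centered f, h2] at h1
  exact h1

theorem IsGFF.memLp_apply (h : IsGFF μ₀) (f : TestFn) : MemLp (fun φ : Dist => φ f) 2 μ₀ := by
  have h1 : MemLp (id ∘ fun φ : Dist => φ f) 2 μ₀ := by
    rw [← memLp_map_measure_iff (by fun_prop) (measurable_apply_testFn f).aemeasurable,
      h.map_apply f]
    exact ProbabilityTheory.memLp_id_gaussianReal' _ (by norm_num)
  exact h1

theorem IsGFF.integrable_mul (h : IsGFF μ₀) (f g : TestFn) :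
    Integrable (fun φ : Dist => φ f * φ g) μ₀ :=
  (h.memLp_apply f).integrable_mul (h.memLp_apply g)

theorem IsGFF.integrable_exp (h : IsGFF μ₀) (f : TestFn) :
    Integrable (fun φ : Dist => Real.exp (φ f)) μ₀ := by
  have h1 : Integrable (fun x : ℝ => Real.exp (1 * x)) (μ₀.map fun φ : Dist => φ f) := by
    rw [h.map_apply f]
    exact ProbabilityTheory.integrable_exp_mul_gaussianReal 1
  simpa [Function.comp_def] using h1.comp_measurable (measurable_apply_testFn f)

/-- The Laplace transform of the centered Gaussian variable `⟨φ, f⟩`. -/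
theorem IsGFF.integral_exp (h : IsGFF μ₀) (f : TestFn) :
    ∫ φ, Real.exp (φ f) ∂μ₀ = Real.exp ((∫ φ, φ f ^ 2 ∂μ₀) / 2) := by
  have h1 := ProbabilityTheory.mgf_gaussianReal (h.map_apply f) 1
  have h0 : 0 ≤ ∫ φ, φ f ^ 2 ∂μ₀ := integral_nonneg fun φ => sq_nonneg _
  simpa [ProbabilityTheory.mgf, Real.coe_toNNReal _ h0] using h1

theorem cosTest_neg (k : ℤ × ℤ) : cosTest (-k) = cosTest k := by
  ext x; simp [cosTest, kdot_neg]

theorem sinTest_neg (k : ℤ × ℤ) : sinTest (-k) = (-1 : ℝ) • sinTest k := by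
  ext x; simp [sinTest, kdot_neg]

theorem fourierCoef_neg (u : Dist) (k : ℤ × ℤ) :
    fourierCoef u (-k) = (starRingEnd ℂ) (fourierCoef u k) := by
  rw [fourierCoef, fourierCoef, cosTest_neg, sinTest_neg, map_smul]
  simp only [map_mul, map_sub, Complex.conj_ofReal, Complex.conj_I]
  push_cast
  simp only [smul_eq_mul]
  push_cast
  ring

/-- The covariances of the real and imaginary parts of the Fourier coefficients. -/
theorem IsGFF.covariance_trig (h : IsGFF μ₀) (k l : ℤ × ℤ) :
    (∫ φ, φ (cosTest k) * φ (cosTest l) ∂μ₀ = 2 * Real.pi ^ 2 * (bracketSq k)⁻¹ *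
      ((if k = l then 1 else 0) + (if k = -l then 1 else 0))) ∧
    (∫ φ, φ (sinTest k) * φ (sinTest l) ∂μ₀ = 2 * Real.pi ^ 2 * (bracketSq k)⁻¹ *
      ((if k = l then 1 else 0) - (if k = -l then 1 else 0))) ∧
    (∫ φ, φ (cosTest k) * φ (sinTest l) ∂μ₀ = 0) := by
  have hpi : Real.pi ≠ 0 := Real.pi_ne_zero
  set cc := ∫ φ, φ (cosTest k) * φ (cosTest l) ∂μ₀ with hcc
  set ss := ∫ φ, φ (sinTest k) * φ (sinTest l) ∂μ₀ with hss
  set cs := ∫ φ, φ (cosTest k) * φ (sinTest l) ∂μ₀ with hcs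
  set sc := ∫ φ, φ (sinTest k) * φ (cosTest l) ∂μ₀ with hsc
  have icc := h.integrable_mul (cosTest k) (cosTest l)
  have iss := h.integrable_mul (sinTest k) (sinTest l)
  have ics := h.integrable_mul (cosTest k) (sinTest l)
  have isc := h.integrable_mul (sinTest k) (cosTest l)
  have h1 : ∫ φ, fourierCoef φ k * (starRingEnd ℂ) (fourierCoef φ l) ∂μ₀ =
      (1 / (4 * Real.pi ^ 2) : ℝ) * (((cc + ss : ℝ) : ℂ) + Complex.I * ((cs - sc : ℝ) : ℂ)) := by
    have e : ∀ φ : Dist, fourierCoef φ k * (starRingEnd ℂ) (fourierCoef φ l) =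
        (1 / (4 * Real.pi ^ 2) : ℝ) * (((φ (cosTest k) * φ (cosTest l) +
          φ (sinTest k) * φ (sinTest l) : ℝ) : ℂ) + Complex.I *
          ((φ (cosTest k) * φ (sinTest l) - φ (sinTest k) * φ (cosTest l) : ℝ) : ℂ)) := by
      intro φ
      simp only [fourierCoef, map_mul, map_sub, Complex.conj_ofReal, Complex.conj_I]
      push_cast
      linear_combination (-(1 / (2 * (Real.pi : ℂ))) ^ 2 * φ (sinTest k) * φ (sinTest l)) *
        Complex.I_mul_I
    simp_rw [e]
    have i1 : Integrable (fun φ : Dist => ((φ (cosTest k) * φ (cosTest l) +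
        φ (sinTest k) * φ (sinTest l) : ℝ) : ℂ)) μ₀ := (icc.add iss).ofReal
    have i2 : Integrable (fun φ : Dist => ((φ (cosTest k) * φ (sinTest l) -
        φ (sinTest k) * φ (cosTest l) : ℝ) : ℂ)) μ₀ := (ics.sub isc).ofReal
    rw [integral_const_mul, integral_add i1 (i2.const_mul _), integral_const_mul]
    rw [integral_complex_ofReal, integral_complex_ofReal, integral_add icc iss,
      integral_sub ics isc]
  have h2 : ∫ φ, fourierCoef φ k * (starRingEnd ℂ) (fourierCoef φ (-l)) ∂μ₀ =
      (1 / (4 * Real.pi ^ 2) : ℝ) * (((cc - ss : ℝ) : ℂ) + Complex.I * ((-cs - sc : ℝ) : ℂ)) := by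
    have e : ∀ φ : Dist, fourierCoef φ k * (starRingEnd ℂ) (fourierCoef φ (-l)) =
        (1 / (4 * Real.pi ^ 2) : ℝ) * (((φ (cosTest k) * φ (cosTest l) -
          φ (sinTest k) * φ (sinTest l) : ℝ) : ℂ) + Complex.I *
          ((-(φ (cosTest k) * φ (sinTest l)) - φ (sinTest k) * φ (cosTest l) : ℝ) : ℂ)) := by
      intro φ
      rw [fourierCoef_neg, Complex.conj_conj]
      simp only [fourierCoef]
      push_cast
      linear_combination ((1 / (2 * (Real.pi : ℂ))) ^ 2 * φ (sinTest k) * φ (sinTest l)) *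
        Complex.I_mul_I
    simp_rw [e]
    have i1 : Integrable (fun φ : Dist => ((φ (cosTest k) * φ (cosTest l) -
        φ (sinTest k) * φ (sinTest l) : ℝ) : ℂ)) μ₀ := (icc.sub iss).ofReal
    have i2 : Integrable (fun φ : Dist => ((-(φ (cosTest k) * φ (sinTest l)) -
        φ (sinTest k) * φ (cosTest l) : ℝ) : ℂ)) μ₀ := (ics.neg.sub isc).ofReal
    rw [integral_const_mul, integral_add i1 (i2.const_mul _), integral_const_mul]
    have h3 := integral_sub ics.neg isc
    simp only [Pi.neg_apply] at h3
    rw [integral_complex_ofReal, integral_complex_ofReal, integral_sub icc iss, h3, integral_neg]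
  -- The covariances of the complex Fourier coefficients at `(k, l)` and at `(k, -l)` are two complex
  -- equations, which determine the four real covariances.
  rw [h.covariance] at h1 h2
  have r1 := congrArg Complex.re h1
  have m1 := congrArg Complex.im h1
  have r2 := congrArg Complex.re h2
  have m2 := congrArg Complex.im h2
  rw [Complex.re_ofReal_mul] at r1 r2
  rw [Complex.im_ofReal_mul] at m1 m2
  simp only [Complex.add_re, Complex.add_im, Complex.ofReal_re, Complex.ofReal_im,
    Complex.I_mul_re, Complex.I_mul_im, apply_ite Complex.re, apply_ite Complex.im,
    Complex.zero_re, Complex.zero_im, ite_self] at r1 r2 m1 m2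
  have hp : (1 / (4 * Real.pi ^ 2) : ℝ) ≠ 0 := by positivity
  have m1' : cs - sc = 0 := by simpa [hp] using m1.symm
  have m2' : -cs - sc = 0 := by simpa [hp] using m2.symm
  have r1' : cc + ss = 4 * Real.pi ^ 2 * (if k = l then (bracketSq k)⁻¹ else 0) := by
    rw [r1]; field_simp; ring
  have r2' : cc - ss = 4 * Real.pi ^ 2 * (if k = -l then (bracketSq k)⁻¹ else 0) := by
    rw [r2]; field_simp; ring
  clear r1 r2 h1 h2
  refine ⟨?_, ?_, by linarith⟩ <;> split_ifs at r1' r2' ⊢ <;> linarith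

/-- The test function `y ↦ (4π²)⁻¹ ∑_{k ∈ S} p_k cos(k·(x - y))`, whose pairing with a distribution
`φ` is the regularization of `φ` at `x`. -/
def fieldTest (S : Finset (ℤ × ℤ)) (p : ℤ × ℤ → ℝ) (x : ℝ × ℝ) : TestFn :=
  ∑ k ∈ S, (p k / (4 * Real.pi ^ 2)) •
    (Real.cos (kdot k x) • cosTest k + Real.sin (kdot k x) • sinTest k)

theorem apply_fieldTest (φ : Dist) (S : Finset (ℤ × ℤ)) (p : ℤ × ℤ → ℝ) (x : ℝ × ℝ) :
    φ (fieldTest S p x) = ∑ k ∈ S, p k / (4 * Real.pi ^ 2) *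
      (Real.cos (kdot k x) * φ (cosTest k) + Real.sin (kdot k x) * φ (sinTest k)) := by
  simp only [fieldTest, map_sum, map_smul, map_add, smul_eq_mul]

/-- The covariance function `(4π²)⁻¹ ∑_{k ∈ S} p_k q_k (1 + |k|²)⁻¹ cos(k·z)` of two
regularizations. -/
def covFn (S : Finset (ℤ × ℤ)) (p q : ℤ × ℤ → ℝ) (z : ℝ × ℝ) : ℝ :=
  ∑ k ∈ S, covCoef k * (p k * q k) * Real.cos (kdot k z)

theorem kdot_sub (k : ℤ × ℤ) (x y : ℝ × ℝ) : kdot k (x - y) = kdot k x - kdot k y := by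
  simp only [kdot, Prod.fst_sub, Prod.snd_sub]; ring

theorem IsGFF.integral_fieldTest_mul (h : IsGFF μ₀) {S : Finset (ℤ × ℤ)} (hS : ∀ k ∈ S, -k ∈ S)
    (p : ℤ × ℤ → ℝ) {q : ℤ × ℤ → ℝ} (hq : ∀ k, q (-k) = q k) (x y : ℝ × ℝ) :
    ∫ φ, φ (fieldTest S p x) * φ (fieldTest S q y) ∂μ₀ = covFn S p q (x - y) := by
  have hpi := Real.pi_pos
  simp_rw [apply_fieldTest, Finset.sum_mul_sum]
  have icc := fun k l => h.integrable_mul (cosTest k) (cosTest l)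
  have iss := fun k l => h.integrable_mul (sinTest k) (sinTest l)
  have ics := fun k l => h.integrable_mul (cosTest k) (sinTest l)
  have isc := fun k l => h.integrable_mul (sinTest k) (cosTest l)
  set P : ℝ := 1 / (4 * Real.pi ^ 2) with hP
  have e : ∀ (k l : ℤ × ℤ) (φ : Dist), p k / (4 * Real.pi ^ 2) *
      (Real.cos (kdot k x) * φ (cosTest k) + Real.sin (kdot k x) * φ (sinTest k)) *
      (q l / (4 * Real.pi ^ 2) *
      (Real.cos (kdot l y) * φ (cosTest l) + Real.sin (kdot l y) * φ (sinTest l))) =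
      P * P * p k * q l * (Real.cos (kdot k x) * Real.cos (kdot l y) * (φ (cosTest k) * φ (cosTest l)) +
        Real.sin (kdot k x) * Real.sin (kdot l y) * (φ (sinTest k) * φ (sinTest l)) +
        (Real.cos (kdot k x) * Real.sin (kdot l y) * (φ (cosTest k) * φ (sinTest l)) +
        Real.sin (kdot k x) * Real.cos (kdot l y) * (φ (sinTest k) * φ (cosTest l)))) := by
    intro k l φ
    rw [hP]; ring
  simp_rw [e]
  have i1 := fun k l => ((icc k l).const_mul (Real.cos (kdot k x) * Real.cos (kdot l y))).add
    ((iss k l).const_mul (Real.sin (kdot k x) * Real.sin (kdot l y)))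
  have i2 := fun k l => ((ics k l).const_mul (Real.cos (kdot k x) * Real.sin (kdot l y))).add
    ((isc k l).const_mul (Real.sin (kdot k x) * Real.cos (kdot l y)))
  have key : ∀ k l, ∫ φ, P * P * p k * q l * (Real.cos (kdot k x) * Real.cos (kdot l y) *
        (φ (cosTest k) * φ (cosTest l)) +
        Real.sin (kdot k x) * Real.sin (kdot l y) * (φ (sinTest k) * φ (sinTest l)) +
        (Real.cos (kdot k x) * Real.sin (kdot l y) * (φ (cosTest k) * φ (sinTest l)) +
        Real.sin (kdot k x) * Real.cos (kdot l y) * (φ (sinTest k) * φ (cosTest l)))) ∂μ₀ =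
      (if k = l then covCoef k * (p k * q k) * Real.cos (kdot k (x - y)) / 2 else 0) +
      (if k = -l then covCoef k * (p k * q k) * Real.cos (kdot k (x - y)) / 2 else 0) := by
    intro k l
    rw [integral_const_mul]
    have h1 := integral_add (i1 k l) (i2 k l)
    simp only [Pi.add_apply] at h1
    rw [h1, integral_add ((icc k l).const_mul _) ((iss k l).const_mul _),
      integral_add ((ics k l).const_mul _) ((isc k l).const_mul _)]
    simp only [integral_const_mul]
    have hsc : ∫ φ, φ (sinTest k) * φ (cosTest l) ∂μ₀ = 0 := by
      rw [← (h.covariance_trig l k).2.2]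
      exact integral_congr_ae (ae_of_all _ fun φ => mul_comm _ _)
    rw [(h.covariance_trig k l).1, (h.covariance_trig k l).2.1, (h.covariance_trig k l).2.2, hsc]
    have a1 : k = l → P * P * p k * q l * (Real.cos (kdot k x) * Real.cos (kdot l y) *
        (2 * Real.pi ^ 2 * (bracketSq k)⁻¹) + Real.sin (kdot k x) * Real.sin (kdot l y) *
        (2 * Real.pi ^ 2 * (bracketSq k)⁻¹)) =
        covCoef k * (p k * q k) * Real.cos (kdot k (x - y)) / 2 := by
      rintro rfl
      rw [kdot_sub, Real.cos_sub, covCoef, hP]; field_simp; ring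
    have a2 : k = -l → P * P * p k * q l * (Real.cos (kdot k x) * Real.cos (kdot l y) *
        (2 * Real.pi ^ 2 * (bracketSq k)⁻¹) - Real.sin (kdot k x) * Real.sin (kdot l y) *
        (2 * Real.pi ^ 2 * (bracketSq k)⁻¹)) =
        covCoef k * (p k * q k) * Real.cos (kdot k (x - y)) / 2 := by
      intro hkl
      obtain rfl : l = -k := by rw [hkl, neg_neg]
      rw [kdot_neg, Real.cos_neg, Real.sin_neg, hq, kdot_sub, Real.cos_sub, covCoef, hP]
      field_simp; ring
    by_cases c1 : k = l <;> by_cases c2 : k = -l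
    · rw [if_pos c1, if_pos c2, if_pos c1, if_pos c2, ← a1 c1]
      nth_rewrite 2 [a1 c1]
      rw [← a2 c2]; ring
    · rw [if_pos c1, if_neg c2, if_pos c1, if_neg c2, ← a1 c1]; ring
    · rw [if_neg c1, if_pos c2, if_neg c1, if_pos c2, ← a2 c2]; ring
    · rw [if_neg c1, if_neg c2, if_neg c1, if_neg c2]; ring
  have iterm := fun k l => ((i1 k l).add (i2 k l)).const_mul (P * P * p k * q l)
  simp only [Pi.add_apply] at iterm
  rw [integral_finsetSum _ fun k _ => integrable_finsetSum _ fun l _ => iterm k l]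
  simp_rw [integral_finsetSum _ fun l _ => iterm _ l, key]
  rw [covFn]
  refine Finset.sum_congr rfl fun k hk => ?_
  rw [Finset.sum_add_distrib, Finset.sum_ite_eq, if_pos hk]
  have : ∀ l, (k = -l) ↔ (-k = l) := fun l => by rw [neg_eq_iff_eq_neg]
  simp_rw [this]
  rw [Finset.sum_ite_eq, if_pos (hS k hk)]
  ring

end

section

variable {μ₀ : Measure Dist}

/-! ### Second moments of Wick exponentials -/

/-- The Wick exponential of a trigonometric regularization: only the finitely many modes in `S`
enter. -/
def wickTrig (α : ℝ) (S : Finset (ℤ × ℤ)) (p : ℤ × ℤ → ℝ) (φ : Dist) (x : ℝ × ℝ) : ℝ :=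
  Real.exp (α * φ (fieldTest S p x) - α ^ 2 / 2 * covFn S p p 0)

theorem continuous_apply_fieldTest (S : Finset (ℤ × ℤ)) (p : ℤ × ℤ → ℝ) (φ : Dist) :
    Continuous fun x => φ (fieldTest S p x) := by
  simp_rw [apply_fieldTest]
  fun_prop

theorem continuous_wickTrig (α : ℝ) (S : Finset (ℤ × ℤ)) (p : ℤ × ℤ → ℝ) (φ : Dist) :
    Continuous (wickTrig α S p φ) := by
  exact Real.continuous_exp.comp
    ((continuous_const.mul (continuous_apply_fieldTest S p φ)).sub continuous_const)

theorem measurable_wickTrig (α : ℝ) (S : Finset (ℤ × ℤ)) (p : ℤ × ℤ → ℝ) :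
    Measurable fun z : Dist × (ℝ × ℝ) => wickTrig α S p z.1 z.2 := by
  have hm : ∀ f : TestFn, Measurable fun z : Dist × (ℝ × ℝ) => z.1 f := fun f =>
    (measurable_apply_testFn f).comp measurable_fst
  have hk : ∀ k, Measurable fun z : Dist × (ℝ × ℝ) => kdot k z.2 := fun k =>
    (continuous_kdot k).measurable.comp measurable_snd
  unfold wickTrig
  simp_rw [apply_fieldTest]
  refine Real.measurable_exp.comp (Measurable.sub_const (Measurable.const_mul ?_ _) _)
  refine Finset.measurable_sum _ fun k _ => Measurable.const_mul ?_ _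
  exact ((Real.measurable_cos.comp (hk k)).mul (hm _)).add
    ((Real.measurable_sin.comp (hk k)).mul (hm _))

theorem continuous_covFn (S : Finset (ℤ × ℤ)) (p q : ℤ × ℤ → ℝ) : Continuous (covFn S p q) := by
  unfold covFn; fun_prop

theorem abs_covFn_le (S : Finset (ℤ × ℤ)) (p q : ℤ × ℤ → ℝ) (z : ℝ × ℝ) :
    |covFn S p q z| ≤ ∑ k ∈ S, |covCoef k * (p k * q k)| := by
  refine (Finset.abs_sum_le_sum_abs _ _).trans (Finset.sum_le_sum fun k _ => ?_)
  rw [abs_mul]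
  exact mul_le_of_le_one_right (abs_nonneg _) (Real.abs_cos_le_one _)

theorem wickTrig_mul_eq (α : ℝ) (S : Finset (ℤ × ℤ)) (p q : ℤ × ℤ → ℝ) (x y : ℝ × ℝ) (φ : Dist) :
    wickTrig α S p φ x * wickTrig α S q φ y =
      Real.exp (-(α ^ 2 / 2 * (covFn S p p 0 + covFn S q q 0))) *
        Real.exp (φ (α • fieldTest S p x + α • fieldTest S q y)) := by
  rw [wickTrig, wickTrig, ← Real.exp_add, ← Real.exp_add, map_add, map_smul, map_smul]
  simp only [smul_eq_mul]
  ring_nf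

theorem IsGFF.integrable_wickTrig_mul (h : IsGFF μ₀) (α : ℝ) (S : Finset (ℤ × ℤ))
    (p q : ℤ × ℤ → ℝ) (x y : ℝ × ℝ) :
    Integrable (fun φ => wickTrig α S p φ x * wickTrig α S q φ y) μ₀ := by
  simp_rw [wickTrig_mul_eq]
  exact (h.integrable_exp _).const_mul _

/-- The correlation of two Wick exponentials. The normalization cancels the variances, and only the
cross covariance is left. -/
theorem IsGFF.integral_wickTrig_mul (h : IsGFF μ₀) (α : ℝ) {S : Finset (ℤ × ℤ)}
    (hS : ∀ k ∈ S, -k ∈ S) {p q : ℤ × ℤ → ℝ} (hp : ∀ k, p (-k) = p k) (hq : ∀ k, q (-k) = q k)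
    (x y : ℝ × ℝ) :
    ∫ φ, wickTrig α S p φ x * wickTrig α S q φ y ∂μ₀ =
      Real.exp (α ^ 2 * covFn S p q (x - y)) := by
  simp_rw [wickTrig_mul_eq]
  rw [integral_const_mul, h.integral_exp, ← Real.exp_add]
  have e : ∀ φ : Dist, φ (α • fieldTest S p x + α • fieldTest S q y) ^ 2 =
      α ^ 2 * (φ (fieldTest S p x) * φ (fieldTest S p x)) +
      (2 * α ^ 2 * (φ (fieldTest S p x) * φ (fieldTest S q y)) +
      α ^ 2 * (φ (fieldTest S q y) * φ (fieldTest S q y))) := by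
    intro φ
    rw [map_add, map_smul, map_smul, smul_eq_mul, smul_eq_mul]
    ring
  simp_rw [e]
  have i := fun f g => h.integrable_mul f g
  have i2 : Integrable (fun φ : Dist => 2 * α ^ 2 * (φ (fieldTest S p x) * φ (fieldTest S q y)) +
      α ^ 2 * (φ (fieldTest S q y) * φ (fieldTest S q y))) μ₀ :=
    ((i _ _).const_mul _).add ((i _ _).const_mul _)
  rw [integral_add ((i _ _).const_mul _) i2,
    integral_add ((i _ _).const_mul _) ((i _ _).const_mul _), integral_const_mul,
    integral_const_mul, integral_const_mul, h.integral_fieldTest_mul hS p hp,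
    h.integral_fieldTest_mul hS p hq, h.integral_fieldTest_mul hS q hq, sub_self, sub_self]
  ring_nf

/-- The measure `dx dy` on `Λ × Λ`. -/
abbrev boxSq : Measure ((ℝ × ℝ) × (ℝ × ℝ)) := (volume.restrict box).prod (volume.restrict box)

theorem IsGFF.integrable_wickTrig_mul_prod (h : IsGFF μ₀) (α : ℝ) {S : Finset (ℤ × ℤ)}
    (hS : ∀ k ∈ S, -k ∈ S) {p q : ℤ × ℤ → ℝ} (hp : ∀ k, p (-k) = p k) (hq : ∀ k, q (-k) = q k) :
    Integrable (fun z : Dist × ((ℝ × ℝ) × (ℝ × ℝ)) =>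
      wickTrig α S p z.1 z.2.1 * wickTrig α S q z.1 z.2.2) (μ₀.prod boxSq) := by
  have := h.isProbabilityMeasure
  have hmeas : Measurable (fun z : Dist × ((ℝ × ℝ) × (ℝ × ℝ)) =>
      wickTrig α S p z.1 z.2.1 * wickTrig α S q z.1 z.2.2) :=
    ((measurable_wickTrig α S p).comp (measurable_fst.prodMk measurable_snd.fst)).mul
    ((measurable_wickTrig α S q).comp (measurable_fst.prodMk measurable_snd.snd))
  rw [integrable_prod_iff' hmeas.aestronglyMeasurable]
  refine ⟨ae_of_all _ fun xy => h.integrable_wickTrig_mul α S p q xy.1 xy.2, ?_⟩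
  have e : ∀ xy : (ℝ × ℝ) × (ℝ × ℝ), ∫ φ, ‖wickTrig α S p φ xy.1 * wickTrig α S q φ xy.2‖ ∂μ₀ =
      Real.exp (α ^ 2 * covFn S p q (xy.1 - xy.2)) := by
    intro xy
    rw [← h.integral_wickTrig_mul α hS hp hq]
    refine integral_congr_ae (ae_of_all _ fun φ => ?_)
    exact Real.norm_of_nonneg (mul_nonneg (Real.exp_pos _).le (Real.exp_pos _).le)
  simp_rw [e]
  have hc := continuous_covFn S p q
  refine Integrable.of_bound (Continuous.aestronglyMeasurable (by fun_prop))
    (Real.exp (α ^ 2 * ∑ k ∈ S, |covCoef k * (p k * q k)|)) (ae_of_all _ fun xy => ?_)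
  rw [Real.norm_of_nonneg (Real.exp_pos _).le]
  gcongr
  exact (le_abs_self _).trans (abs_covFn_le S p q _)

/-- The Fourier coefficients of the Wick exponential of a trigonometric regularization. -/
def wickTrigCoef (α : ℝ) (S : Finset (ℤ × ℤ)) (p : ℤ × ℤ → ℝ) (k : ℤ × ℤ) (φ : Dist) : ℂ :=
  ∫ x in box, (wickTrig α S p φ x : ℂ) * expFn (-k) x

theorem stronglyMeasurable_wickTrigCoef (α : ℝ) (S : Finset (ℤ × ℤ)) (p : ℤ × ℤ → ℝ) (k : ℤ × ℤ) :
    StronglyMeasurable (wickTrigCoef α S p k) := by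
  have : Measurable fun z : Dist × (ℝ × ℝ) => (wickTrig α S p z.1 z.2 : ℂ) * expFn (-k) z.2 :=
    (Complex.measurable_ofReal.comp (measurable_wickTrig α S p)).mul
      ((continuous_expFn _).measurable.comp measurable_snd)
  exact this.stronglyMeasurable.integral_prod_right

theorem IsGFF.integrable_wickTrig_mul_expFn (h : IsGFF μ₀) (α : ℝ) {S : Finset (ℤ × ℤ)}
    (hS : ∀ k ∈ S, -k ∈ S) {p q : ℤ × ℤ → ℝ} (hp : ∀ k, p (-k) = p k) (hq : ∀ k, q (-k) = q k)
    (k : ℤ × ℤ) :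
    Integrable (fun z : Dist × ((ℝ × ℝ) × (ℝ × ℝ)) =>
      ((wickTrig α S p z.1 z.2.1 * wickTrig α S q z.1 z.2.2 : ℝ) : ℂ) *
        (expFn (-k) z.2.1 * expFn k z.2.2)) (μ₀.prod boxSq) := by
  have := h.isProbabilityMeasure
  refine (h.integrable_wickTrig_mul_prod α hS hp hq).ofReal.mul_bdd
    (c := 1 / (2 * Real.pi) * (1 / (2 * Real.pi))) ?_ (ae_of_all _ fun z => ?_)
  · refine Measurable.aestronglyMeasurable ?_
    exact ((continuous_expFn _).measurable.comp (by fun_prop)).mul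
      ((continuous_expFn _).measurable.comp (by fun_prop))
  · rw [norm_mul, norm_expFn, norm_expFn]

theorem integral_wickTrig_mul_expFn (α : ℝ) (S : Finset (ℤ × ℤ)) (p q : ℤ × ℤ → ℝ) (k : ℤ × ℤ)
    (φ : Dist) : ∫ xy, ((wickTrig α S p φ xy.1 * wickTrig α S q φ xy.2 : ℝ) : ℂ) *
        (expFn (-k) xy.1 * expFn k xy.2) ∂boxSq =
      wickTrigCoef α S p k φ * (starRingEnd ℂ) (wickTrigCoef α S q k φ) := by
  rw [wickTrigCoef, wickTrigCoef, ← integral_conj, ← integral_prod_mul]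
  refine integral_congr_ae (ae_of_all _ fun xy => ?_)
  simp only [map_mul, Complex.conj_ofReal, expFn_neg, Complex.conj_conj]
  push_cast
  ring

theorem IsGFF.integrable_wickTrigCoef_mul (h : IsGFF μ₀) (α : ℝ) {S : Finset (ℤ × ℤ)}
    (hS : ∀ k ∈ S, -k ∈ S) {p q : ℤ × ℤ → ℝ} (hp : ∀ k, p (-k) = p k) (hq : ∀ k, q (-k) = q k)
    (k : ℤ × ℤ) : Integrable (fun φ =>
      wickTrigCoef α S p k φ * (starRingEnd ℂ) (wickTrigCoef α S q k φ)) μ₀ := by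
  have := h.isProbabilityMeasure
  simp_rw [← integral_wickTrig_mul_expFn]
  exact (h.integrable_wickTrig_mul_expFn α hS hp hq k).integral_prod_left

theorem IsGFF.integral_wickTrigCoef_mul (h : IsGFF μ₀) (α : ℝ) {S : Finset (ℤ × ℤ)}
    (hS : ∀ k ∈ S, -k ∈ S) {p q : ℤ × ℤ → ℝ} (hp : ∀ k, p (-k) = p k) (hq : ∀ k, q (-k) = q k)
    (k : ℤ × ℤ) : ∫ φ, wickTrigCoef α S p k φ * (starRingEnd ℂ) (wickTrigCoef α S q k φ) ∂μ₀ =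
      ∫ xy, (Real.exp (α ^ 2 * covFn S p q (xy.1 - xy.2)) : ℂ) *
        (expFn (-k) xy.1 * expFn k xy.2) ∂boxSq := by
  have := h.isProbabilityMeasure
  simp_rw [← integral_wickTrig_mul_expFn]
  rw [integral_integral_swap (h.integrable_wickTrig_mul_expFn α hS hp hq k)]
  refine integral_congr_ae (ae_of_all _ fun xy => ?_)
  simp only
  rw [integral_mul_const, integral_complex_ofReal, h.integral_wickTrig_mul α hS hp hq]

theorem expFn_mul (k l : ℤ × ℤ) (x : ℝ × ℝ) :
    expFn k x * expFn l x = (1 / (2 * Real.pi) : ℝ) * expFn (k + l) x := by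
  have : kdot (k + l) x = kdot k x + kdot l x := by
    simp only [kdot, Prod.fst_add, Prod.snd_add]; push_cast; ring
  rw [expFn_def, expFn_def, expFn_def, this]
  push_cast
  rw [add_mul, Complex.exp_add]
  ring

theorem integral_box_expFn_mul (k l : ℤ × ℤ) :
    ∫ x in box, expFn k x * expFn l x = if k + l = 0 then 1 else 0 := by
  simp_rw [expFn_mul]
  rw [integral_const_mul, integral_box_expFn]
  split_ifs
  · have : (Real.pi : ℂ) ≠ 0 := by exact_mod_cast Real.pi_ne_zero
    push_cast; field_simp
  · simp

theorem exp_kdot_sub (m : ℤ × ℤ) (x y : ℝ × ℝ) :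
    Complex.exp ((kdot m (x - y) : ℝ) * Complex.I) =
      4 * Real.pi ^ 2 * (expFn m x * expFn (-m) y) := by
  have : (Real.pi : ℂ) ≠ 0 := by exact_mod_cast Real.pi_ne_zero
  rw [expFn_def, expFn_def, kdot_neg, kdot_sub]
  push_cast
  rw [sub_eq_add_neg, add_mul, Complex.exp_add]
  field_simp
  norm_num

theorem integral_exp_kdot_sub (m k : ℤ × ℤ) :
    ∫ xy, Complex.exp ((kdot m (xy.1 - xy.2) : ℝ) * Complex.I) *
      (expFn (-k) xy.1 * expFn k xy.2) ∂boxSq = if m = k then 4 * (Real.pi : ℂ) ^ 2 else 0 := by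
  have e : ∀ xy : (ℝ × ℝ) × (ℝ × ℝ), Complex.exp ((kdot m (xy.1 - xy.2) : ℝ) * Complex.I) *
      (expFn (-k) xy.1 * expFn k xy.2) = 4 * Real.pi ^ 2 *
      ((expFn m xy.1 * expFn (-k) xy.1) * (expFn (-m) xy.2 * expFn k xy.2)) := by
    intro xy
    rw [exp_kdot_sub]; ring
  simp_rw [e]
  rw [integral_const_mul, integral_prod_mul (fun x => expFn m x * expFn (-k) x)
    (fun y => expFn (-m) y * expFn k y), integral_box_expFn_mul, integral_box_expFn_mul]
  by_cases h : m = k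
  · simp [h]
  · rw [if_neg h, if_neg (by rwa [← sub_eq_add_neg, sub_eq_zero])]; simp

theorem kdot_sum {ι : Type*} (s : Finset ι) (κ : ι → ℤ × ℤ) (z : ℝ × ℝ) :
    kdot (∑ i ∈ s, κ i) z = ∑ i ∈ s, kdot (κ i) z := by
  simp only [kdot, Prod.fst_sum, Prod.snd_sum]
  push_cast
  rw [Finset.sum_mul, Finset.sum_mul, ← Finset.sum_add_distrib]

theorem covFn_eq_exp {S : Finset (ℤ × ℤ)} (hS : ∀ k ∈ S, -k ∈ S) {p q : ℤ × ℤ → ℝ}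
    (hp : ∀ k, p (-k) = p k) (hq : ∀ k, q (-k) = q k) (z : ℝ × ℝ) :
    (covFn S p q z : ℂ) = ∑ k ∈ S, ((covCoef k * (p k * q k) : ℝ) : ℂ) *
      Complex.exp ((kdot k z : ℝ) * Complex.I) := by
  set r : ℤ × ℤ → ℝ := fun k => covCoef k * (p k * q k) with hr
  have hreven : ∀ k, r (-k) = r k := fun k => by simp only [hr, covCoef, bracketSq_neg, hp, hq]
  have hsin : ∑ k ∈ S, r k * Real.sin (kdot k z) = 0 := by
    have h1 : ∑ k ∈ S, r k * Real.sin (kdot k z) = ∑ k ∈ S, r (-k) * Real.sin (kdot (-k) z) := by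
      refine Finset.sum_nbij' (fun k => -k) (fun k => -k) hS hS ?_ ?_ ?_ <;> simp
    simp_rw [hreven, kdot_neg, Real.sin_neg, mul_neg, Finset.sum_neg_distrib] at h1
    linarith
  have h2 : ∀ k, (r k : ℂ) * Complex.exp ((kdot k z : ℝ) * Complex.I) =
      ((r k * Real.cos (kdot k z) : ℝ) : ℂ) + ((r k * Real.sin (kdot k z) : ℝ) : ℂ) * Complex.I := by
    intro k
    rw [Complex.exp_mul_I]
    push_cast; ring
  rw [Finset.sum_congr rfl fun k _ => h2 k, Finset.sum_add_distrib, ← Finset.sum_mul, ← Complex.ofReal_sum, ← Complex.ofReal_sum, hsin]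
  rw [Complex.ofReal_zero, zero_mul, add_zero]
  rfl

/-- The coefficients of the chaos expansion: sums of `∏ c(κ_i)` over the `κ` with `∑ κ_i = k`. -/
def chaosSum (S : Finset (ℤ × ℤ)) (n : ℕ) (k : ℤ × ℤ) (c : (Fin n → ℤ × ℤ) → ℝ) : ℝ :=
  ∑ κ ∈ Fintype.piFinset fun _ : Fin n => S, if ∑ i, κ i = k then c κ else 0

/-- The `n`-th power of the covariance function has as its Fourier coefficients the `n`-fold
convolution of those of the covariance function. -/
theorem integral_covFn_pow {S : Finset (ℤ × ℤ)} (hS : ∀ k ∈ S, -k ∈ S) {p q : ℤ × ℤ → ℝ}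
    (hp : ∀ k, p (-k) = p k) (hq : ∀ k, q (-k) = q k) (k : ℤ × ℤ) (n : ℕ) :
    ∫ xy, (covFn S p q (xy.1 - xy.2) : ℂ) ^ n * (expFn (-k) xy.1 * expFn k xy.2) ∂boxSq =
      (4 * Real.pi ^ 2 * chaosSum S n k fun κ => ∏ i, (covCoef (κ i) * (p (κ i) * q (κ i))) : ℝ) := by
  have e : ∀ xy : (ℝ × ℝ) × (ℝ × ℝ), (covFn S p q (xy.1 - xy.2) : ℂ) ^ n *
      (expFn (-k) xy.1 * expFn k xy.2) = ∑ κ ∈ Fintype.piFinset fun _ : Fin n => S,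
      ((∏ i, (covCoef (κ i) * (p (κ i) * q (κ i))) : ℝ) : ℂ) *
      (Complex.exp ((kdot (∑ i, κ i) (xy.1 - xy.2) : ℝ) * Complex.I) *
        (expFn (-k) xy.1 * expFn k xy.2)) := by
    intro xy
    have h1 : (covFn S p q (xy.1 - xy.2) : ℂ) ^ n = ∏ _i : Fin n, ∑ k ∈ S,
        ((covCoef k * (p k * q k) : ℝ) : ℂ) * Complex.exp ((kdot k (xy.1 - xy.2) : ℝ) * Complex.I) := by
      rw [Finset.prod_const, Finset.card_univ, Fintype.card_fin, covFn_eq_exp hS hp hq]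
    rw [h1, Finset.prod_univ_sum, Finset.sum_mul]
    refine Finset.sum_congr rfl fun κ _ => ?_
    rw [Finset.prod_mul_distrib, ← Complex.exp_sum, kdot_sum]
    push_cast
    rw [Finset.sum_mul]
    ring
  simp_rw [e]
  have hint : ∀ m : ℤ × ℤ, Integrable (fun xy : (ℝ × ℝ) × (ℝ × ℝ) =>
      Complex.exp ((kdot m (xy.1 - xy.2) : ℝ) * Complex.I) * (expFn (-k) xy.1 * expFn k xy.2))
      boxSq := by
    intro m
    refine Integrable.of_bound (Continuous.aestronglyMeasurable (by fun_prop))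
      (1 / (2 * Real.pi) * (1 / (2 * Real.pi))) (ae_of_all _ fun xy => ?_)
    rw [norm_mul, Complex.norm_exp_ofReal_mul_I, norm_mul, norm_expFn, norm_expFn, one_mul]
  rw [integral_finsetSum _ fun κ _ => (hint _).const_mul _]
  simp_rw [integral_const_mul, integral_exp_kdot_sub]
  rw [chaosSum, Finset.mul_sum, Complex.ofReal_sum]
  refine Finset.sum_congr rfl fun κ _ => ?_
  split_ifs <;> push_cast <;> ring

/-- The chaos expansion of the correlation of two Wick exponentials. -/
theorem IsGFF.hasSum_integral_wickTrigCoef_mul (h : IsGFF μ₀) (α : ℝ) {S : Finset (ℤ × ℤ)}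
    (hS : ∀ k ∈ S, -k ∈ S) {p q : ℤ × ℤ → ℝ} (hp : ∀ k, p (-k) = p k) (hq : ∀ k, q (-k) = q k)
    (k : ℤ × ℤ) :
    HasSum (fun n : ℕ => (((α ^ 2) ^ n / n.factorial * (4 * Real.pi ^ 2 *
      chaosSum S n k fun κ => ∏ i, (covCoef (κ i) * (p (κ i) * q (κ i)))) : ℝ) : ℂ))
      (∫ φ, wickTrigCoef α S p k φ * (starRingEnd ℂ) (wickTrigCoef α S q k φ) ∂μ₀) := by
  have hpi := Real.pi_pos
  rw [h.integral_wickTrigCoef_mul α hS hp hq]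
  have hc := continuous_covFn S p q
  set B := ∑ k ∈ S, |covCoef k * (p k * q k)| with hB
  have hB0 : 0 ≤ B := Finset.sum_nonneg fun _ _ => abs_nonneg _
  have hbd : ∀ (n : ℕ) (xy : (ℝ × ℝ) × (ℝ × ℝ)),
      ‖((((α ^ 2) ^ n / n.factorial : ℝ) : ℂ)) * ((covFn S p q (xy.1 - xy.2) : ℂ) ^ n *
      (expFn (-k) xy.1 * expFn k xy.2))‖ ≤
      (1 / (2 * Real.pi) * (1 / (2 * Real.pi))) * ((α ^ 2 * B) ^ n / n.factorial) := by
    intro n xy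
    rw [norm_mul, norm_mul, norm_mul, norm_expFn, norm_expFn, norm_pow, Complex.norm_real,
      Complex.norm_real, Real.norm_of_nonneg (by positivity), Real.norm_eq_abs]
    have := pow_le_pow_left₀ (abs_nonneg _) (abs_covFn_le S p q (xy.1 - xy.2)) n
    calc _ ≤ (α ^ 2) ^ n / n.factorial * (B ^ n * (1 / (2 * Real.pi) * (1 / (2 * Real.pi)))) := by
          gcongr
      _ = _ := by rw [mul_pow]; ring
  have main := hasSum_integral_of_summable_integral_norm (μ := boxSq)
    (F := fun (n : ℕ) (xy : (ℝ × ℝ) × (ℝ × ℝ)) => (((α ^ 2) ^ n / n.factorial : ℝ) : ℂ) *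
      ((covFn S p q (xy.1 - xy.2) : ℂ) ^ n * (expFn (-k) xy.1 * expFn k xy.2)))
    (fun n => Integrable.of_bound (Continuous.aestronglyMeasurable (by fun_prop)) _
      (ae_of_all _ (hbd n))) (by
      have hs : Summable fun n : ℕ => boxSq.real univ * ((1 / (2 * Real.pi) * (1 / (2 * Real.pi))) *
          ((α ^ 2 * B) ^ n / n.factorial)) :=
        ((Real.summable_pow_div_factorial _).mul_left _).mul_left _
      refine Summable.of_nonneg_of_le (fun n => integral_nonneg fun _ => norm_nonneg _)
        (fun n => ?_) hs
      have := integral_mono_of_nonneg (μ := boxSq) (ae_of_all _ fun _ => norm_nonneg _)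
        (integrable_const _) (ae_of_all _ (hbd n))
      rwa [integral_const, smul_eq_mul] at this)
  have hval : ∀ xy : (ℝ × ℝ) × (ℝ × ℝ), ∑' n : ℕ, (((α ^ 2) ^ n / n.factorial : ℝ) : ℂ) *
      ((covFn S p q (xy.1 - xy.2) : ℂ) ^ n * (expFn (-k) xy.1 * expFn k xy.2)) =
      (Real.exp (α ^ 2 * covFn S p q (xy.1 - xy.2)) : ℂ) * (expFn (-k) xy.1 * expFn k xy.2) := by
    intro xy
    have h1 : HasSum (fun n : ℕ => (((α ^ 2 * covFn S p q (xy.1 - xy.2)) ^ n / n.factorial : ℝ) : ℂ))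
        ((Real.exp (α ^ 2 * covFn S p q (xy.1 - xy.2)) : ℝ) : ℂ) := by
      have h0 := NormedSpace.expSeries_div_hasSum_exp (𝔸 := ℝ) (α ^ 2 * covFn S p q (xy.1 - xy.2))
      rw [← Real.exp_eq_exp_ℝ] at h0
      exact Complex.hasSum_ofReal.2 h0
    rw [← (h1.mul_right (expFn (-k) xy.1 * expFn k xy.2)).tsum_eq]
    refine tsum_congr fun n => ?_
    push_cast; rw [mul_pow]; ring
  simp_rw [hval, integral_const_mul, integral_covFn_pow hS hp hq] at main
  push_cast at main ⊢
  exact main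

end

section

variable {μ₀ : Measure Dist}

/-! ### Mean square distances of Wick exponentials -/

theorem ofReal_norm_sub_sq (z w : ℂ) : ((‖z - w‖ ^ 2 : ℝ) : ℂ) =
    z * (starRingEnd ℂ) z - z * (starRingEnd ℂ) w -
      (w * (starRingEnd ℂ) z - w * (starRingEnd ℂ) w) := by
  rw [Complex.ofReal_pow, ← Complex.mul_conj', map_sub]
  ring

/-- The coefficients of the four correlations in `E|X - Y|² = E X X̄ - E X Ȳ - (E Y X̄ - E Y Ȳ)` combine
to a square. -/
theorem chaosSum_expand (S : Finset (ℤ × ℤ)) (n : ℕ) (k : ℤ × ℤ) (p q : ℤ × ℤ → ℝ) :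
    (chaosSum S n k fun κ => ∏ i, (covCoef (κ i) * (p (κ i) * p (κ i)))) -
    (chaosSum S n k fun κ => ∏ i, (covCoef (κ i) * (p (κ i) * q (κ i)))) -
    ((chaosSum S n k fun κ => ∏ i, (covCoef (κ i) * (q (κ i) * p (κ i)))) -
    (chaosSum S n k fun κ => ∏ i, (covCoef (κ i) * (q (κ i) * q (κ i))))) =
    chaosSum S n k fun κ => (∏ i, covCoef (κ i)) * (∏ i, p (κ i) - ∏ i, q (κ i)) ^ 2 := by
  simp only [chaosSum, ← Finset.sum_sub_distrib]
  refine Finset.sum_congr rfl fun κ _ => ?_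
  split_ifs
  · simp only [Finset.prod_mul_distrib]; ring
  · simp

/-- The chaos expansion of the mean square distance of the Fourier coefficients of two Wick
exponentials. -/
theorem IsGFF.hasSum_integral_wickTrigCoef_sub (h : IsGFF μ₀) (α : ℝ) {S : Finset (ℤ × ℤ)}
    (hS : ∀ k ∈ S, -k ∈ S) {p q : ℤ × ℤ → ℝ} (hp : ∀ k, p (-k) = p k) (hq : ∀ k, q (-k) = q k)
    (k : ℤ × ℤ) :
    HasSum (fun n : ℕ => (α ^ 2) ^ n / n.factorial * (4 * Real.pi ^ 2 *
      chaosSum S n k fun κ => (∏ i, covCoef (κ i)) * (∏ i, p (κ i) - ∏ i, q (κ i)) ^ 2))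
      (∫ φ, ‖wickTrigCoef α S p k φ - wickTrigCoef α S q k φ‖ ^ 2 ∂μ₀) := by
  have i := fun {p q : ℤ × ℤ → ℝ} (hp : ∀ k, p (-k) = p k) (hq : ∀ k, q (-k) = q k) =>
    h.integrable_wickTrigCoef_mul α hS hp hq k
  have s := fun {p q : ℤ × ℤ → ℝ} (hp : ∀ k, p (-k) = p k) (hq : ∀ k, q (-k) = q k) =>
    h.hasSum_integral_wickTrigCoef_mul α hS hp hq k
  have main := ((s hp hp).sub (s hp hq)).sub ((s hq hp).sub (s hq hq))
  have i1 : Integrable (fun φ => wickTrigCoef α S p k φ * (starRingEnd ℂ) (wickTrigCoef α S p k φ) -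
      wickTrigCoef α S p k φ * (starRingEnd ℂ) (wickTrigCoef α S q k φ)) μ₀ :=
    (i hp hp).sub (i hp hq)
  have i2 : Integrable (fun φ => wickTrigCoef α S q k φ * (starRingEnd ℂ) (wickTrigCoef α S p k φ) -
      wickTrigCoef α S q k φ * (starRingEnd ℂ) (wickTrigCoef α S q k φ)) μ₀ :=
    (i hq hp).sub (i hq hq)
  rw [← integral_sub (i hp hp) (i hp hq), ← integral_sub (i hq hp) (i hq hq),
    ← integral_sub i1 i2] at main
  simp only [← ofReal_norm_sub_sq] at main
  rw [integral_complex_ofReal] at main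
  rw [← Complex.hasSum_ofReal]
  have e2 : ∀ n : ℕ, (((α ^ 2) ^ n / n.factorial * (4 * Real.pi ^ 2 *
      chaosSum S n k fun κ => (∏ i, covCoef (κ i)) * (∏ i, p (κ i) - ∏ i, q (κ i)) ^ 2) : ℝ) : ℂ) =
      _ := fun n => by
    rw [← chaosSum_expand, mul_sub, mul_sub, mul_sub, mul_sub, mul_sub, mul_sub,
      Complex.ofReal_sub, Complex.ofReal_sub, Complex.ofReal_sub]
  simp_rw [e2]
  exact main

theorem integrable_norm_wickTrigCoef_sub_sq (h : IsGFF μ₀) (α : ℝ) {S : Finset (ℤ × ℤ)}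
    (hS : ∀ k ∈ S, -k ∈ S) {p q : ℤ × ℤ → ℝ} (hp : ∀ k, p (-k) = p k) (hq : ∀ k, q (-k) = q k)
    (k : ℤ × ℤ) :
    Integrable (fun φ => ‖wickTrigCoef α S p k φ - wickTrigCoef α S q k φ‖ ^ 2) μ₀ := by
  have i := fun {p q : ℤ × ℤ → ℝ} (hp : ∀ k, p (-k) = p k) (hq : ∀ k, q (-k) = q k) =>
    h.integrable_wickTrigCoef_mul α hS hp hq k
  refine (((i hp hp).sub (i hp hq)).sub ((i hq hp).sub (i hq hq))).re.congr
    (ae_of_all _ fun φ => ?_)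
  exact congrArg Complex.re
    (ofReal_norm_sub_sq (wickTrigCoef α S p k φ) (wickTrigCoef α S q k φ)).symm

theorem abs_prod_sub_prod_le {ι : Type*} (s : Finset ι) {a b : ι → ℝ}
    (ha : ∀ i ∈ s, a i ∈ Icc (0 : ℝ) 1) (hb : ∀ i ∈ s, b i ∈ Icc (0 : ℝ) 1) :
    |∏ i ∈ s, a i - ∏ i ∈ s, b i| ≤ ∑ i ∈ s, |a i - b i| := by
  classical
  induction s using Finset.induction_on with
  | empty => simp
  | insert i s his ih =>
    have ih := ih (fun j hj => ha j (Finset.mem_insert_of_mem hj))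
      (fun j hj => hb j (Finset.mem_insert_of_mem hj))
    have ha0 := ha i (Finset.mem_insert_self i s)
    have hP0 : 0 ≤ ∏ j ∈ s, b j :=
      Finset.prod_nonneg fun j hj => (hb j (Finset.mem_insert_of_mem hj)).1
    have hP1 : ∏ j ∈ s, b j ≤ 1 := Finset.prod_le_one
      (fun j hj => (hb j (Finset.mem_insert_of_mem hj)).1)
      (fun j hj => (hb j (Finset.mem_insert_of_mem hj)).2)
    rw [Finset.prod_insert his, Finset.prod_insert his, Finset.sum_insert his]
    have e : a i * ∏ j ∈ s, a j - b i * ∏ j ∈ s, b j =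
        (a i - b i) * ∏ j ∈ s, b j + a i * (∏ j ∈ s, a j - ∏ j ∈ s, b j) := by ring
    rw [e]
    refine (abs_add_le _ _).trans (add_le_add ?_ ?_)
    · rw [abs_mul, abs_of_nonneg hP0]
      exact mul_le_of_le_one_right (abs_nonneg _) hP1
    · rw [abs_mul, abs_of_nonneg ha0.1]
      exact (mul_le_of_le_one_left (abs_nonneg _) ha0.2).trans ih

/-- One power of the difference of two products in `[0, 1]` is given away, the other one is bounded
by telescoping. -/
theorem sq_prod_sub_prod_le {ι : Type*} (s : Finset ι) {a b d : ι → ℝ}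
    (ha : ∀ i ∈ s, a i ∈ Icc (0 : ℝ) 1) (hb : ∀ i ∈ s, b i ∈ Icc (0 : ℝ) 1)
    (hd : ∀ i ∈ s, |a i - b i| ≤ d i) :
    (∏ i ∈ s, a i - ∏ i ∈ s, b i) ^ 2 ≤ ∑ i ∈ s, d i := by
  have h1 := abs_prod_sub_prod_le s ha hb
  have mem : ∀ {c : ι → ℝ}, (∀ i ∈ s, c i ∈ Icc (0 : ℝ) 1) → ∏ i ∈ s, c i ∈ Icc (0 : ℝ) 1 :=
    fun hc => ⟨Finset.prod_nonneg fun j hj => (hc j hj).1,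
      Finset.prod_le_one (fun j hj => (hc j hj).1) fun j hj => (hc j hj).2⟩
  have hA := mem ha
  have hB := mem hb
  have h2 : |∏ i ∈ s, a i - ∏ i ∈ s, b i| ≤ 1 := by
    rw [abs_le]; constructor <;> linarith [hA.1, hA.2, hB.1, hB.2]
  rw [← sq_abs]
  calc |∏ i ∈ s, a i - ∏ i ∈ s, b i| ^ 2 ≤ |∏ i ∈ s, a i - ∏ i ∈ s, b i| :=
        pow_le_of_le_one (abs_nonneg _) h2 two_ne_zero
    _ ≤ ∑ i ∈ s, |a i - b i| := h1
    _ ≤ _ := Finset.sum_le_sum hd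

/-- Summing the chaos coefficients of order `n + 1` against the Sobolev weight gives a power of the
convolution operator of the covariance. -/
theorem tsum_weight_mul_chaosSum_le {S : Finset (ℤ × ℤ)} {p q : ℤ × ℤ → ℝ} {D κ β : ℝ} (hD : 0 ≤ D)
    (hp : ∀ k, p k ∈ Icc (0 : ℝ) 1) (hq : ∀ k, q k ∈ Icc (0 : ℝ) 1)
    (hpq : ∀ k, |p k - q k| ≤ D * bracketSq k ^ κ) (n : ℕ) :
    ∑' k, weight β k * ENNReal.ofReal (chaosSum S (n + 1) k fun κ =>
      (∏ i, covCoef (κ i)) * (∏ i, p (κ i) - ∏ i, q (κ i)) ^ 2) ≤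
    ENNReal.ofReal D * ((n + 1) * (covOp ^ n) (convOp (fun j => ENNReal.ofReal (covCoef j) *
      ENNReal.ofReal (bracketSq j ^ κ)) (weight β)) 0) := by
  set c : (Fin (n + 1) → ℤ × ℤ) → ℝ := fun κ =>
    (∏ i, covCoef (κ i)) * (∏ i, p (κ i) - ∏ i, q (κ i)) ^ 2 with hc
  have hc0 : ∀ κ, 0 ≤ c κ := fun κ =>
    mul_nonneg (Finset.prod_nonneg fun i _ => (covCoef_pos _).le) (sq_nonneg _)
  have h1 : ∀ k, ENNReal.ofReal (chaosSum S (n + 1) k c) ≤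
      ∑' κ : Fin (n + 1) → ℤ × ℤ, if ∑ i, κ i = k then ENNReal.ofReal (c κ) else 0 := by
    intro k
    rw [chaosSum, ENNReal.ofReal_sum_of_nonneg fun κ _ => by split_ifs <;> simp [hc0]]
    refine le_trans (le_of_eq ?_) (ENNReal.sum_le_tsum (Fintype.piFinset fun _ => S))
    refine Finset.sum_congr rfl fun κ _ => ?_
    split_ifs <;> simp
  have h2 : ∀ κ' : Fin (n + 1) → ℤ × ℤ, ENNReal.ofReal (c κ') ≤ ENNReal.ofReal D *
      ((∏ i, ENNReal.ofReal (covCoef (κ' i))) * ∑ i, ENNReal.ofReal (bracketSq (κ' i) ^ κ)) := by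
    intro κ'
    have hb : ∀ k, 0 ≤ bracketSq k ^ κ := fun k => (Real.rpow_pos_of_pos (bracketSq_pos k) _).le
    rw [← ENNReal.ofReal_prod_of_nonneg fun i _ => (covCoef_pos _).le,
      ← ENNReal.ofReal_sum_of_nonneg fun i _ => hb _, ← ENNReal.ofReal_mul
      (Finset.prod_nonneg fun i _ => (covCoef_pos _).le), ← ENNReal.ofReal_mul hD]
    refine ENNReal.ofReal_le_ofReal ?_
    have := sq_prod_sub_prod_le Finset.univ (a := fun i => p (κ' i)) (b := fun i => q (κ' i))
      (fun i _ => hp _) (fun i _ => hq _) (fun i _ => hpq _)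
    rw [← Finset.mul_sum] at this
    calc c κ' ≤ (∏ i, covCoef (κ' i)) * (D * ∑ i, bracketSq (κ' i) ^ κ) :=
          mul_le_mul_of_nonneg_left this (Finset.prod_nonneg fun i _ => (covCoef_pos _).le)
      _ = _ := by ring
  calc _ ≤ ∑' k, weight β k * ∑' κ : Fin (n + 1) → ℤ × ℤ,
        (if ∑ i, κ i = k then ENNReal.ofReal (c κ) else 0) :=
        ENNReal.tsum_le_tsum fun k => by gcongr; exact h1 k
    _ = ∑' κ : Fin (n + 1) → ℤ × ℤ, ENNReal.ofReal (c κ) * weight β (0 + ∑ i, κ i) := by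
        simp_rw [← ENNReal.tsum_mul_left]
        rw [ENNReal.tsum_comm]
        refine tsum_congr fun κ => ?_
        rw [tsum_eq_single (∑ i, κ i) fun k hk => by rw [if_neg hk.symm, mul_zero], if_pos rfl,
          zero_add, mul_comm]
    _ ≤ ∑' κ' : Fin (n + 1) → ℤ × ℤ, ENNReal.ofReal D *
        (((∏ i, ENNReal.ofReal (covCoef (κ' i))) * ∑ i, ENNReal.ofReal (bracketSq (κ' i) ^ κ)) *
          weight β (0 + ∑ i, κ' i)) :=
        ENNReal.tsum_le_tsum fun κ' => by rw [← mul_assoc]; gcongr; exact h2 κ'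
    _ = _ := by
        rw [ENNReal.tsum_mul_left]
        congr 1
        exact tsum_prod_mul_sum_eq (fun j => ENNReal.ofReal (covCoef j))
          (fun j => ENNReal.ofReal (bracketSq j ^ κ)) (weight β) n 0

/-- The second moment estimate behind the convergence of the Wick exponentials. -/
theorem IsGFF.tsum_lintegral_wickTrigCoef_sub_le (h : IsGFF μ₀) {α l β κ D : ℝ} (hαl : α ^ 2 ≤ l)
    (hD : 0 ≤ D) {S : Finset (ℤ × ℤ)} (hS : ∀ k ∈ S, -k ∈ S) {p q : ℤ × ℤ → ℝ}
    (hpe : ∀ k, p (-k) = p k) (hqe : ∀ k, q (-k) = q k)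
    (hp : ∀ k, p k ∈ Icc (0 : ℝ) 1) (hq : ∀ k, q k ∈ Icc (0 : ℝ) 1)
    (hpq : ∀ k, |p k - q k| ≤ D * bracketSq k ^ κ) :
    ∑' k, ∫⁻ φ, ENNReal.ofReal (bracketSq k ^ (-β) *
      ‖wickTrigCoef α S p k φ - wickTrigCoef α S q k φ‖ ^ 2) ∂μ₀ ≤
    ENNReal.ofReal (4 * Real.pi ^ 2 * l * D) * ∑' m : ℕ, ENNReal.ofReal (l ^ m / m.factorial) *
      (covOp ^ m) (convOp (fun j => ENNReal.ofReal (covCoef j) *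
        ENNReal.ofReal (bracketSq j ^ κ)) (weight β)) 0 := by
  have hl : 0 ≤ l := (sq_nonneg _).trans hαl
  set T : ℕ → ℝ≥0∞ := fun m => (covOp ^ m) (convOp (fun j => ENNReal.ofReal (covCoef j) *
        ENNReal.ofReal (bracketSq j ^ κ)) (weight β)) 0 with hT
  set Q : (n : ℕ) → ℤ × ℤ → ℝ := fun n k => chaosSum S n k fun κ =>
    (∏ i, covCoef (κ i)) * (∏ i, p (κ i) - ∏ i, q (κ i)) ^ 2 with hQ
  have hQ0 : ∀ n k, 0 ≤ Q n k := fun n k => Finset.sum_nonneg fun κ _ => by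
    split_ifs
    · exact mul_nonneg (Finset.prod_nonneg fun i _ => (covCoef_pos _).le) (sq_nonneg _)
    · exact le_rfl
  -- Both Wick exponentials have mean one: the terms of order zero cancel.
  have hQ00 : ∀ k, Q 0 k = 0 := fun k => by simp [hQ, chaosSum]
  have h1 : ∀ k, ∫⁻ φ, ENNReal.ofReal (bracketSq k ^ (-β) *
      ‖wickTrigCoef α S p k φ - wickTrigCoef α S q k φ‖ ^ 2) ∂μ₀ =
      ∑' n : ℕ, weight β k * ENNReal.ofReal ((α ^ 2) ^ (n + 1) / (n + 1).factorial *
        (4 * Real.pi ^ 2 * Q (n + 1) k)) := by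
    intro k
    have hb : 0 ≤ bracketSq k ^ (-β) := (Real.rpow_pos_of_pos (bracketSq_pos k) _).le
    simp_rw [ENNReal.ofReal_mul hb]
    rw [lintegral_const_mul' _ _ ENNReal.ofReal_ne_top, ENNReal.tsum_mul_left,
      ← ofReal_integral_eq_lintegral_ofReal
        (integrable_norm_wickTrigCoef_sub_sq h α hS hpe hqe k) (ae_of_all _ fun _ => sq_nonneg _)]
    have hs := h.hasSum_integral_wickTrigCoef_sub α hS hpe hqe k
    rw [← hs.tsum_eq, hs.summable.tsum_eq_zero_add]
    have z := hQ00 k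
    simp only [hQ] at z
    rw [z, mul_zero, mul_zero, zero_add, ENNReal.ofReal_tsum_of_nonneg]
    · rfl
    · exact fun n => mul_nonneg (by positivity) (mul_nonneg (by positivity) (hQ0 _ _))
    · exact (summable_nat_add_iff 1).2 hs.summable
  simp_rw [h1]
  rw [ENNReal.tsum_comm, ← ENNReal.tsum_mul_left]
  refine ENNReal.tsum_le_tsum fun n => ?_
  have h2 := tsum_weight_mul_chaosSum_le (S := S) (β := β) hD hp hq hpq n
  have h3 : ∀ k, weight β k * ENNReal.ofReal ((α ^ 2) ^ (n + 1) / (n + 1).factorial *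
        (4 * Real.pi ^ 2 * Q (n + 1) k)) ≤ ENNReal.ofReal (l ^ (n + 1) / (n + 1).factorial *
        (4 * Real.pi ^ 2)) * (weight β k * ENNReal.ofReal (Q (n + 1) k)) := by
    intro k
    rw [← mul_assoc ((α ^ 2) ^ (n + 1) / ((n + 1).factorial : ℝ)), ENNReal.ofReal_mul (by positivity),
      mul_left_comm]
    gcongr
  refine (ENNReal.tsum_le_tsum h3).trans ?_
  rw [ENNReal.tsum_mul_left]
  refine (mul_le_mul_right h2 _).trans (le_of_eq ?_)
  have hn : ((n : ℝ≥0∞) + 1) = ENNReal.ofReal ((n : ℝ) + 1) := by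
    rw [ENNReal.ofReal_add (by positivity) zero_le_one, ENNReal.ofReal_natCast, ENNReal.ofReal_one]
  change _ * (_ * (_ * T n)) = _ * (_ * T n)
  rw [hn, ← mul_assoc, ← mul_assoc, ← mul_assoc (ENNReal.ofReal (4 * Real.pi ^ 2 * l * D)), ← ENNReal.ofReal_mul (by positivity),
    ← ENNReal.ofReal_mul (by positivity), ← ENNReal.ofReal_mul (by positivity)]
  congr 2
  rw [Nat.factorial_succ]
  push_cast
  have : (n.factorial : ℝ) ≠ 0 := by positivity
  field_simp
  ring

end

section

variable {μ₀ : Measure Dist}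

/-! ### Regularity of the free field -/

theorem IsGFF.memLp_fourierCoef (h : IsGFF μ₀) (k : ℤ × ℤ) :
    MemLp (fun φ => fourierCoef φ k) 2 μ₀ := by
  have hc : MemLp (fun φ : Dist => ((φ (cosTest k) : ℝ) : ℂ)) 2 μ₀ := (h.memLp_apply _).ofReal
  have hs : MemLp (fun φ : Dist => ((φ (sinTest k) : ℝ) : ℂ)) 2 μ₀ := (h.memLp_apply _).ofReal
  exact (hc.sub (hs.const_mul Complex.I)).const_mul _

theorem IsGFF.lintegral_norm_fourierCoef_sq (h : IsGFF μ₀) (k : ℤ × ℤ) :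
    ∫⁻ φ, ENNReal.ofReal (‖fourierCoef φ k‖ ^ 2) ∂μ₀ = ENNReal.ofReal (bracketSq k)⁻¹ := by
  have hi : Integrable (fun φ => ‖fourierCoef φ k‖ ^ 2) μ₀ :=
    (h.memLp_fourierCoef k).integrable_norm_pow two_ne_zero
  rw [← ofReal_integral_eq_lintegral_ofReal hi (ae_of_all _ fun _ => sq_nonneg _)]
  congr 1
  have := h.covariance k k
  rw [if_pos rfl] at this
  rw [← Complex.ofReal_inj, ← this, ← integral_complex_ofReal]
  refine integral_congr_ae (ae_of_all _ fun φ => ?_)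
  simp only [Complex.mul_conj', Complex.ofReal_pow]

/-- The mean of the squared norm is `∑ (1 + |k|²)^{-1-ε}`. -/
theorem IsGFF.ae_mem_sobolevSpace (h : IsGFF μ₀) {ε : ℝ} (hε : 0 < ε) :
    ∀ᵐ φ ∂μ₀, φ ∈ sobolevSpace (-ε) := by
  have hm : ∀ k, Measurable fun φ : Dist =>
      ENNReal.ofReal (bracketSq k ^ (-ε) * ‖fourierCoef φ k‖ ^ 2) := fun k =>
    (((measurable_fourierCoef k).norm.pow_const 2).const_mul _).ennreal_ofReal
  have h1 : ∫⁻ φ, ∑' k, ENNReal.ofReal (bracketSq k ^ (-ε) * ‖fourierCoef φ k‖ ^ 2) ∂μ₀ ≠ ⊤ := by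
    rw [lintegral_tsum fun k => (hm k).aemeasurable]
    have : ∀ k, ∫⁻ φ, ENNReal.ofReal (bracketSq k ^ (-ε) * ‖fourierCoef φ k‖ ^ 2) ∂μ₀ =
        ENNReal.ofReal (bracketSq k ^ (-(1 + ε))) := by
      intro k
      have hk := bracketSq_pos k
      have hb : 0 ≤ bracketSq k ^ (-ε) := (Real.rpow_pos_of_pos hk _).le
      simp_rw [ENNReal.ofReal_mul hb]
      rw [lintegral_const_mul' _ _ ENNReal.ofReal_ne_top, h.lintegral_norm_fourierCoef_sq,
        ← ENNReal.ofReal_mul hb, ← Real.rpow_neg_one, ← Real.rpow_add hk]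
      ring_nf
    simp_rw [this]
    exact tsum_bracketSq_rpow_ne_top (by linarith)
  filter_upwards [ae_lt_top (Measurable.tsum hm) h1] with φ hφ
  rw [sobolevSpace, mem_ofPred_eq, sobolevNorm]
  exact ENNReal.rpow_lt_top_of_nonneg (by norm_num) hφ.ne

/-- The distributions whose regularizations by symbols of decay `(1 + |k|²)⁻²` are absolutely
convergent Fourier series. -/
def IsTame (φ : Dist) : Prop := Summable fun k => bracketSq k ^ (-2 : ℝ) * ‖fourierCoef φ k‖

theorem IsGFF.ae_isTame (h : IsGFF μ₀) : ∀ᵐ φ ∂μ₀, IsTame φ := by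
  filter_upwards [h.ae_mem_sobolevSpace one_pos] with φ hφ
  have h1 : ∑' k, ENNReal.ofReal (bracketSq k ^ (-1 : ℝ) * ‖fourierCoef φ k‖ ^ 2) ≠ ⊤ := by
    rw [← sobolevNorm_sq]
    exact ENNReal.pow_ne_top (ne_of_lt hφ)
  have hb : ∀ (s : ℝ) k, 0 ≤ bracketSq k ^ s := fun s k =>
    (Real.rpow_pos_of_pos (bracketSq_pos k) _).le
  have h2 : Summable fun k => bracketSq k ^ (-1 : ℝ) * ‖fourierCoef φ k‖ ^ 2 := by
    refine (ENNReal.summable_toReal h1).congr fun k => ?_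
    exact ENNReal.toReal_ofReal (mul_nonneg (hb _ _) (sq_nonneg _))
  refine ((summable_bracketSq_rpow (s := 2) (by norm_num)).add h2).of_nonneg_of_le
    (fun k => mul_nonneg (hb _ _) (norm_nonneg _)) fun k => ?_
  have h3 : bracketSq k ^ (-2 : ℝ) ≤ bracketSq k ^ (-1 : ℝ) :=
    Real.rpow_le_rpow_of_exponent_le (one_le_bracketSq k) (by norm_num)
  nlinarith [hb (-2) k, sq_nonneg (‖fourierCoef φ k‖ - 1), norm_nonneg (fourierCoef φ k),
    mul_le_mul_of_nonneg_right h3 (sq_nonneg ‖fourierCoef φ k‖),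
    mul_nonneg (hb (-2) k) (sq_nonneg (‖fourierCoef φ k‖ - 1)),
    mul_nonneg (hb (-2) k) (norm_nonneg (fourierCoef φ k)),
    mul_nonneg (hb (-2) k) (sq_nonneg (‖fourierCoef φ k‖))]

/-! ### Wick exponentials of general regularizations -/

/-- The Fourier multipliers used for regularization: even, with values in `[0, 1]`, and of fourth
order decay. -/
structure IsSymbol (p : ℤ × ℤ → ℝ) : Prop where
  even : ∀ k, p (-k) = p k
  mem_Icc : ∀ k, p k ∈ Icc (0 : ℝ) 1
  decay : ∃ A : ℝ, ∀ k, p k ≤ A * bracketSq k ^ (-2 : ℝ)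

/-- The Wick exponential of the regularization of `φ` by the Fourier multiplier `p`. -/
def wickOf (α : ℝ) (p : ℤ × ℤ → ℝ) (φ : Dist) (x : ℝ × ℝ) : ℝ :=
  Real.exp (α * (∑' k : ℤ × ℤ, (p k : ℂ) * fourierCoef φ k * expFn k x).re -
    α ^ 2 / 2 * (1 / (4 * Real.pi ^ 2) * ∑' k : ℤ × ℤ, p k ^ 2 / bracketSq k))

theorem wickExpN_eq (ψ : ℝ × ℝ → ℝ) (α : ℝ) (N : ℕ) : wickExpN ψ α N = wickOf α (cutoffAt ψ N) :=
  rfl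

/-- The frequencies `k` with `max |k_i| ≤ R`. -/
def freqBox (R : ℕ) : Finset (ℤ × ℤ) := Finset.Icc (-(R : ℤ), -(R : ℤ)) ((R : ℤ), (R : ℤ))

theorem mem_freqBox {R : ℕ} {k : ℤ × ℤ} : k ∈ freqBox R ↔ |k.1| ≤ R ∧ |k.2| ≤ R := by
  rw [freqBox, Finset.mem_Icc, Prod.le_def, Prod.le_def, abs_le, abs_le]
  tauto

theorem neg_mem_freqBox (R : ℕ) : ∀ k ∈ freqBox R, -k ∈ freqBox R := by
  intro k hk
  rw [mem_freqBox] at hk ⊢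
  simpa using hk

theorem tendsto_freqBox : Tendsto freqBox atTop atTop := by
  refine tendsto_atTop_finset_of_monotone (fun R R' hR k hk => ?_) fun k => ?_
  · rw [mem_freqBox] at hk ⊢
    have : (R : ℤ) ≤ R' := by exact_mod_cast hR
    exact ⟨hk.1.trans this, hk.2.trans this⟩
  · refine ⟨max k.1.natAbs k.2.natAbs, mem_freqBox.2 ⟨?_, ?_⟩⟩ <;> simp

theorem re_mul_fourierCoef_mul_expFn (p : ℝ) (φ : Dist) (k : ℤ × ℤ) (x : ℝ × ℝ) :
    ((p : ℂ) * fourierCoef φ k * expFn k x).re = p / (4 * Real.pi ^ 2) *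
      (Real.cos (kdot k x) * φ (cosTest k) + Real.sin (kdot k x) * φ (sinTest k)) := by
  have e : (p : ℂ) * fourierCoef φ k * expFn k x = ((p / (4 * Real.pi ^ 2) : ℝ) : ℂ) *
      ((φ (cosTest k) - Complex.I * φ (sinTest k)) *
        (Real.cos (kdot k x) + Real.sin (kdot k x) * Complex.I)) := by
    rw [fourierCoef, expFn, mul_comm Complex.I (kdot k x : ℂ), Complex.exp_mul_I]
    push_cast
    have : (Real.pi : ℂ) ≠ 0 := by exact_mod_cast Real.pi_ne_zero
    field_simp
    ring
  rw [e, Complex.re_ofReal_mul]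
  simp only [Complex.mul_re, Complex.sub_re, Complex.sub_im, Complex.add_re, Complex.add_im,
    Complex.mul_im, Complex.ofReal_re, Complex.ofReal_im, Complex.I_re, Complex.I_im]
  ring

namespace IsSymbol

variable {p q : ℤ × ℤ → ℝ} {φ : Dist}

theorem summable_norm (hp : IsSymbol p) (hφ : IsTame φ) :
    Summable fun k => p k * ‖fourierCoef φ k‖ := by
  obtain ⟨A, hA⟩ := hp.decay
  refine (hφ.mul_left A).of_nonneg_of_le (fun k => mul_nonneg (hp.mem_Icc k).1 (norm_nonneg _))
    fun k => ?_
  rw [← mul_assoc]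
  exact mul_le_mul_of_nonneg_right (hA k) (norm_nonneg _)

theorem norm_term (hp : IsSymbol p) (φ : Dist) (x : ℝ × ℝ) (k : ℤ × ℤ) :
    ‖(p k : ℂ) * fourierCoef φ k * expFn k x‖ = 1 / (2 * Real.pi) * (p k * ‖fourierCoef φ k‖) := by
  rw [norm_mul, norm_mul, Complex.norm_real, Real.norm_of_nonneg (hp.mem_Icc k).1, norm_expFn,
    mul_comm]

theorem abs_apply_fieldTest_le (hp : IsSymbol p) (hφ : IsTame φ) (S : Finset (ℤ × ℤ))
    (x : ℝ × ℝ) :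
    |φ (fieldTest S p x)| ≤ 1 / (2 * Real.pi) * ∑' k, p k * ‖fourierCoef φ k‖ := by
  rw [apply_fieldTest, ← tsum_mul_left]
  refine (Finset.abs_sum_le_sum_abs _ _).trans ?_
  refine le_trans (Finset.sum_le_sum fun k _ => ?_) (((hp.summable_norm hφ).mul_left _).sum_le_tsum S
    fun k _ => mul_nonneg (by positivity) (mul_nonneg (hp.mem_Icc k).1 (norm_nonneg _)))
  rw [← re_mul_fourierCoef_mul_expFn, ← hp.norm_term φ x]
  exact Complex.abs_re_le_norm _

theorem tendsto_apply_fieldTest (hp : IsSymbol p) (hφ : IsTame φ) (x : ℝ × ℝ) :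
    Tendsto (fun R => φ (fieldTest (freqBox R) p x)) atTop
      (𝓝 (∑' k : ℤ × ℤ, (p k : ℂ) * fourierCoef φ k * expFn k x).re) := by
  have hs : Summable fun k => (p k : ℂ) * fourierCoef φ k * expFn k x :=
    Summable.of_norm (by simp_rw [hp.norm_term]; exact (hp.summable_norm hφ).mul_left _)
  have h1 := (Complex.hasSum_re hs.hasSum).comp tendsto_freqBox
  refine h1.congr fun R => ?_
  simp only [Function.comp, re_mul_fourierCoef_mul_expFn, apply_fieldTest]

theorem covFn_zero (S : Finset (ℤ × ℤ)) (p : ℤ × ℤ → ℝ) :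
    covFn S p p 0 = ∑ k ∈ S, 1 / (4 * Real.pi ^ 2) * (p k ^ 2 / bracketSq k) := by
  refine Finset.sum_congr rfl fun k _ => ?_
  simp only [covCoef, kdot, Prod.fst_zero, Prod.snd_zero, mul_zero, add_zero, Real.cos_zero]
  ring

theorem covFn_zero_nonneg (S : Finset (ℤ × ℤ)) (p : ℤ × ℤ → ℝ) : 0 ≤ covFn S p p 0 := by
  rw [covFn_zero]
  exact Finset.sum_nonneg fun k _ => mul_nonneg (by positivity)
    (div_nonneg (sq_nonneg _) (bracketSq_pos k).le)

theorem tendsto_covFn (hp : IsSymbol p) : Tendsto (fun R => covFn (freqBox R) p p 0) atTop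
    (𝓝 (1 / (4 * Real.pi ^ 2) * ∑' k : ℤ × ℤ, p k ^ 2 / bracketSq k)) := by
  simp_rw [covFn_zero]
  obtain ⟨A, hA⟩ := hp.decay
  have hs : Summable fun k => p k ^ 2 / bracketSq k := by
    refine ((summable_bracketSq_rpow (s := 2) (by norm_num)).mul_left A).of_nonneg_of_le
      (fun k => div_nonneg (sq_nonneg _) (bracketSq_pos k).le) fun k => ?_
    refine (div_le_self (sq_nonneg _) (one_le_bracketSq k)).trans (le_trans ?_ (hA k))
    exact pow_le_of_le_one (hp.mem_Icc k).1 (hp.mem_Icc k).2 two_ne_zero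
  exact (hs.hasSum.mul_left _).comp tendsto_freqBox

theorem tendsto_wickTrig (hp : IsSymbol p) (hφ : IsTame φ) (α : ℝ) (x : ℝ × ℝ) :
    Tendsto (fun R => wickTrig α (freqBox R) p φ x) atTop (𝓝 (wickOf α p φ x)) :=
  (Real.continuous_exp.tendsto _).comp
    (((hp.tendsto_apply_fieldTest hφ x).const_mul α).sub (hp.tendsto_covFn.const_mul _))

theorem wickTrig_le (hp : IsSymbol p) (hφ : IsTame φ) (α : ℝ) (S : Finset (ℤ × ℤ)) (x : ℝ × ℝ) :
    wickTrig α S p φ x ≤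
      Real.exp (|α| * (1 / (2 * Real.pi) * ∑' k, p k * ‖fourierCoef φ k‖)) := by
  refine Real.exp_le_exp.2 ?_
  have h1 : α * φ (fieldTest S p x) ≤ |α| * (1 / (2 * Real.pi) * ∑' k, p k * ‖fourierCoef φ k‖) := by
    refine (le_abs_self _).trans ?_
    rw [abs_mul]
    exact mul_le_mul_of_nonneg_left (hp.abs_apply_fieldTest_le hφ S x) (abs_nonneg _)
  have h2 : 0 ≤ α ^ 2 / 2 * covFn S p p 0 := mul_nonneg (by positivity) (covFn_zero_nonneg S p)
  linarith

theorem integrableOn_wickOf (hp : IsSymbol p) (hφ : IsTame φ) (α : ℝ) :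
    IntegrableOn (wickOf α p φ) box := by
  have hm : Measurable (wickOf α p φ) := measurable_of_tendsto_metrizable
    (fun R => (continuous_wickTrig α (freqBox R) p φ).measurable)
    (tendsto_pi_nhds.2 fun x => hp.tendsto_wickTrig hφ α x)
  refine Integrable.of_bound hm.aestronglyMeasurable
    (Real.exp (|α| * (1 / (2 * Real.pi) * ∑' k, p k * ‖fourierCoef φ k‖))) (ae_of_all _ fun x => ?_)
  rw [Real.norm_of_nonneg (show 0 ≤ wickOf α p φ x from (Real.exp_pos _).le)]
  exact le_of_tendsto' (hp.tendsto_wickTrig hφ α x) fun R => hp.wickTrig_le hφ α _ x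

theorem tendsto_wickTrigCoef (hp : IsSymbol p) (hφ : IsTame φ) (α : ℝ) (k : ℤ × ℤ) :
    Tendsto (fun R => wickTrigCoef α (freqBox R) p k φ) atTop
      (𝓝 (fourierCoef (toDist (wickOf α p φ)) k)) := by
  rw [fourierCoef_toDist (hp.integrableOn_wickOf hφ α)]
  refine tendsto_integral_of_dominated_convergence
    (fun _ => Real.exp (|α| * (1 / (2 * Real.pi) * ∑' k, p k * ‖fourierCoef φ k‖)) *
      (1 / (2 * Real.pi))) (fun R => ?_) (integrable_const _) (fun R => ae_of_all _ fun x => ?_)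
    (ae_of_all _ fun x => ?_)
  · exact ((Complex.continuous_ofReal.comp (continuous_wickTrig α _ p φ)).mul
      (continuous_expFn _)).aestronglyMeasurable
  · rw [norm_mul, norm_expFn, Complex.norm_real,
      Real.norm_of_nonneg (show 0 ≤ wickTrig α (freqBox R) p φ x from (Real.exp_pos _).le)]
    exact mul_le_mul_of_nonneg_right (hp.wickTrig_le hφ α _ x) (by positivity)
  · exact ((Complex.continuous_ofReal.tendsto _).comp (hp.tendsto_wickTrig hφ α x)).mul_const _

theorem aemeasurable_fourierCoef_wickOf (hp : IsSymbol p) (h : IsGFF μ₀) (α : ℝ) (k : ℤ × ℤ) :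
    AEMeasurable (fun φ => fourierCoef (toDist (wickOf α p φ)) k) μ₀ :=
  aemeasurable_of_tendsto_metrizable_ae atTop
    (fun R => (stronglyMeasurable_wickTrigCoef α (freqBox R) p k).measurable.aemeasurable)
    (h.ae_isTame.mono fun _ hφ => hp.tendsto_wickTrigCoef hφ α k)

end IsSymbol

theorem aemeasurable_sobolevNorm {s : ℝ} {u : Dist → Dist}
    (hu : ∀ k, AEMeasurable (fun φ => fourierCoef (u φ) k) μ₀) :
    AEMeasurable (fun φ => sobolevNorm s (u φ)) μ₀ :=
  (AEMeasurable.tsum fun k =>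
    (((hu k).norm.pow_const 2).const_mul _).ennreal_ofReal).pow_const _

theorem IsSymbol.aemeasurable_sobolevNorm_sub {p q : ℤ × ℤ → ℝ} (hp : IsSymbol p)
    (hq : IsSymbol q) (h : IsGFF μ₀) (α s : ℝ) : AEMeasurable (fun φ =>
      sobolevNorm s (toDist (wickOf α p φ) - toDist (wickOf α q φ))) μ₀ := by
  refine aemeasurable_sobolevNorm fun k => ?_
  simp_rw [fourierCoef_sub]
  exact (hp.aemeasurable_fourierCoef_wickOf h α k).sub (hq.aemeasurable_fourierCoef_wickOf h α k)

/-- The second moment estimate passes from trigonometric to general regularizations by Fatou's lemma,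
applied once to the sum over the frequencies and once to the expectation. -/
theorem IsGFF.exists_lintegral_sobolevNorm_sub_sq_le {α β : ℝ} (hαβ : α ^ 2 / (4 * Real.pi) < β)
    (hβ : β < 1) : ∃ κ₀ : ℝ, 0 < κ₀ ∧ ∀ κ, 0 < κ → κ ≤ κ₀ → ∃ C : ℝ≥0,
      ∀ {μ₀ : Measure Dist}, IsGFF μ₀ → ∀ {p q : ℤ × ℤ → ℝ}, IsSymbol p → IsSymbol q →
      ∀ {D : ℝ}, 0 ≤ D → (∀ k, |p k - q k| ≤ D * bracketSq k ^ κ) →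
      ∫⁻ φ, sobolevNorm (-β) (toDist (wickOf α p φ) - toDist (wickOf α q φ)) ^ 2 ∂μ₀ ≤
        C * ENNReal.ofReal D := by
  have hpi := Real.pi_pos
  rw [div_lt_iff₀ (by positivity)] at hαβ
  -- A coupling strictly between `α²` and `4πβ`; unlike `α²` it is positive even for `α = 0`.
  set l := (α ^ 2 + β * (4 * Real.pi)) / 2 with hl
  have hl1 : α ^ 2 ≤ l := by rw [hl]; linarith
  have hl0 : 0 < l := by rw [hl]; nlinarith [sq_nonneg α]
  obtain ⟨κ₀, hκ₀, H⟩ := exists_tsum_covOp_pow_convOp_le hl0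
    (by rw [div_lt_iff₀ (by positivity)]; linarith) hβ
  refine ⟨κ₀, hκ₀, fun κ hκ hκ' => ?_⟩
  obtain ⟨C, hC⟩ := H κ hκ hκ'
  refine ⟨(4 * Real.pi ^ 2 * l).toNNReal * C, fun {μ₀} h {p q} hp hq {D} hD hpq => ?_⟩
  set F : ℕ → ℤ × ℤ → Dist → ℝ≥0∞ := fun R k φ => ENNReal.ofReal (bracketSq k ^ (-β) *
    ‖wickTrigCoef α (freqBox R) p k φ - wickTrigCoef α (freqBox R) q k φ‖ ^ 2) with hF
  have hFm : ∀ R k, Measurable (F R k) := fun R k =>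
    ((((stronglyMeasurable_wickTrigCoef α (freqBox R) p k).sub
      (stronglyMeasurable_wickTrigCoef α (freqBox R) q k)).measurable.norm.pow_const 2).const_mul
        _).ennreal_ofReal
  have hbound : ∀ R, ∫⁻ φ, ∑' k, F R k φ ∂μ₀ ≤
      ((4 * Real.pi ^ 2 * l).toNNReal * C : ℝ≥0) * ENNReal.ofReal D := by
    intro R
    rw [lintegral_tsum fun k => (hFm R k).aemeasurable]
    refine (h.tsum_lintegral_wickTrigCoef_sub_le hl1 hD (neg_mem_freqBox R) hp.even hq.even
      hp.mem_Icc hq.mem_Icc hpq).trans ?_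
    rw [ENNReal.ofReal_mul (by positivity), ENNReal.coe_mul, mul_right_comm]
    gcongr
    exact le_rfl
  calc ∫⁻ φ, sobolevNorm (-β) (toDist (wickOf α p φ) - toDist (wickOf α q φ)) ^ 2 ∂μ₀
      ≤ ∫⁻ φ, liminf (fun R => ∑' k, F R k φ) atTop ∂μ₀ := by
        refine lintegral_mono_ae (h.ae_isTame.mono fun φ hφ => ?_)
        have hlim : ∀ k, Tendsto (fun R => F R k φ) atTop (𝓝 (ENNReal.ofReal (bracketSq k ^ (-β) *
            ‖fourierCoef (toDist (wickOf α p φ) - toDist (wickOf α q φ)) k‖ ^ 2))) := by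
          intro k
          rw [fourierCoef_sub]
          exact ENNReal.tendsto_ofReal ((((hp.tendsto_wickTrigCoef hφ α k).sub
            (hq.tendsto_wickTrigCoef hφ α k)).norm.pow 2).const_mul _)
        rw [sobolevNorm_sq]
        simp_rw [← fun k => (hlim k).liminf_eq, ← lintegral_count]
        exact lintegral_liminf_le fun R => Measurable.of_discrete
    _ ≤ liminf (fun R => ∫⁻ φ, ∑' k, F R k φ ∂μ₀) atTop :=
        lintegral_liminf_le fun R => Measurable.tsum (hFm R)
    _ ≤ _ := liminf_le_of_le (by isBoundedDefault) fun b hb => by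
        obtain ⟨R, hR⟩ := hb.exists
        exact hR.trans (hbound R)

end

section

variable {μ₀ : Measure Dist} {ψ : ℝ × ℝ → ℝ}

/-! ### Convergence of the Wick exponentials -/

theorem bracketSq_eq_scale (N : ℕ) (k : ℤ × ℤ) :
    bracketSq k = 1 + 4 ^ N * euclNorm ((k.1 : ℝ) / 2 ^ N, (k.2 : ℝ) / 2 ^ N) ^ 2 := by
  have h4 : (4 : ℝ) ^ N = 2 ^ N * 2 ^ N := by rw [← mul_pow]; norm_num
  rw [euclNorm, Real.sq_sqrt (by positivity), bracketSq, h4]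
  have : (2 : ℝ) ^ N ≠ 0 := by positivity
  field_simp
  ring

/-- The decay `|x|^{-m}` with `m ≥ 4` of the cut-off becomes `(1 + |k|²)⁻²`, with a constant that
depends on `N`. -/
theorem IsCutoff.isSymbol (hψ : IsCutoff ψ) (N : ℕ) : IsSymbol (cutoffAt ψ N) where
  even k := by
    rw [cutoffAt, cutoffAt, ← hψ.even]
    congr 1
    simp [neg_div]
  mem_Icc k := hψ.mem_Icc _
  decay := by
    obtain ⟨m, hm, C, hC⟩ := hψ.decay
    refine ⟨4 * 16 ^ N * max 1 C, fun k => ?_⟩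
    set x : ℝ × ℝ := ((k.1 : ℝ) / 2 ^ N, (k.2 : ℝ) / 2 ^ N) with hx
    have hx0 : 0 ≤ euclNorm x := Real.sqrt_nonneg _
    have hψ0 := hψ.mem_Icc x
    have hb : bracketSq k ≤ 4 ^ N * (1 + euclNorm x ^ 2) := by
      rw [bracketSq_eq_scale N k, mul_add]
      have : (1 : ℝ) ≤ 4 ^ N := one_le_pow₀ (by norm_num)
      linarith
    have hbp := bracketSq_pos k
    have h16 : (16 : ℝ) ^ N = 4 ^ N * 4 ^ N := by rw [← mul_pow]; norm_num
    have h4 : (0 : ℝ) < 4 ^ N := by positivity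
    rw [Real.rpow_neg hbp.le, Real.rpow_two, ← div_eq_mul_inv, le_div_iff₀ (by positivity)]
    change ψ x * _ ≤ _
    have hb2 : bracketSq k ^ 2 ≤ 16 ^ N * (1 + euclNorm x ^ 2) ^ 2 := by
      rw [h16, ← sq, ← mul_pow]
      exact pow_le_pow_left₀ hbp.le hb 2
    have key : ψ x * (1 + euclNorm x ^ 2) ^ 2 ≤ 4 * max 1 C := by
      rcases le_total (euclNorm x) 1 with h1 | h1
      · have : euclNorm x ^ 2 ≤ 1 := pow_le_one₀ hx0 h1
        have h2 : (1 + euclNorm x ^ 2) ^ 2 ≤ 4 := by nlinarith [sq_nonneg (euclNorm x)]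
        have h3 : ψ x * (1 + euclNorm x ^ 2) ^ 2 ≤ 1 * 4 :=
          mul_le_mul hψ0.2 h2 (sq_nonneg _) zero_le_one
        linarith [le_max_left 1 C]
      · have h2 : (1 + euclNorm x ^ 2) ^ 2 ≤ 4 * euclNorm x ^ m := by
          have : euclNorm x ^ (4 : ℝ) ≤ euclNorm x ^ m := Real.rpow_le_rpow_of_exponent_le h1 hm
          have h4 : euclNorm x ^ (4 : ℝ) = (euclNorm x ^ 2) ^ 2 := by
            rw [← pow_mul]; exact_mod_cast Real.rpow_natCast _ 4
          have h5 : 1 ≤ euclNorm x ^ 2 := one_le_pow₀ h1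
          have h6 : (1 + euclNorm x ^ 2) ^ 2 ≤ (2 * euclNorm x ^ 2) ^ 2 :=
            pow_le_pow_left₀ (by positivity) (by linarith) 2
          rw [h4] at this
          linarith [mul_pow 2 (euclNorm x ^ 2) 2]
        calc ψ x * (1 + euclNorm x ^ 2) ^ 2 ≤ ψ x * (4 * euclNorm x ^ m) :=
              mul_le_mul_of_nonneg_left h2 hψ0.1
          _ = 4 * (euclNorm x ^ m * |ψ x|) := by rw [abs_of_nonneg hψ0.1]; ring
          _ ≤ _ := by have := hC x; linarith [le_max_right 1 C]
    calc ψ x * bracketSq k ^ 2 ≤ ψ x * (16 ^ N * (1 + euclNorm x ^ 2) ^ 2) :=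
          mul_le_mul_of_nonneg_left hb2 hψ0.1
      _ = 16 ^ N * (ψ x * (1 + euclNorm x ^ 2) ^ 2) := by ring
      _ ≤ 16 ^ N * (4 * max 1 C) := by gcongr
      _ = _ := by ring

/-- The cut-off at scale `N` differs from `1` by at most `(2^{-N} |k|)^{2κ}`. -/
theorem IsCutoff.exists_abs_sub_one_le (hψ : IsCutoff ψ) : ∃ κ₁ : ℝ, 0 < κ₁ ∧
    ∀ κ, 0 < κ → κ ≤ κ₁ → ∃ C : ℝ, 0 ≤ C ∧ ∀ N k,
      |cutoffAt ψ N k - 1| ≤ C * ((2 : ℝ) ^ (-κ) * 2 ^ (-κ)) ^ N * bracketSq k ^ κ := by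
  obtain ⟨θ, hθ, C, hC⟩ := hψ.near_zero
  refine ⟨θ / 2, by linarith [hθ.1], fun κ hκ hκθ => ⟨max 1 C, by positivity, fun N k => ?_⟩⟩
  set x : ℝ × ℝ := ((k.1 : ℝ) / 2 ^ N, (k.2 : ℝ) / 2 ^ N) with hx
  have hx0 : 0 ≤ euclNorm x := Real.sqrt_nonneg _
  have hψ0 := hψ.mem_Icc x
  have habs : |ψ x - 1| ≤ 1 := by rw [abs_le]; constructor <;> linarith [hψ0.1, hψ0.2]
  have hscale : (euclNorm x ^ 2) ^ κ ≤
      ((2 : ℝ) ^ (-κ) * 2 ^ (-κ)) ^ N * bracketSq k ^ κ := by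
    have h1 : ((2 : ℝ) ^ (-κ) * 2 ^ (-κ)) ^ N = ((4 : ℝ) ^ N)⁻¹ ^ κ := by
      rw [← Real.mul_rpow (by norm_num) (by norm_num), Real.inv_rpow (by positivity),
        ← Real.rpow_neg (by positivity), ← Real.rpow_natCast, ← Real.rpow_natCast,
        ← Real.rpow_mul (by norm_num), ← Real.rpow_mul (by norm_num)]
      norm_num [mul_comm]
    rw [h1, ← Real.mul_rpow (by positivity) (bracketSq_pos k).le]
    refine Real.rpow_le_rpow (by positivity) ?_ hκ.le
    rw [inv_mul_eq_div, le_div_iff₀ (by positivity), bracketSq_eq_scale N k, mul_comm]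
    linarith
  have hpow : (euclNorm x ^ 2) ^ κ = euclNorm x ^ (2 * κ) := by
    rw [← Real.rpow_natCast, ← Real.rpow_mul hx0]; norm_num
  -- For `|x| ≤ 1` this is the Hölder condition, since `2κ ≤ θ`; for `|x| ≥ 1` the left side is at
  -- most `1`.
  have key : |ψ x - 1| ≤ max 1 C * euclNorm x ^ (2 * κ) := by
    rcases le_total 1 (euclNorm x) with h1 | h1
    · have := Real.one_le_rpow h1 (by linarith : 0 ≤ 2 * κ)
      nlinarith [le_max_left 1 C]
    · by_cases hz : x = 0
      · rw [hz, hψ.at_zero, sub_self, abs_zero]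
        exact mul_nonneg (by positivity) (Real.rpow_nonneg (Real.sqrt_nonneg _) _)
      · have hpos : 0 < euclNorm x := by
          refine Real.sqrt_pos.2 ?_
          by_contra hle
          refine hz (Prod.ext ?_ ?_)
          · change x.1 = 0
            nlinarith [sq_nonneg x.1, sq_nonneg x.2]
          · change x.2 = 0
            nlinarith [sq_nonneg x.1, sq_nonneg x.2]
        have h2 := hC x hz
        rw [Real.rpow_neg hx0, inv_mul_le_iff₀ (Real.rpow_pos_of_pos hpos _)] at h2
        have h3 : euclNorm x ^ θ ≤ euclNorm x ^ (2 * κ) :=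
          Real.rpow_le_rpow_of_exponent_ge hpos h1 (by linarith)
        calc |ψ x - 1| ≤ euclNorm x ^ θ * C := h2
          _ ≤ euclNorm x ^ θ * max 1 C := by gcongr; exact le_max_right _ _
          _ ≤ euclNorm x ^ (2 * κ) * max 1 C := by gcongr
          _ = _ := mul_comm _ _
  rw [← hpow] at key
  refine key.trans ?_
  rw [mul_assoc]
  exact mul_le_mul_of_nonneg_left hscale (by positivity)

/-- A bound of first by second moments, where the scale `t` is free; it takes the place of the
Cauchy–Schwarz inequality. -/
theorem ENNReal_le_add_inv_mul_sq (a : ℝ≥0∞) {t : ℝ≥0∞} (ht : t ≠ 0) (ht' : t ≠ ⊤) :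
    a ≤ t + t⁻¹ * a ^ 2 := by
  rcases le_total a t with h | h
  · exact h.trans le_self_add
  · refine le_trans ?_ le_add_self
    calc a = t⁻¹ * (t * a) := by rw [← mul_assoc, ENNReal.inv_mul_cancel ht ht', one_mul]
      _ ≤ t⁻¹ * a ^ 2 := by rw [sq]; gcongr

/-- If the regularizations get close at a geometric rate, the distances of the Wick exponentials
are almost surely summable. -/
theorem exists_ae_tsum_sobolevNorm_sub_ne_top {α β : ℝ} (hαβ : α ^ 2 / (4 * Real.pi) < β)
    (hβ : β < 1) : ∃ κ₀ : ℝ, 0 < κ₀ ∧ ∀ κ, 0 < κ → κ ≤ κ₀ →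
      ∀ {μ₀ : Measure Dist}, IsGFF μ₀ → ∀ {p q : ℕ → ℤ × ℤ → ℝ}, (∀ N, IsSymbol (p N)) →
      (∀ N, IsSymbol (q N)) → ∀ {D s : ℝ}, 0 ≤ D → 0 < s → s < 1 →
      (∀ N k, |p N k - q N k| ≤ D * (s * s) ^ N * bracketSq k ^ κ) →
      ∀ᵐ φ ∂μ₀, ∑' N, sobolevNorm (-β) (toDist (wickOf α (p N) φ) - toDist (wickOf α (q N) φ)) ≠ ⊤ := by
  obtain ⟨κ₀, hκ₀, H⟩ := IsGFF.exists_lintegral_sobolevNorm_sub_sq_le hαβ hβ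
  refine ⟨κ₀, hκ₀, fun κ hκ hκ' {μ₀} h {p q} hp hq {D s} hD hs hs1 hpq => ?_⟩
  obtain ⟨C, hC⟩ := H κ hκ hκ'
  have := h.isProbabilityMeasure
  set a : ℕ → Dist → ℝ≥0∞ := fun N φ =>
    sobolevNorm (-β) (toDist (wickOf α (p N) φ) - toDist (wickOf α (q N) φ)) with ha
  have ham : ∀ N, AEMeasurable (a N) μ₀ := fun N => (hp N).aemeasurable_sobolevNorm_sub (hq N) h α _
  set t : ℝ≥0∞ := ENNReal.ofReal s with ht
  have ht0 : t ≠ 0 := by rw [ht]; simpa using hs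
  have htt : t ≠ ⊤ := ENNReal.ofReal_ne_top
  have ht1 : t < 1 := by rw [ht]; exact ENNReal.ofReal_lt_one.2 hs1
  have hN : ∀ N, ∫⁻ φ, a N φ ∂μ₀ ≤ t ^ N * (1 + C * ENNReal.ofReal D) := by
    intro N
    have h1 := hC h (hp N) (hq N) (mul_nonneg hD (by positivity)) (hpq N)
    have h2 : ENNReal.ofReal (D * (s * s) ^ N) = ENNReal.ofReal D * (t ^ N * t ^ N) := by
      rw [ENNReal.ofReal_mul hD, ENNReal.ofReal_pow (by positivity), ENNReal.ofReal_mul hs.le,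
        mul_pow]
    -- The second moment is of order `t ^ (2 * N)`, so that `t ^ N` is the right scale for the distance.
    have htN : t ^ N ≠ 0 := pow_ne_zero _ ht0
    have htN' : t ^ N ≠ ⊤ := ENNReal.pow_ne_top htt
    calc ∫⁻ φ, a N φ ∂μ₀ ≤ ∫⁻ φ, (t ^ N + (t ^ N)⁻¹ * a N φ ^ 2) ∂μ₀ :=
          lintegral_mono fun φ => ENNReal_le_add_inv_mul_sq _ htN htN'
      _ = t ^ N + (t ^ N)⁻¹ * ∫⁻ φ, a N φ ^ 2 ∂μ₀ := by
          rw [lintegral_add_left measurable_const, lintegral_const, measure_univ, mul_one,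
            lintegral_const_mul' _ _ (ENNReal.inv_ne_top.2 htN)]
      _ ≤ t ^ N + (t ^ N)⁻¹ * (C * (ENNReal.ofReal D * (t ^ N * t ^ N))) := by
          rw [← h2]; gcongr
      _ = t ^ N + ((t ^ N)⁻¹ * t ^ N) * (t ^ N * (C * ENNReal.ofReal D)) := by ring
      _ = _ := by rw [ENNReal.inv_mul_cancel htN htN', one_mul, mul_add, mul_one]
  have hfin : ∫⁻ φ, ∑' N, a N φ ∂μ₀ ≠ ⊤ := by
    rw [lintegral_tsum ham]
    refine ne_top_of_le_ne_top ?_ (ENNReal.tsum_le_tsum hN)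
    rw [ENNReal.tsum_mul_right, ENNReal.tsum_geometric]
    refine ENNReal.mul_ne_top (ENNReal.inv_ne_top.2 (tsub_pos_of_lt ht1).ne') ?_
    exact ENNReal.add_ne_top.2 ⟨ENNReal.one_ne_top,
      ENNReal.mul_ne_top ENNReal.coe_ne_top ENNReal.ofReal_ne_top⟩
  filter_upwards [ae_lt_top' (AEMeasurable.tsum ham) hfin] with φ hφ
  exact hφ.ne

theorem isSymbol_zero : IsSymbol fun _ => 0 where
  even _ := rfl
  mem_Icc _ := ⟨le_rfl, zero_le_one⟩
  decay := ⟨0, fun k => by simp⟩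

theorem wickOf_zero (α : ℝ) (φ : Dist) : wickOf α (fun _ => 0) φ = fun _ => 1 := by
  funext x
  simp [wickOf]

theorem sobolevNorm_toDist_one_ne_top (s : ℝ) : sobolevNorm s (toDist fun _ => 1) ≠ ⊤ := by
  have hi : IntegrableOn (fun _ : ℝ × ℝ => (1 : ℝ)) box := integrableOn_box continuous_const
  have hk : ∀ k, k ≠ 0 → fourierCoef (toDist fun _ => 1) k = 0 := by
    intro k hk
    rw [fourierCoef_toDist hi]
    simp_rw [Complex.ofReal_one, one_mul]
    rw [integral_box_expFn, if_neg (neg_ne_zero.2 hk)]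
  rw [sobolevNorm, tsum_eq_single 0 fun k h0 => by simp [hk k h0]]
  exact ENNReal.rpow_ne_top_of_nonneg (by norm_num) ENNReal.ofReal_ne_top

/-- Comparison with the multiplier `0`, whose Wick exponential is the constant `1`. -/
theorem IsSymbol.ae_sobolevNorm_wickOf_ne_top {p : ℤ × ℤ → ℝ} (hp : IsSymbol p) (h : IsGFF μ₀)
    {α β : ℝ} (hαβ : α ^ 2 / (4 * Real.pi) < β) (hβ : β < 1) :
    ∀ᵐ φ ∂μ₀, sobolevNorm (-β) (toDist (wickOf α p φ)) ≠ ⊤ := by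
  obtain ⟨κ₀, hκ₀, H⟩ := IsGFF.exists_lintegral_sobolevNorm_sub_sq_le hαβ hβ
  obtain ⟨C, hC⟩ := H κ₀ hκ₀ le_rfl
  have h1 := hC h hp isSymbol_zero zero_le_one fun k => by
    rw [sub_zero, one_mul, abs_of_nonneg (hp.mem_Icc k).1]
    exact (hp.mem_Icc k).2.trans (Real.one_le_rpow (one_le_bracketSq k) hκ₀.le)
  have h2 := ae_lt_top' ((hp.aemeasurable_sobolevNorm_sub isSymbol_zero h α (-β)).pow_const 2)
    (ne_top_of_le_ne_top (ENNReal.mul_ne_top ENNReal.coe_ne_top ENNReal.ofReal_ne_top) h1)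
  filter_upwards [h2] with φ hφ
  rw [wickOf_zero] at hφ
  have h3 := sobolevNorm_sub_le (-β) (toDist (wickOf α p φ)) (toDist fun _ => 1) 0
  rw [sub_zero, sub_zero] at h3
  refine ne_top_of_le_ne_top (ENNReal.add_ne_top.2 ⟨?_, sobolevNorm_toDist_one_ne_top _⟩) h3
  intro htop
  rw [htop] at hφ
  simp at hφ

/-- The Wick exponentials of the regularizations converge almost surely. -/
theorem IsGFF.ae_tendsto_wickExpN (h : IsGFF μ₀) (hψ : IsCutoff ψ) {α β : ℝ}
    (hαβ : α ^ 2 / (4 * Real.pi) < β) (hβ : β < 1) : ∀ᵐ φ ∂μ₀,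
    Tendsto (fun N => toDist (wickExpN ψ α N φ)) atTop (𝓝 (wickExp ψ α φ)) ∧
    wickExp ψ α φ ∈ sobolevSpace (-β) ∧
    Tendsto (fun N => sobolevNorm (-β) (toDist (wickExpN ψ α N φ) - wickExp ψ α φ)) atTop
      (𝓝 0) := by
  obtain ⟨κ₀, hκ₀, H⟩ := exists_ae_tsum_sobolevNorm_sub_ne_top hαβ hβ
  obtain ⟨κ₁, hκ₁, H₁⟩ := hψ.exists_abs_sub_one_le
  have hκ : 0 < min κ₀ κ₁ := lt_min hκ₀ hκ₁
  obtain ⟨C, hC0, hC⟩ := H₁ _ hκ (min_le_right _ _)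
  set s : ℝ := 2 ^ (-min κ₀ κ₁) with hs
  have hs0 : 0 < s := Real.rpow_pos_of_pos two_pos _
  have hs1 : s < 1 := Real.rpow_lt_one_of_one_lt_of_neg (by norm_num) (by linarith)
  have hd : ∀ N k, |cutoffAt ψ (N + 1) k - cutoffAt ψ N k| ≤
      2 * C * (s * s) ^ N * bracketSq k ^ min κ₀ κ₁ := by
    intro N k
    have e : cutoffAt ψ (N + 1) k - cutoffAt ψ N k =
        (cutoffAt ψ (N + 1) k - 1) - (cutoffAt ψ N k - 1) := by ring
    have hb : 0 ≤ bracketSq k ^ min κ₀ κ₁ := (Real.rpow_pos_of_pos (bracketSq_pos k) _).le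
    have h1 : (s * s) ^ (N + 1) ≤ (s * s) ^ N :=
      pow_le_pow_of_le_one (by positivity) (by nlinarith) (Nat.le_succ N)
    have h2 : C * (s * s) ^ (N + 1) * bracketSq k ^ min κ₀ κ₁ ≤
        C * (s * s) ^ N * bracketSq k ^ min κ₀ κ₁ := by gcongr
    rw [e]
    refine (abs_sub _ _).trans ?_
    linarith [hC N k, hC (N + 1) k]
  filter_upwards [H _ hκ (min_le_left _ _) h (fun N => hψ.isSymbol (N + 1)) hψ.isSymbol
    (by positivity) hs0 hs1 hd, (hψ.isSymbol 0).ae_sobolevNorm_wickOf_ne_top h hαβ hβ] with φ h1 h2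
  obtain ⟨u, hu, hus, hun⟩ := exists_tendsto_of_tsum_sobolevNorm hβ
    (v := fun N => toDist (wickExpN ψ α N φ)) (fun N => hasParseval_toDist _) h2 h1
  have e : wickExp ψ α φ = u := hu.limUnder_eq
  rw [e]
  exact ⟨hu, hus, hun⟩

/-- Both cut-offs tend to `1` at a geometric rate, so that they are also close to each other. -/
theorem IsGFF.wickExp_ae_eq (h : IsGFF μ₀) (hψ : IsCutoff ψ) {ψ' : ℝ × ℝ → ℝ} (hψ' : IsCutoff ψ')
    {α β : ℝ} (hαβ : α ^ 2 / (4 * Real.pi) < β) (hβ : β < 1) :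
    wickExp ψ' α =ᵐ[μ₀] wickExp ψ α := by
  obtain ⟨κ₀, hκ₀, H⟩ := exists_ae_tsum_sobolevNorm_sub_ne_top hαβ hβ
  obtain ⟨κ₁, hκ₁, H₁⟩ := hψ.exists_abs_sub_one_le
  obtain ⟨κ₂, hκ₂, H₂⟩ := hψ'.exists_abs_sub_one_le
  set κ := min κ₀ (min κ₁ κ₂) with hκdef
  have hκ : 0 < κ := lt_min hκ₀ (lt_min hκ₁ hκ₂)
  obtain ⟨C, hC0, hC⟩ := H₁ κ hκ ((min_le_right _ _).trans (min_le_left _ _))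
  obtain ⟨C', hC0', hC'⟩ := H₂ κ hκ ((min_le_right _ _).trans (min_le_right _ _))
  have hd : ∀ N k, |cutoffAt ψ' N k - cutoffAt ψ N k| ≤
      (C' + C) * ((2 : ℝ) ^ (-κ) * 2 ^ (-κ)) ^ N * bracketSq k ^ κ := by
    intro N k
    have e : cutoffAt ψ' N k - cutoffAt ψ N k = (cutoffAt ψ' N k - 1) - (cutoffAt ψ N k - 1) := by
      ring
    rw [e]
    refine (abs_sub _ _).trans ?_
    linarith [hC N k, hC' N k]
  filter_upwards [H κ hκ (min_le_left _ _) h hψ'.isSymbol hψ.isSymbol (by positivity)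
    (Real.rpow_pos_of_pos two_pos _)
    (Real.rpow_lt_one_of_one_lt_of_neg (by norm_num) (by linarith)) hd,
    h.ae_tendsto_wickExpN hψ hαβ hβ, h.ae_tendsto_wickExpN hψ' hαβ hβ] with φ h1 h2 h3
  have h4 := tendsto_apply_of_sobolevNorm hβ (v := fun N =>
    toDist (wickExpN ψ' α N φ) - toDist (wickExpN ψ α N φ))
    (fun N => (hasParseval_toDist _).sub (hasParseval_toDist _))
    (ENNReal.tendsto_atTop_zero_of_tsum_ne_top h1)
  exact sub_eq_zero.1 (tendsto_nhds_unique (h3.1.sub h2.1) h4)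

end

section

variable {μ₀ : Measure Dist}

/-! ### Gibbs measures -/

section Gibbs

variable {V : Dist → ℝ}

theorem gibbs_congr {V' : Dist → ℝ} (hV : V =ᵐ[μ₀] V') : gibbs μ₀ V = gibbs μ₀ V' := by
  have h1 : (fun φ => ENNReal.ofReal (Real.exp (-V φ))) =ᵐ[μ₀]
      fun φ => ENNReal.ofReal (Real.exp (-V' φ)) := hV.mono fun φ hφ => by simp only [hφ]
  rw [gibbs, gibbs, lintegral_congr_ae h1, withDensity_congr_ae h1]

theorem gibbs_absolutelyContinuous (μ₀ : Measure Dist) (V : Dist → ℝ) : gibbs μ₀ V ≪ μ₀ :=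
  (withDensity_absolutelyContinuous _ _).smul_left _

theorem aemeasurable_exp_neg (hV : AEMeasurable V μ₀) :
    AEMeasurable (fun φ => ENNReal.ofReal (Real.exp (-V φ))) μ₀ :=
  (Real.measurable_exp.comp_aemeasurable hV.neg).ennreal_ofReal

theorem lintegral_exp_neg_ne_zero [IsProbabilityMeasure μ₀] (hV : AEMeasurable V μ₀) :
    ∫⁻ φ, ENNReal.ofReal (Real.exp (-V φ)) ∂μ₀ ≠ 0 := by
  intro h
  rw [lintegral_eq_zero_iff' (aemeasurable_exp_neg hV)] at h
  obtain ⟨φ, hφ⟩ := h.exists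
  simp at hφ
  exact absurd hφ (Real.exp_pos _).not_ge

theorem ofReal_exp_neg_le_one {x : ℝ} (hx : 0 ≤ x) : ENNReal.ofReal (Real.exp (-x)) ≤ 1 :=
  ENNReal.ofReal_le_one.2 (Real.exp_le_one_iff.2 (by linarith))

theorem lintegral_exp_neg_ne_top [IsProbabilityMeasure μ₀] (hV0 : ∀ᵐ φ ∂μ₀, 0 ≤ V φ) :
    ∫⁻ φ, ENNReal.ofReal (Real.exp (-V φ)) ∂μ₀ ≠ ⊤ := by
  refine ne_top_of_le_ne_top ENNReal.one_ne_top
    ((lintegral_mono_ae (hV0.mono fun φ hφ => ofReal_exp_neg_le_one hφ)).trans ?_)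
  simp

theorem isProbabilityMeasure_gibbs [IsProbabilityMeasure μ₀] (hV : AEMeasurable V μ₀)
    (hV0 : ∀ᵐ φ ∂μ₀, 0 ≤ V φ) : IsProbabilityMeasure (gibbs μ₀ V) := by
  constructor
  rw [gibbs, Measure.smul_apply, withDensity_apply _ MeasurableSet.univ, Measure.restrict_univ,
    smul_eq_mul]
  exact ENNReal.inv_mul_cancel (lintegral_exp_neg_ne_zero hV) (lintegral_exp_neg_ne_top hV0)

theorem rnDeriv_gibbs_le [IsProbabilityMeasure μ₀] (hV : AEMeasurable V μ₀)
    (hV0 : ∀ᵐ φ ∂μ₀, 0 ≤ V φ) : ∀ᵐ φ ∂μ₀, (gibbs μ₀ V).rnDeriv μ₀ φ ≤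
      (∫⁻ φ, ENNReal.ofReal (Real.exp (-V φ)) ∂μ₀)⁻¹ := by
  have hz := ENNReal.inv_ne_top.2 (lintegral_exp_neg_ne_zero hV)
  have e : gibbs μ₀ V = μ₀.withDensity ((∫⁻ φ, ENNReal.ofReal (Real.exp (-V φ)) ∂μ₀)⁻¹ •
      fun φ => ENNReal.ofReal (Real.exp (-V φ))) := by
    rw [gibbs, withDensity_smul' _ _ hz]
  have h1 := Measure.rnDeriv_withDensity₀ μ₀ ((aemeasurable_exp_neg hV).const_smul
    (∫⁻ φ, ENNReal.ofReal (Real.exp (-V φ)) ∂μ₀)⁻¹)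
  rw [← e] at h1
  filter_upwards [h1, hV0] with φ hφ hφ0
  rw [hφ, Pi.smul_apply, smul_eq_mul]
  exact mul_le_of_le_one_right' (ofReal_exp_neg_le_one hφ0)

theorem integral_gibbs (hV : AEMeasurable V μ₀) (F : Dist → ℝ) :
    ∫ φ, F φ ∂(gibbs μ₀ V) = (∫⁻ φ, ENNReal.ofReal (Real.exp (-V φ)) ∂μ₀)⁻¹.toReal *
      ∫ φ, Real.exp (-V φ) * F φ ∂μ₀ := by
  rw [gibbs, integral_smul_measure, smul_eq_mul, integral_withDensity_eq_integral_toReal_smul₀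
    (aemeasurable_exp_neg hV) (ae_of_all _ fun _ => ENNReal.ofReal_lt_top)]
  simp_rw [ENNReal.toReal_ofReal (Real.exp_pos _).le, smul_eq_mul]

variable {W : ℕ → Dist → ℝ}

theorem tendsto_lintegral_exp_neg [IsProbabilityMeasure μ₀] (hW : ∀ N, AEMeasurable (W N) μ₀)
    (hW0 : ∀ N, ∀ᵐ φ ∂μ₀, 0 ≤ W N φ)
    (h : ∀ᵐ φ ∂μ₀, Tendsto (fun N => W N φ) atTop (𝓝 (V φ))) :
    Tendsto (fun N => ∫⁻ φ, ENNReal.ofReal (Real.exp (-W N φ)) ∂μ₀) atTop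
      (𝓝 (∫⁻ φ, ENNReal.ofReal (Real.exp (-V φ)) ∂μ₀)) := by
  refine tendsto_lintegral_of_dominated_convergence' (fun _ => 1)
    (fun N => aemeasurable_exp_neg (hW N))
    (fun N => (hW0 N).mono fun φ hφ => ofReal_exp_neg_le_one hφ) (by simp) ?_
  filter_upwards [h] with φ hφ
  exact ENNReal.tendsto_ofReal ((Real.continuous_exp.tendsto _).comp hφ.neg)

/-- Dominated convergence: the densities `exp (-W N)` are at most `1`, and the normalizing constants
have a positive limit. The test function `F` need only be bounded and measurable. -/
theorem tendsto_integral_gibbs [IsProbabilityMeasure μ₀] (hW : ∀ N, AEMeasurable (W N) μ₀)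
    (hW0 : ∀ N, ∀ᵐ φ ∂μ₀, 0 ≤ W N φ) (hV : AEMeasurable V μ₀)
    (h : ∀ᵐ φ ∂μ₀, Tendsto (fun N => W N φ) atTop (𝓝 (V φ))) {F : Dist → ℝ} (hF : Measurable F)
    {M : ℝ} (hM : ∀ φ, |F φ| ≤ M) :
    Tendsto (fun N => ∫ φ, F φ ∂(gibbs μ₀ (W N))) atTop (𝓝 (∫ φ, F φ ∂(gibbs μ₀ V))) := by
  simp_rw [integral_gibbs (hW _), integral_gibbs hV]
  refine Tendsto.mul ?_ ?_
  · refine (ENNReal.tendsto_toReal (ENNReal.inv_ne_top.2 (lintegral_exp_neg_ne_zero hV))).comp ?_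
    exact (tendsto_lintegral_exp_neg hW hW0 h).inv
  · refine tendsto_integral_of_dominated_convergence (fun _ => M) (fun N => ?_)
      (integrable_const _) (fun N => ?_) ?_
    · exact ((Real.measurable_exp.comp_aemeasurable (hW N).neg).mul
        hF.aemeasurable).aestronglyMeasurable
    · filter_upwards [hW0 N] with φ hφ
      rw [norm_mul, Real.norm_of_nonneg (Real.exp_pos _).le]
      exact (mul_le_of_le_one_left (abs_nonneg _)
        (Real.exp_le_one_iff.2 (by linarith))).trans (hM φ)
    · filter_upwards [h] with φ hφ
      exact ((Real.continuous_exp.tendsto _).comp hφ.neg).mul_const _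

/-- The densities are at most the inverses of the normalizing constants, which converge in `(0, ∞)`. -/
theorem exists_rnDeriv_gibbs_le [IsProbabilityMeasure μ₀] (hW : ∀ N, AEMeasurable (W N) μ₀)
    (hW0 : ∀ N, ∀ᵐ φ ∂μ₀, 0 ≤ W N φ) (hV : AEMeasurable V μ₀)
    (h : ∀ᵐ φ ∂μ₀, Tendsto (fun N => W N φ) atTop (𝓝 (V φ))) :
    ∃ C : ℝ≥0, ∀ N, ∀ᵐ φ ∂μ₀, (gibbs μ₀ (W N)).rnDeriv μ₀ φ ≤ C := by
  have h1 := (ENNReal.tendsto_toReal (ENNReal.inv_ne_top.2 (lintegral_exp_neg_ne_zero hV))).comp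
    (tendsto_lintegral_exp_neg hW hW0 h).inv
  obtain ⟨C, hC⟩ := h1.bddAbove_range
  refine ⟨C.toNNReal, fun N => (rnDeriv_gibbs_le (hW N) (hW0 N)).mono fun φ hφ => hφ.trans ?_⟩
  rw [← ENNReal.ofReal_toReal (ENNReal.inv_ne_top.2 (lintegral_exp_neg_ne_zero (hW N)))]
  exact ENNReal.ofReal_le_ofReal (hC ⟨N, rfl⟩)

end Gibbs

/-! ### The total mass of the Wick exponentials -/

theorem apply_oneTest (u : Dist) : u oneTest = 2 * Real.pi * (fourierCoef u 0).re := by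
  have : cosTest 0 = oneTest := by ext x; simp [cosTest, oneTest, kdot]
  rw [fourierCoef, this, Complex.re_ofReal_mul]
  simp
  field_simp

theorem toDist_oneTest {g : ℝ × ℝ → ℝ} (hg : IntegrableOn g box) :
    toDist g oneTest = ∫ x in box, g x := by
  rw [toDist_apply hg]
  simp [oneTest]

variable {ψ : ℝ × ℝ → ℝ}

/-- The total mass is a multiple of the Fourier coefficient at frequency `0`. -/
theorem IsGFF.aemeasurable_integral_wickExpN (h : IsGFF μ₀) (hψ : IsCutoff ψ) (α : ℝ) (N : ℕ) :
    AEMeasurable (fun φ => ∫ x in box, wickExpN ψ α N φ x) μ₀ := by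
  refine (((Complex.measurable_re.comp_aemeasurable
    ((hψ.isSymbol N).aemeasurable_fourierCoef_wickOf h α 0)).const_mul (2 * Real.pi))).congr ?_
  filter_upwards [h.ae_isTame] with φ hφ
  rw [wickExpN_eq, ← toDist_oneTest ((hψ.isSymbol N).integrableOn_wickOf hφ α), apply_oneTest]
  rfl

theorem integral_wickExpN_nonneg (ψ : ℝ × ℝ → ℝ) (α : ℝ) (N : ℕ) (φ : Dist) :
    0 ≤ ∫ x in box, wickExpN ψ α N φ x :=
  integral_nonneg fun _ => (Real.exp_pos _).le

theorem IsGFF.ae_tendsto_integral_wickExpN (h : IsGFF μ₀) (hψ : IsCutoff ψ) {α β : ℝ}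
    (hαβ : α ^ 2 / (4 * Real.pi) < β) (hβ : β < 1) : ∀ᵐ φ ∂μ₀,
    Tendsto (fun N => ∫ x in box, wickExpN ψ α N φ x) atTop (𝓝 (wickExp ψ α φ oneTest)) := by
  filter_upwards [h.ae_isTame, h.ae_tendsto_wickExpN hψ hαβ hβ] with φ hφ hφ'
  refine (((continuous_apply_testFn oneTest).tendsto _).comp hφ'.1).congr fun N => ?_
  exact toDist_oneTest ((hψ.isSymbol N).integrableOn_wickOf hφ α)

end

section

/-! ### Construction of the free field -/

open ProbabilityTheory

/-- The coefficient of `f` in the orthonormal basis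
`(2π)⁻¹ (cos(k·x) + sin(k·x))`, divided by `(1 + |k|²)^{1/2}`. -/
def hartleyCoef (k : ℤ × ℤ) (f : TestFn) : ℝ :=
  (√(bracketSq k))⁻¹ * ((testCoef f k).re - (testCoef f k).im)

theorem abs_hartleyCoef_le (k : ℤ × ℤ) (f : TestFn) :
    |hartleyCoef k f| ≤ 324 * Real.pi * sumSeminorm 9 f * bracketSq k ^ (-4 : ℝ) := by
  have h1 := norm_testCoef_le f k 4
  have h2 : |(testCoef f k).re - (testCoef f k).im| ≤ 2 * ‖testCoef f k‖ := by
    refine (abs_sub _ _).trans ?_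
    linarith [Complex.abs_re_le_norm (testCoef f k), Complex.abs_im_le_norm (testCoef f k)]
  have h3 : (√(bracketSq k))⁻¹ ≤ 1 := inv_le_one_of_one_le₀ (Real.one_le_sqrt.2 (one_le_bracketSq k))
  rw [hartleyCoef, abs_mul, abs_of_nonneg (inv_nonneg.2 (Real.sqrt_nonneg _))]
  refine (mul_le_of_le_one_left (abs_nonneg _) h3).trans (h2.trans ?_)
  norm_num at h1 ⊢
  linarith

/-- The real sequences of at most quadratic growth, with constant `M`. -/
def growthSet (M : ℕ) : Set (ℤ × ℤ → ℝ) := {ξ | ∀ k, |ξ k| ≤ M * bracketSq k ^ (2 : ℝ)}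

/-- The real sequences of at most quadratic growth. -/
def slowSet : Set (ℤ × ℤ → ℝ) := ⋃ M : ℕ, growthSet M

theorem isClosed_growthSet (M : ℕ) : IsClosed (growthSet M) := by
  have : growthSet M = ⋂ k, {ξ | |ξ k| ≤ M * bracketSq k ^ (2 : ℝ)} := by
    ext ξ; simp [growthSet]
  rw [this]
  exact isClosed_iInter fun k => isClosed_le (by fun_prop) continuous_const

theorem measurableSet_slowSet : MeasurableSet slowSet :=
  MeasurableSet.iUnion fun M => (isClosed_growthSet M).measurableSet

theorem norm_mul_hartleyCoef_le {M : ℕ} {ξ : ℤ × ℤ → ℝ} (hξ : ξ ∈ growthSet M) (k : ℤ × ℤ)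
    (f : TestFn) : ‖ξ k * hartleyCoef k f‖ ≤
      M * (324 * Real.pi * sumSeminorm 9 f) * bracketSq k ^ (-2 : ℝ) := by
  have hk := bracketSq_pos k
  have e : bracketSq k ^ (-2 : ℝ) = bracketSq k ^ (2 : ℝ) * bracketSq k ^ (-4 : ℝ) := by
    rw [← Real.rpow_add hk]; norm_num
  rw [Real.norm_eq_abs, abs_mul, e]
  refine (mul_le_mul (hξ k) (abs_hartleyCoef_le k f) (abs_nonneg _) (by positivity)).trans
    (le_of_eq ?_)
  ring

theorem summable_mul_hartleyCoef {ξ : ℤ × ℤ → ℝ} (hξ : ξ ∈ slowSet) (f : TestFn) :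
    Summable fun k => ξ k * hartleyCoef k f := by
  obtain ⟨M, hM⟩ := mem_iUnion.1 hξ
  exact Summable.of_norm_bounded ((summable_bracketSq_rpow (s := 2) (by norm_num)).mul_left _)
    fun k => norm_mul_hartleyCoef_le hM k f

open Classical in
/-- The distribution `∑_k ξ_k (1 + |k|²)^{-1/2} (2π)⁻¹ (cos(k·x) + sin(k·x))`, for `ξ` of at most
quadratic growth (and `0` otherwise). -/
def hartleySeries (ξ : ℤ × ℤ → ℝ) : Dist :=
  if hξ : ξ ∈ slowSet then
    distOfBound
      { toFun := fun f => ∑' k, ξ k * hartleyCoef k f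
        map_add' := fun f g => by
          rw [← (summable_mul_hartleyCoef hξ f).tsum_add (summable_mul_hartleyCoef hξ g)]
          refine tsum_congr fun k => ?_
          rw [hartleyCoef, testCoef_add, Complex.add_re, Complex.add_im, hartleyCoef, hartleyCoef]
          ring
        map_smul' := fun c f => by
          rw [RingHom.id_apply, smul_eq_mul, ← tsum_mul_left]
          refine tsum_congr fun k => ?_
          rw [hartleyCoef, testCoef_smul, Complex.re_ofReal_mul, Complex.im_ofReal_mul, hartleyCoef]
          ring }
      (by
        obtain ⟨M, hM⟩ := mem_iUnion.1 hξ
        refine ⟨9, M * (324 * Real.pi) * ∑' k, bracketSq k ^ (-2 : ℝ), fun f => ?_⟩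
        have hs := summable_bracketSq_rpow (s := 2) (by norm_num)
        refine (tsum_of_norm_bounded (hs.hasSum.mul_left (M * (324 * Real.pi * sumSeminorm 9 f)))
          fun k => norm_mul_hartleyCoef_le hM k f).trans (le_of_eq ?_)
        ring)
  else 0

theorem hartleySeries_apply {ξ : ℤ × ℤ → ℝ} (hξ : ξ ∈ slowSet) (f : TestFn) :
    hartleySeries ξ f = ∑' k, ξ k * hartleyCoef k f := by
  rw [hartleySeries, dif_pos hξ]
  rfl

theorem continuousOn_hartleySeries (M : ℕ) : ContinuousOn hartleySeries (growthSet M) := by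
  rw [continuousOn_iff_continuous_domRestrict]
  refine WeakDual.continuous_of_continuous_eval fun f => ?_
  have h1 : (fun ξ : growthSet M => (growthSet M).domRestrict hartleySeries ξ f) =
      fun ξ : growthSet M => ∑' k, (ξ : ℤ × ℤ → ℝ) k * hartleyCoef k f :=
    funext fun ξ => hartleySeries_apply (mem_iUnion.2 ⟨M, ξ.2⟩) f
  rw [h1]
  refine continuous_tsum (fun k => ?_)
    ((summable_bracketSq_rpow (s := 2) (by norm_num)).mul_left (M * (324 * Real.pi * sumSeminorm 9 f)))
    fun k ξ => norm_mul_hartleyCoef_le ξ.2 k f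
  exact ((continuous_apply k).comp continuous_subtype_val).mul continuous_const

/-- The Borel `σ`-algebra of the weak-* topology is not generated by the evaluations in an evident way;
measurability follows instead from continuity on each of the closed sets `growthSet M`. -/
theorem measurable_hartleySeries : Measurable hartleySeries := by
  refine measurable_of_isOpen fun U hU => ?_
  have e : hartleySeries ⁻¹' U = (⋃ M : ℕ, growthSet M ∩ hartleySeries ⁻¹' U) ∪
      (slowSetᶜ ∩ hartleySeries ⁻¹' U) := by
    rw [← iUnion_inter, ← union_inter_distrib_right, ← slowSet, union_compl_self, univ_inter]
  rw [e]
  refine (MeasurableSet.iUnion fun M => ?_).union ?_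
  · obtain ⟨O, hO, hOe⟩ := (continuousOn_iff'.1 (continuousOn_hartleySeries M)) U hU
    rw [inter_comm, hOe]
    exact hO.measurableSet.inter (isClosed_growthSet M).measurableSet
  · by_cases h0 : (0 : Dist) ∈ U
    · have : slowSetᶜ ∩ hartleySeries ⁻¹' U = slowSetᶜ := by
        refine inter_eq_left.2 fun ξ hξ => ?_
        rw [mem_preimage, hartleySeries, dif_neg hξ]
        exact h0
      rw [this]
      exact measurableSet_slowSet.compl
    · have : slowSetᶜ ∩ hartleySeries ⁻¹' U = ∅ := by
        refine eq_empty_of_forall_notMem fun ξ hξ => h0 ?_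
        have := hξ.2
        rwa [mem_preimage, hartleySeries, dif_neg hξ.1] at this
      rw [this]
      exact MeasurableSet.empty

/-- Independent standard Gaussian variables indexed by `ℤ²`. -/
def whiteNoise : Measure (ℤ × ℤ → ℝ) := Measure.infinitePi fun _ => gaussianReal 0 1

instance : IsProbabilityMeasure whiteNoise := by unfold whiteNoise; infer_instance

theorem aemeasurable_eval_whiteNoise (k : ℤ × ℤ) :
    AEMeasurable (fun ξ : ℤ × ℤ → ℝ => ξ k) whiteNoise :=
  (measurable_pi_apply k).aemeasurable

theorem map_eval_whiteNoise (k : ℤ × ℤ) :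
    whiteNoise.map (fun ξ => ξ k) = gaussianReal 0 1 :=
  Measure.infinitePi_map_eval (fun _ : ℤ × ℤ => gaussianReal 0 1) k

theorem iIndepFun_whiteNoise (c : ℤ × ℤ → ℝ) :
    iIndepFun (fun k ξ => ξ k * c k) whiteNoise :=
  iIndepFun_infinitePi (X := fun k (x : ℝ) => x * c k) fun k => by fun_prop

theorem memLp_eval_whiteNoise (k : ℤ × ℤ) : MemLp (fun ξ : ℤ × ℤ → ℝ => ξ k) 2 whiteNoise := by
  have h1 : MemLp (id ∘ fun ξ : ℤ × ℤ → ℝ => ξ k) 2 whiteNoise := by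
    rw [← memLp_map_measure_iff (by fun_prop) (aemeasurable_eval_whiteNoise k), map_eval_whiteNoise]
    exact memLp_id_gaussianReal' _ (by norm_num)
  exact h1

theorem integral_eval_whiteNoise (k : ℤ × ℤ) : ∫ ξ, ξ k ∂whiteNoise = 0 := by
  have h : ∫ ξ, ξ k ∂whiteNoise = ∫ x, x ∂(whiteNoise.map fun ξ => ξ k) :=
    (integral_map (aemeasurable_eval_whiteNoise k) aestronglyMeasurable_id).symm
  rw [h, map_eval_whiteNoise, integral_id_gaussianReal]

theorem integral_eval_mul_whiteNoise (k l : ℤ × ℤ) :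
    ∫ ξ, ξ k * ξ l ∂whiteNoise = if k = l then 1 else 0 := by
  split_ifs with hkl
  · subst hkl
    have h := variance_of_integral_eq_zero (X := fun ξ : ℤ × ℤ → ℝ => ξ k) (μ := whiteNoise)
      (aemeasurable_eval_whiteNoise k) (integral_eval_whiteNoise k)
    have h2 : variance (fun ξ : ℤ × ℤ → ℝ => ξ k) whiteNoise = 1 := by
      have := variance_map (X := id) (μ := whiteNoise) (Y := fun ξ : ℤ × ℤ → ℝ => ξ k)
        (by fun_prop) (aemeasurable_eval_whiteNoise k)
      rw [map_eval_whiteNoise, variance_id_gaussianReal] at this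
      simpa using this.symm
    rw [h2] at h
    rw [h]
    exact integral_congr_ae (ae_of_all _ fun ξ => (sq _).symm)
  · have hi : IndepFun (fun ξ : ℤ × ℤ → ℝ => ξ k) (fun ξ => ξ l) whiteNoise := by
      simpa using (iIndepFun_whiteNoise fun _ => 1).indepFun hkl
    rw [hi.integral_fun_mul_eq_mul_integral
      (aemeasurable_eval_whiteNoise k).aestronglyMeasurable
      (aemeasurable_eval_whiteNoise l).aestronglyMeasurable, integral_eval_whiteNoise,
      zero_mul]

/-- Almost surely `∑ (1 + |k|²)⁻² ξ_k²` is finite. -/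
theorem ae_mem_slowSet : ∀ᵐ ξ ∂whiteNoise, ξ ∈ slowSet := by
  have hm : ∀ k, Measurable fun ξ : ℤ × ℤ → ℝ =>
      ENNReal.ofReal (bracketSq k ^ (-2 : ℝ) * (ξ k * ξ k)) := fun k => by fun_prop
  have hb : ∀ (s : ℝ) k, 0 < bracketSq k ^ s := fun s k => Real.rpow_pos_of_pos (bracketSq_pos k) _
  have h1 : ∫⁻ ξ, ∑' k, ENNReal.ofReal (bracketSq k ^ (-2 : ℝ) * (ξ k * ξ k)) ∂whiteNoise ≠ ⊤ := by
    rw [lintegral_tsum fun k => (hm k).aemeasurable]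
    have : ∀ k, ∫⁻ ξ, ENNReal.ofReal (bracketSq k ^ (-2 : ℝ) * (ξ k * ξ k)) ∂whiteNoise =
        ENNReal.ofReal (bracketSq k ^ (-2 : ℝ)) := by
      intro k
      rw [← ofReal_integral_eq_lintegral_ofReal, integral_const_mul, integral_eval_mul_whiteNoise,
        if_pos rfl, mul_one]
      · exact ((memLp_eval_whiteNoise k).integrable_mul (memLp_eval_whiteNoise k)).const_mul _
      · exact ae_of_all _ fun ξ => mul_nonneg (hb _ _).le (mul_self_nonneg _)
    simp_rw [this]
    exact tsum_bracketSq_rpow_ne_top (by norm_num)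
  filter_upwards [ae_lt_top (Measurable.tsum hm) h1] with ξ hξ
  set S := ∑' k, ENNReal.ofReal (bracketSq k ^ (-2 : ℝ) * (ξ k * ξ k)) with hS
  obtain ⟨M, hM⟩ := exists_nat_ge (max 1 S.toReal)
  refine mem_iUnion.2 ⟨M, fun k => ?_⟩
  have h2 : bracketSq k ^ (-2 : ℝ) * (ξ k * ξ k) ≤ S.toReal := by
    rw [← ENNReal.ofReal_le_iff_le_toReal hξ.ne]
    exact ENNReal.le_tsum k
  have h3 : bracketSq k ^ (2 : ℝ) * bracketSq k ^ (-2 : ℝ) = 1 := by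
    rw [← Real.rpow_add (bracketSq_pos k)]; norm_num
  have h4 : 1 ≤ bracketSq k ^ (2 : ℝ) := Real.one_le_rpow (one_le_bracketSq k) (by norm_num)
  have hM1 : (1 : ℝ) ≤ M := (le_max_left _ _).trans hM
  have hMS : S.toReal ≤ M := (le_max_right _ _).trans hM
  refine abs_le_of_sq_le_sq ?_ (by positivity)
  calc ξ k ^ 2 = bracketSq k ^ (2 : ℝ) * (bracketSq k ^ (-2 : ℝ) * (ξ k * ξ k)) := by
        rw [← mul_assoc, h3, one_mul, sq]
    _ ≤ bracketSq k ^ (2 : ℝ) * M := by gcongr; exact h2.trans hMS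
    _ ≤ bracketSq k ^ (2 : ℝ) * M * (bracketSq k ^ (2 : ℝ) * M) :=
        le_mul_of_one_le_right (by positivity) (one_le_mul_of_one_le_of_one_le h4 hM1)
    _ = _ := by ring

theorem map_sum_whiteNoise (c : ℤ × ℤ → ℝ) (S : Finset (ℤ × ℤ)) :
    whiteNoise.map (fun ξ => ∑ k ∈ S, ξ k * c k) =
      gaussianReal 0 (∑ k ∈ S, Real.nnabs (c k) ^ 2) := by
  induction S using Finset.induction_on with
  | empty => simp [Measure.map_const]
  | insert k S hk ih =>
    have h1 : whiteNoise.map (fun ξ => ξ k * c k) = gaussianReal 0 (Real.nnabs (c k) ^ 2) := by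
      have := Measure.map_map (μ := whiteNoise) (f := fun ξ : ℤ × ℤ → ℝ => ξ k)
        (g := fun x => x * c k) (by fun_prop) (by fun_prop)
      rw [map_eval_whiteNoise, gaussianReal_map_mul_const] at this
      rw [show (fun ξ : ℤ × ℤ → ℝ => ξ k * c k) = (fun x => x * c k) ∘ fun ξ => ξ k from rfl, ← this,
        mul_zero, mul_one]
      congr 1
      ext
      simp
    have hi := (iIndepFun_whiteNoise c).indepFun_finsetSum_of_notMem (fun _ => by fun_prop) hk
    have h2 := gaussianReal_add_gaussianReal_of_indepFun hi.symm h1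
      (by rw [← ih]; congr 1; ext ξ; simp)
    rw [Finset.sum_insert hk, ← add_zero (0 : ℝ), ← h2]
    congr 1
    ext ξ
    simp [Finset.sum_insert hk]

/-- Almost sure limits of centered Gaussian variables are centered Gaussian. -/
theorem map_eq_gaussianReal_of_tendsto {Ω : Type*} [MeasurableSpace Ω] {P : Measure Ω}
    [IsProbabilityMeasure P] {X : ℕ → Ω → ℝ} {Y : Ω → ℝ} (hX : ∀ n, Measurable (X n))
    (hY : AEMeasurable Y P) (h : ∀ᵐ z ∂P, Tendsto (fun n => X n z) atTop (𝓝 (Y z)))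
    {v : ℕ → ℝ≥0} {w : ℝ≥0} (hv : ∀ n, P.map (X n) = gaussianReal 0 (v n))
    (hw : Tendsto v atTop (𝓝 w)) : P.map Y = gaussianReal 0 w := by
  have := Measure.isProbabilityMeasure_map hY
  refine Measure.ext_of_charFun (funext fun t => ?_)
  have e : ∀ {Z : Ω → ℝ}, AEMeasurable Z P →
      charFun (P.map Z) t = ∫ z, Complex.exp (t * Z z * Complex.I) ∂P := by
    intro Z hZ
    rw [charFun_apply_real, integral_map hZ (by fun_prop)]
  have h1 : Tendsto (fun n => charFun (P.map (X n)) t) atTop (𝓝 (charFun (P.map Y) t)) := by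
    simp_rw [e (hX _).aemeasurable, e hY]
    refine tendsto_integral_of_dominated_convergence (fun _ => 1) (fun n => ?_)
      (integrable_const _) (fun n => ae_of_all _ fun z => ?_) ?_
    · have := hX n
      exact Measurable.aestronglyMeasurable (by fun_prop)
    · rw [← Complex.ofReal_mul, Complex.norm_exp_ofReal_mul_I]
    · filter_upwards [h] with z hz
      have hc : Continuous fun x : ℝ => Complex.exp (t * x * Complex.I) := by fun_prop
      exact (hc.tendsto _).comp hz
  have h2 : Tendsto (fun n => charFun (P.map (X n)) t) atTop (𝓝 (charFun (gaussianReal 0 w) t)) := by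
    simp_rw [hv, charFun_gaussianReal]
    have hc : Continuous fun x : ℝ≥0 =>
        Complex.exp (t * (0 : ℝ) * Complex.I - ((x : ℝ) : ℂ) * t ^ 2 / 2) := by fun_prop
    exact (hc.tendsto _).comp hw
  exact tendsto_nhds_unique h1 h2

/-- The pairings with test functions are limits of finite linear combinations of independent Gaussian
variables. -/
theorem exists_map_hartleySeries (f : TestFn) : ∃ v : ℝ≥0,
    (whiteNoise.map hartleySeries).map (fun φ : Dist => φ f) = gaussianReal 0 v := by
  have hs : Summable fun k => Real.nnabs (hartleyCoef k f) ^ 2 := by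
    rw [← NNReal.summable_coe]
    set B := 324 * Real.pi * sumSeminorm 9 f with hB
    refine ((summable_bracketSq_rpow (s := 8) (by norm_num)).mul_left (B ^ 2)).of_nonneg_of_le
      (fun k => by positivity) fun k => ?_
    have e : bracketSq k ^ (-8 : ℝ) = (bracketSq k ^ (-4 : ℝ)) ^ 2 := by
      rw [← Real.rpow_natCast, ← Real.rpow_mul (bracketSq_pos k).le]; norm_num
    rw [e, ← mul_pow, NNReal.coe_pow, Real.coe_nnabs]
    exact pow_le_pow_left₀ (abs_nonneg _) (abs_hartleyCoef_le k f) 2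
  refine ⟨∑' k, Real.nnabs (hartleyCoef k f) ^ 2, ?_⟩
  rw [Measure.map_map (measurable_apply_testFn f) measurable_hartleySeries]
  refine map_eq_gaussianReal_of_tendsto
    (X := fun R ξ => ∑ k ∈ freqBox R, ξ k * hartleyCoef k f) (fun R => by fun_prop)
    ((measurable_apply_testFn f).comp measurable_hartleySeries).aemeasurable ?_
    (fun R => map_sum_whiteNoise (fun k => hartleyCoef k f) (freqBox R))
    (hs.hasSum.comp tendsto_freqBox)
  filter_upwards [ae_mem_slowSet] with ξ hξ
  rw [Function.comp, hartleySeries_apply hξ]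
  exact (summable_mul_hartleyCoef hξ f).hasSum.comp tendsto_freqBox

theorem testCoef_cosTest (l k : ℤ × ℤ) : testCoef (cosTest l) k =
    Real.pi * ((if k = l then 1 else 0) + (if k = -l then 1 else 0)) := by
  have e : ∀ x, (((cosTest l : ℝ × ℝ → ℝ) x : ℝ) : ℂ) * expFn (-k) x =
      Real.pi * (expFn l x * expFn (-k) x + expFn (-l) x * expFn (-k) x) := by
    intro x
    have : (((cosTest l : ℝ × ℝ → ℝ) x : ℝ) : ℂ) = Real.pi * (expFn l x + expFn (-l) x) := by
      change ((Real.cos (kdot l x) : ℝ) : ℂ) = _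
      have : (Real.pi : ℂ) ≠ 0 := by exact_mod_cast Real.pi_ne_zero
      rw [expFn_def, expFn_def, kdot_neg, Complex.ofReal_cos, Complex.cos]
      push_cast
      field_simp
    rw [this]; ring
  have hi : ∀ m n : ℤ × ℤ, IntegrableOn (fun x => expFn m x * expFn n x) box := fun m n =>
    integrableOn_box (by fun_prop)
  rw [testCoef]
  simp_rw [e]
  rw [integral_const_mul, integral_add (hi _ _) (hi _ _), integral_box_expFn_mul,
    integral_box_expFn_mul]
  have c1 : l + -k = 0 ↔ k = l := by rw [← sub_eq_add_neg, sub_eq_zero, eq_comm]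
  have c2 : -l + -k = 0 ↔ k = -l := by rw [← sub_eq_add_neg, sub_eq_zero, eq_comm]
  simp only [c1, c2]

theorem testCoef_sinTest (l k : ℤ × ℤ) : testCoef (sinTest l) k =
    -(Real.pi * ((if k = l then 1 else 0) - (if k = -l then 1 else 0))) * Complex.I := by
  have e : ∀ x, (((sinTest l : ℝ × ℝ → ℝ) x : ℝ) : ℂ) * expFn (-k) x =
      (-Real.pi * Complex.I) * (expFn l x * expFn (-k) x - expFn (-l) x * expFn (-k) x) := by
    intro x
    have : (((sinTest l : ℝ × ℝ → ℝ) x : ℝ) : ℂ) =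
        (-Real.pi * Complex.I) * (expFn l x - expFn (-l) x) := by
      change ((Real.sin (kdot l x) : ℝ) : ℂ) = _
      have : (Real.pi : ℂ) ≠ 0 := by exact_mod_cast Real.pi_ne_zero
      rw [expFn_def, expFn_def, kdot_neg, Complex.ofReal_sin, Complex.sin]
      push_cast
      field_simp
      ring
    rw [this]; ring
  have hi : ∀ m n : ℤ × ℤ, IntegrableOn (fun x => expFn m x * expFn n x) box := fun m n =>
    integrableOn_box (by fun_prop)
  rw [testCoef]
  simp_rw [e]
  rw [integral_const_mul, integral_sub (hi _ _) (hi _ _), integral_box_expFn_mul,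
    integral_box_expFn_mul]
  have c1 : l + -k = 0 ↔ k = l := by rw [← sub_eq_add_neg, sub_eq_zero, eq_comm]
  have c2 : -l + -k = 0 ↔ k = -l := by rw [← sub_eq_add_neg, sub_eq_zero, eq_comm]
  simp only [c1, c2]
  ring

/-- Only the terms at `±l` contribute. For `l = 0` the two terms coincide, and the formulas still
hold. -/
theorem hartleySeries_trig {ξ : ℤ × ℤ → ℝ} (hξ : ξ ∈ slowSet) (l : ℤ × ℤ) :
    hartleySeries ξ (cosTest l) = (√(bracketSq l))⁻¹ * Real.pi * (ξ l + ξ (-l)) ∧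
    hartleySeries ξ (sinTest l) = (√(bracketSq l))⁻¹ * Real.pi * (ξ l - ξ (-l)) := by
  have key : ∀ (c : ℝ) (a : ℤ × ℤ), HasSum (fun k => if k = a then c else 0) c := fun c a =>
    hasSum_ite_eq a c
  rw [hartleySeries_apply hξ, hartleySeries_apply hξ]
  constructor
  · have h := (key ((√(bracketSq l))⁻¹ * Real.pi * ξ l) l).add
      (key ((√(bracketSq l))⁻¹ * Real.pi * ξ (-l)) (-l))
    rw [mul_add, ← h.tsum_eq]
    refine tsum_congr fun k => ?_
    have hre : hartleyCoef k (cosTest l) = (√(bracketSq k))⁻¹ *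
        (Real.pi * ((if k = l then 1 else 0) + (if k = -l then 1 else 0))) := by
      rw [hartleyCoef, testCoef_cosTest]
      split_ifs <;> simp
    rw [hre]
    split_ifs with h1 h2 h2
    · rw [← h2, ← h1]; ring
    · rw [← h1]; ring
    · rw [h2, bracketSq_neg]; ring
    · ring
  · have h := (key ((√(bracketSq l))⁻¹ * Real.pi * ξ l) l).sub
      (key ((√(bracketSq l))⁻¹ * Real.pi * ξ (-l)) (-l))
    rw [mul_sub, ← h.tsum_eq]
    refine tsum_congr fun k => ?_
    have hre : hartleyCoef k (sinTest l) = (√(bracketSq k))⁻¹ *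
        (Real.pi * ((if k = l then 1 else 0) - (if k = -l then 1 else 0))) := by
      rw [hartleyCoef, testCoef_sinTest]
      split_ifs <;> simp
    rw [hre]
    split_ifs with h1 h2 h2
    · rw [← h2, ← h1]; ring
    · rw [← h1]; ring
    · rw [h2, bracketSq_neg]; ring
    · ring

theorem fourierCoef_hartleySeries {ξ : ℤ × ℤ → ℝ} (hξ : ξ ∈ slowSet) (l : ℤ × ℤ) :
    fourierCoef (hartleySeries ξ) l = ((√(bracketSq l))⁻¹ : ℝ) *
      (((1 - Complex.I) / 2) * ξ l + ((1 + Complex.I) / 2) * ξ (-l)) := by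
  rw [fourierCoef, (hartleySeries_trig hξ l).1, (hartleySeries_trig hξ l).2]
  have : (Real.pi : ℂ) ≠ 0 := by exact_mod_cast Real.pi_ne_zero
  push_cast
  field_simp
  ring

/-- Continuous linear functionals on distributions are evaluations at test functions. -/
theorem exists_forall_apply_eq (L : Dist →L[ℝ] ℝ) : ∃ f : TestFn, ∀ φ, L φ = φ f := by
  have h := LinearMap.mem_span_iff_continuous (𝕜 := ℝ) (E := Dist)
    (f := fun f : TestFn => (evalCLM f).toLinearMap) L.toLinearMap
  have ht : (⨅ f : TestFn, TopologicalSpace.induced (fun φ : Dist => φ f)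
      (inferInstance : TopologicalSpace ℝ)) = (inferInstance : TopologicalSpace Dist) :=
    (induced_to_pi fun (φ : Dist) (f : TestFn) => φ f).symm
  have hL : L.toLinearMap ∈
      Submodule.span ℝ (range fun f : TestFn => (evalCLM f).toLinearMap) := by
    exact h.2 (continuous_iff_le_induced.2
      ((le_of_eq ht).trans (continuous_iff_le_induced.1 L.continuous)))
  have key : ∀ l ∈ Submodule.span ℝ (range fun f : TestFn => (evalCLM f).toLinearMap),
      ∃ f : TestFn, ∀ φ : Dist, l φ = φ f := by
    intro l hl
    induction hl using Submodule.span_induction with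
    | mem l hl =>
      obtain ⟨f, rfl⟩ := hl
      exact ⟨f, fun φ => rfl⟩
    | zero => exact ⟨0, fun φ => (map_zero φ).symm⟩
    | add l l' _ _ hl hl' =>
      obtain ⟨f, hf⟩ := hl
      obtain ⟨g, hg⟩ := hl'
      exact ⟨f + g, fun φ => by rw [LinearMap.add_apply, hf, hg, map_add]⟩
    | smul c l _ hl =>
      obtain ⟨f, hf⟩ := hl
      exact ⟨c • f, fun φ => by rw [LinearMap.smul_apply, hf, map_smul]⟩
  exact key _ hL

theorem covariance_hartleySeries (k l : ℤ × ℤ) :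
    ∫ φ, fourierCoef φ k * (starRingEnd ℂ) (fourierCoef φ l) ∂(whiteNoise.map hartleySeries) =
      if k = l then (((bracketSq k)⁻¹ : ℝ) : ℂ) else 0 := by
  have hm := fun k => measurable_fourierCoef k
  have hkl : Measurable fun φ : Dist => fourierCoef φ k * (starRingEnd ℂ) (fourierCoef φ l) :=
    (hm k).mul (Complex.continuous_conj.measurable.comp (hm l))
  rw [integral_map measurable_hartleySeries.aemeasurable hkl.aestronglyMeasurable]
  have e : ∀ᵐ ξ ∂whiteNoise, fourierCoef (hartleySeries ξ) k *
      (starRingEnd ℂ) (fourierCoef (hartleySeries ξ) l) =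
      ((√(bracketSq k))⁻¹ * (√(bracketSq l))⁻¹ : ℝ) * (
        (((ξ k * ξ l + ξ (-k) * ξ (-l)) / 2 : ℝ) : ℂ) +
        (((ξ (-k) * ξ l - ξ k * ξ (-l)) / 2 : ℝ) : ℂ) * Complex.I) := by
    filter_upwards [ae_mem_slowSet] with ξ hξ
    rw [fourierCoef_hartleySeries hξ, fourierCoef_hartleySeries hξ]
    simp only [map_mul, map_add, map_sub, map_div₀, Complex.conj_ofReal, Complex.conj_I, map_one,
      map_ofNat]
    push_cast
    ring_nf
    rw [Complex.I_sq]
    ring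
  rw [integral_congr_ae e, integral_const_mul]
  have i := fun k l => (memLp_eval_whiteNoise k).integrable_mul (memLp_eval_whiteNoise l)
  have i1 : Integrable (fun ξ : ℤ × ℤ → ℝ => (((ξ k * ξ l + ξ (-k) * ξ (-l)) / 2 : ℝ) : ℂ))
    whiteNoise := (((i k l).add (i (-k) (-l))).div_const 2).ofReal
  have i2 : Integrable (fun ξ : ℤ × ℤ → ℝ => (((ξ (-k) * ξ l - ξ k * ξ (-l)) / 2 : ℝ) : ℂ))
    whiteNoise := (((i (-k) l).sub (i k (-l))).div_const 2).ofReal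
  have j1 := integral_add (i k l) (i (-k) (-l))
  have j2 := integral_sub (i (-k) l) (i k (-l))
  simp only [Pi.mul_apply, integral_eval_mul_whiteNoise] at j1 j2
  rw [integral_add i1 (i2.mul_const _), integral_mul_const, integral_complex_ofReal,
    integral_complex_ofReal, integral_div, integral_div, j1, j2]
  have c1 : -k = -l ↔ k = l := neg_inj
  have c2 : -k = l ↔ k = -l := neg_eq_iff_eq_neg
  simp only [c1, c2]
  by_cases hkl : k = l
  · subst hkl
    have : √(bracketSq k) * √(bracketSq k) = bracketSq k := Real.mul_self_sqrt (bracketSq_pos k).le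
    rw [← mul_inv, this]
    simp
  · simp [hkl]

/-- The massive Gaussian free field exists. -/
theorem exists_isGFF : ∃ μ₀ : Measure Dist, IsGFF μ₀ := by
  refine ⟨whiteNoise.map hartleySeries, ?_, fun f => ?_, fun k l => ?_⟩
  · refine isGaussian_of_map_eq_gaussianReal fun L => ?_
    obtain ⟨f, hf⟩ := exists_forall_apply_eq L
    obtain ⟨v, hv⟩ := exists_map_hartleySeries f
    refine ⟨0, v, ?_⟩
    rw [← hv]
    congr 1
    exact funext hf
  · obtain ⟨v, hv⟩ := exists_map_hartleySeries f
    have h : ∫ φ, φ f ∂(whiteNoise.map hartleySeries) =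
        ∫ x, x ∂((whiteNoise.map hartleySeries).map fun φ : Dist => φ f) :=
      (integral_map (measurable_apply_testFn f).aemeasurable aestronglyMeasurable_id).symm
    rw [h, hv, integral_id_gaussianReal]
  · exact covariance_hartleySeries k l

end

end ExpPhi

end

theorem corollary2p3 :
    (∃ μ₀ : Measure ExpPhi.Dist, ExpPhi.IsGFF μ₀) ∧
    ∀ μ₀ : Measure ExpPhi.Dist, ExpPhi.IsGFF μ₀ →
    ∀ α : ℝ, |α| < Real.sqrt (4 * Real.pi) →
    ∀ ψ : ℝ × ℝ → ℝ, ExpPhi.IsCutoff ψ →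
      -- the Wick exponential in the definition of the limit measure exists `μ₀`-a.e.
      (∀ β ∈ Ioo (α ^ 2 / (4 * Real.pi)) 1, ∀ᵐ φ ∂μ₀,
        ExpPhi.wickExp ψ α φ ∈ ExpPhi.sobolevSpace (-β) ∧
        Tendsto (fun N : ℕ => ExpPhi.sobolevNorm (-β)
          (ExpPhi.toDist (ExpPhi.wickExpN ψ α N φ) - ExpPhi.wickExp ψ α φ)) atTop (𝓝 0)) ∧
      -- and neither it nor the limit measure depends on the cut-off
      (∀ ψ' : ℝ × ℝ → ℝ, ExpPhi.IsCutoff ψ' →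
        ExpPhi.wickExp ψ' α =ᵐ[μ₀] ExpPhi.wickExp ψ α ∧
        ExpPhi.expMeasure μ₀ ψ' α = ExpPhi.expMeasure μ₀ ψ α) ∧
      -- all the measures are probability measures, with weak convergence on `𝒟'(Λ)`
      (∃ (hN : ∀ N, IsProbabilityMeasure (ExpPhi.expMeasureN μ₀ ψ α N))
          (h : IsProbabilityMeasure (ExpPhi.expMeasure μ₀ ψ α)),
        Tendsto (β := ProbabilityMeasure ExpPhi.Dist)
          (fun N => ⟨ExpPhi.expMeasureN μ₀ ψ α N, hN N⟩) atTop (𝓝 ⟨ExpPhi.expMeasure μ₀ ψ α, h⟩)) ∧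
      -- weak convergence on `H^{-ε}(Λ)` with its norm topology
      (∀ ε : ℝ, 0 < ε → ∀ F : ExpPhi.Dist → ℝ, Measurable F → (∃ M : ℝ, ∀ φ, |F φ| ≤ M) →
        ExpPhi.SobolevContinuous (-ε) F →
        Tendsto (fun N => ∫ φ, F φ ∂(ExpPhi.expMeasureN μ₀ ψ α N)) atTop
          (𝓝 (∫ φ, F φ ∂(ExpPhi.expMeasure μ₀ ψ α)))) ∧
      -- absolute continuity and support
      ExpPhi.expMeasure μ₀ ψ α ≪ μ₀ ∧
      (∀ ε : ℝ, 0 < ε →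
        (∀ N, ∀ᵐ φ ∂(ExpPhi.expMeasureN μ₀ ψ α N), φ ∈ ExpPhi.sobolevSpace (-ε)) ∧
        ∀ᵐ φ ∂(ExpPhi.expMeasure μ₀ ψ α), φ ∈ ExpPhi.sobolevSpace (-ε)) ∧
      -- uniform bound on the densities
      (∀ N, ExpPhi.expMeasureN μ₀ ψ α N ≪ μ₀) ∧
      (∃ C : ℝ≥0, ∀ N, ∀ᵐ φ ∂μ₀, (ExpPhi.expMeasureN μ₀ ψ α N).rnDeriv μ₀ φ ≤ C) := by
  refine ⟨ExpPhi.exists_isGFF, fun μ₀ h α hα ψ hψ => ?_⟩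
  have := h.isProbabilityMeasure
  have hα2 : α ^ 2 / (4 * Real.pi) < 1 := by
    have hpi := Real.pi_pos
    rw [div_lt_one (by positivity), ← sq_abs]
    exact (Real.lt_sqrt (abs_nonneg _)).1 hα
  obtain ⟨β, hβ, hβ1⟩ := exists_between hα2
  have hVm := fun N => h.aemeasurable_integral_wickExpN hψ α N
  have hV0 := fun N => ae_of_all μ₀ (ExpPhi.integral_wickExpN_nonneg ψ α N)
  have hlim := h.ae_tendsto_integral_wickExpN hψ hβ hβ1
  have hWm : AEMeasurable (fun φ => ExpPhi.wickExp ψ α φ ExpPhi.oneTest) μ₀ :=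
    aemeasurable_of_tendsto_metrizable_ae atTop hVm hlim
  have hW0 : ∀ᵐ φ ∂μ₀, 0 ≤ ExpPhi.wickExp ψ α φ ExpPhi.oneTest := by
    filter_upwards [hlim] with φ hφ
    exact ge_of_tendsto' hφ fun N => ExpPhi.integral_wickExpN_nonneg ψ α N φ
  have hPN : ∀ N, IsProbabilityMeasure (ExpPhi.expMeasureN μ₀ ψ α N) := fun N =>
    ExpPhi.isProbabilityMeasure_gibbs (hVm N) (hV0 N)
  have hP : IsProbabilityMeasure (ExpPhi.expMeasure μ₀ ψ α) :=
    ExpPhi.isProbabilityMeasure_gibbs hWm hW0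
  have hac := ExpPhi.gibbs_absolutelyContinuous μ₀
  refine ⟨fun β' hβ' => (h.ae_tendsto_wickExpN hψ hβ'.1 hβ'.2).mono fun φ hφ => hφ.2,
    fun ψ' hψ' => ?_, ⟨hPN, hP, ?_⟩, fun ε _ F hF ⟨M, hM⟩ _ =>
      ExpPhi.tendsto_integral_gibbs hVm hV0 hWm hlim hF hM, hac _, fun ε hε =>
      ⟨fun N => (hac _).ae_le (h.ae_mem_sobolevSpace hε),
        (hac _).ae_le (h.ae_mem_sobolevSpace hε)⟩, fun N => hac _,
    ExpPhi.exists_rnDeriv_gibbs_le hVm hV0 hWm hlim⟩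
  · have he := h.wickExp_ae_eq hψ hψ' hβ hβ1
    exact ⟨he, ExpPhi.gibbs_congr (he.mono fun φ hφ => by simp only [hφ])⟩
  · refine ProbabilityMeasure.tendsto_iff_forall_integral_tendsto.2 fun F => ?_
    exact ExpPhi.tendsto_integral_gibbs hVm hV0 hWm hlim F.continuous.measurable
      (fun φ => F.norm_coe_le_norm φ)
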